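/- **Lemma 4.2 (Error Equation).** Let $\Omega\subset\mathbb R^2$ be a bounded polygonal domain with boundary $\Gamma$ (without slits, i.e. $\Omega$ is the interior of its closure), let $\mathcal T_h$ be a conforming triangulation of $\Omega$ with set of edges $\mathcal E_h$, let $\bm n_e$ be a chosen unit normal of each edge $e\in\mathcal E_h$, let $\bm n$ be the outward unit normal on $\partial K$ for $K\in\mathcal T_h$, and let $k\ge 0$ be an integer. $\mathbb P_m(D)$ denotes the polynomials of degree at most $m$ on $D$, $(v,w)_{\mathcal T_h}=\sum_{K}\int_K vw\,dx$ and $\langle v,w\rangle_{\partial\mathcal T_h}=\sum_{K}\int_{\partial K}vw\,ds$. Put $$S_h=\{w\in H^1_0(\Omega): w|_K\in\mathbb P_{k+2}(K)\ \forall K\in\mathcal T_h\},$$ $$V_h=\{v=\{v_0,v_n\bm n_e\}: v_0\in S_h,\ v_n|_e\in\mathbb P_{k+1}(e)\ \forall e\in\mathcal E_h\},\qquad V_h^0=\{v\in V_h: v_n|_e=0\ \ \forall e\subset\Gamma\}.$$ For $v\in V_h$ the weak Laplacian $\Delta_w v$ is defined on each $K$ as the unique polynomial in $\mathbb P_{k+3}(K)$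 with $$(\Delta_w v,\varphi)_K=-(\nabla v_0,\nabla\varphi)_K+\langle v_n\bm n_e\cdot\bm n,\varphi\rangle_{\partial K}\qquad\forall\varphi\in\mathbb P_{k+3}(K),$$ and $\mathcal A_h(v,w)=(\Delta_w v,\Delta_w w)_{\mathcal T_h}$. Let $\pi_h$ be the elementwise $L^2(K)$ projection onto $\mathbb P_{k+3}(K)$, let $Q_n$ be the edgewise $L^2(e)$ projection onto $\mathbb P_{k+1}(e)$, let $Q_0:H^2(\Omega)\to S_h$ be any map (for instance the Scott–Zhang interpolation operator), and let $Q_hw=\{Q_0w,\,Q_n(\partial w/\partial\bm n_e)\,\bm n_e\}\in V_h$ for $w\in H^2(\Omega)$. Let $f\in L^2(\Omega)$ and let $u\in H^2_0(\Omega)$ be the solution of $\Delta^2u=f$ in $\Omega$, $u=\partial u/\partial\bm n=0$ on $\Gamma$, i.e. $(\Delta u,\Delta v)=(f,v)$ for all $v\in H_0^2(\Omega)$; assume $\Delta u\in H^1(\Omega)$ (which holds if $u\in H^3(\Omega)$), so that the trace of $\Delta u$ on the edges is defined. Let $u_h\in V_h^0$ be the solution of $\mathcal A_h(u_h,v)=(f,v_0)$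 for all $v\in V_h^0$. Then the error $e_h=Q_hu-u_h$ satisfies, for all $v=\{v_0,v_n\bm n_e\}\in V_h^0$, $$\mathcal A_h(e_h,v)=\ell_1(u,v)+\ell_2(u,v),$$ where $$\ell_1(u,v)=(\Delta_w(Q_hu)-\pi_h\Delta u,\ \Delta_w v)_{\mathcal T_h},\qquad \ell_2(u,v)=\langle\Delta u-\pi_h\Delta u,\ (\nabla v_0-v_n\bm n_e)\cdot\bm n\rangle_{\partial\mathcal T_h}.$$ -/

import Mathlib

open MeasureTheory Filter Topology Set
open scoped ENNReal ContDiff RealInnerProductSpace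

noncomputable section

namespace C0WG

/-- The Euclidean plane. -/
abbrev Plane : Type := EuclideanSpace ℝ (Fin 2)

/-! ### Sobolev spaces on an open subset of the plane -/

/-- The classical partial derivative `∂ᵢ φ`. -/
def pd (i : Fin 2) (φ : Plane → ℝ) : Plane → ℝ :=
  fun x => fderiv ℝ φ x (EuclideanSpace.single i 1)

/-- The iterated classical partial derivative `∂^α φ` for a word `α` in the two directions;
`|α|` is the length of the word. -/
def pds (α : List (Fin 2)) (φ : Plane → ℝ) : Plane → ℝ :=
  α.foldr pd φ

/-- `φ ∈ C_c^∞(Ω)`. -/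
structure IsTestFun (Ω : Set Plane) (φ : Plane → ℝ) : Prop where
  smooth : ContDiff ℝ ∞ φ
  compact : HasCompactSupport φ
  support : tsupport φ ⊆ Ω

/-- `w ∈ L²(Ω)`. -/
def MemL2 (Ω : Set Plane) (w : Plane → ℝ) : Prop :=
  MemLp w 2 (volume.restrict Ω)

/-- The `L²(Ω)` norm, with values in `[0, ∞]`. -/
def normL2 (Ω : Set Plane) (w : Plane → ℝ) : ℝ≥0∞ :=
  eLpNorm w 2 (volume.restrict Ω)

/-- `g` is the weak partial derivative `∂ᵢ w` on `Ω`. -/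
def HasWeakPd (Ω : Set Plane) (i : Fin 2) (w g : Plane → ℝ) : Prop :=
  ∀ φ : Plane → ℝ, IsTestFun Ω φ →
    ∫ x in Ω, w x * pd i φ x = -∫ x in Ω, g x * φ x

/-- `w ∈ H^m(Ω)`: all weak derivatives of order at most `m` exist and lie in `L²(Ω)`. -/
def MemH (Ω : Set Plane) : ℕ → (Plane → ℝ) → Prop
  | 0, w => MemL2 Ω w
  | m + 1, w => MemL2 Ω w ∧ ∀ i : Fin 2, ∃ g : Plane → ℝ, HasWeakPd Ω i w g ∧ MemH Ω m g

/-- `w ∈ H₀^m(Ω)`: `w ∈ H^m(Ω)` and `w` is a limit of functions of `C_c^∞(Ω)` in the norm of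
`H^m(Ω)`. The limits `G α` of the `∂^α φ_n` in `L²(Ω)` are then the weak derivatives of `w`. -/
def MemH0 (Ω : Set Plane) (m : ℕ) (w : Plane → ℝ) : Prop :=
  MemH Ω m w ∧
    ∃ (φ : ℕ → Plane → ℝ) (G : List (Fin 2) → Plane → ℝ),
      (∀ n, IsTestFun Ω (φ n)) ∧ G [] = w ∧
      ∀ α : List (Fin 2), α.length ≤ m → MemL2 Ω (G α) ∧
        Tendsto (fun n => normL2 Ω (fun x => pds α (φ n) x - G α x)) atTop (𝓝 0)

/-- The weak partial derivative `∂ᵢ w` in `L²(Ω)` (unique almost everywhere on `Ω`). -/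
def weakPd (Ω : Set Plane) (i : Fin 2) (w : Plane → ℝ) : Plane → ℝ :=
  Classical.epsilon fun g : Plane → ℝ => MemL2 Ω g ∧ HasWeakPd Ω i w g

/-- The Laplacian `Δ w = ∂₀ ∂₀ w + ∂₁ ∂₁ w` of `w ∈ H²(Ω)`. -/
def lap (Ω : Set Plane) (w : Plane → ℝ) : Plane → ℝ :=
  fun x => ∑ i : Fin 2, weakPd Ω i (weakPd Ω i w) x

lemma IsTestFun.integrable_mul_pd {Ω : Set Plane} {φ w : Plane → ℝ} (hφ : IsTestFun Ω φ)
    (hw : MemL2 Ω w) (i : Fin 2) :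
    Integrable (fun x => w x * pd i φ x) (volume.restrict Ω) := by
  have hc : Continuous (pd i φ) :=
    (hφ.smooth.continuous_fderiv (by simp)).clm_apply continuous_const
  have hs : HasCompactSupport (pd i φ) := hφ.compact.fderiv_apply ℝ _
  have h2 : MemLp (pd i φ) 2 (volume.restrict Ω) :=
    (hc.memLp_of_hasCompactSupport hs).restrict Ω
  exact MemLp.integrable_mul hw h2

lemma IsTestFun.integrable_mul {Ω : Set Plane} {φ w : Plane → ℝ} (hφ : IsTestFun Ω φ)
    (hw : MemL2 Ω w) : Integrable (fun x => w x * φ x) (volume.restrict Ω) := by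
  have h2 : MemLp φ 2 (volume.restrict Ω) :=
    (hφ.smooth.continuous.memLp_of_hasCompactSupport hφ.compact).restrict Ω
  exact MemLp.integrable_mul hw h2

lemma MemH.memL2 {Ω : Set Plane} {m : ℕ} {w : Plane → ℝ} (h : MemH Ω m w) : MemL2 Ω w := by
  cases m with
  | zero => exact h
  | succ m => exact h.1

lemma MemH.linComb {Ω : Set Plane} {m : ℕ} {v w : Plane → ℝ} (a b : ℝ)
    (hv : MemH Ω m v) (hw : MemH Ω m w) : MemH Ω m (fun x => a * v x + b * w x) := by
  induction m generalizing v w with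
  | zero => exact (MemLp.const_mul hv a).add (MemLp.const_mul hw b)
  | succ m ih =>
    refine ⟨(MemLp.const_mul hv.1 a).add (MemLp.const_mul hw.1 b), fun i => ?_⟩
    obtain ⟨g, hg, hgm⟩ := hv.2 i
    obtain ⟨g', hg', hgm'⟩ := hw.2 i
    refine ⟨fun x => a * g x + b * g' x, fun φ hφ => ?_, ih hgm hgm'⟩
    have e1 : ∀ p q r : Plane → ℝ, Integrable (fun x => p x * r x) (volume.restrict Ω) →
        Integrable (fun x => q x * r x) (volume.restrict Ω) →
        ∫ x in Ω, (a * p x + b * q x) * r x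
          = a * (∫ x in Ω, p x * r x) + b * ∫ x in Ω, q x * r x := by
      intro p q r h1 h2
      rw [← integral_const_mul, ← integral_const_mul,
        ← integral_add (h1.const_mul a) (h2.const_mul b)]
      congr 1; ext x; ring
    rw [e1 _ _ _ (hφ.integrable_mul_pd hv.1 i) (hφ.integrable_mul_pd hw.1 i),
      e1 _ _ _ (hφ.integrable_mul hgm.memL2) (hφ.integrable_mul hgm'.memL2), hg φ hφ, hg' φ hφ]
    ring

lemma pds_smooth {φ : Plane → ℝ} (h : ContDiff ℝ ∞ φ) (α : List (Fin 2)) :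
    ContDiff ℝ ∞ (pds α φ) := by
  induction α with
  | nil => exact h
  | cons i α ih => exact (ih.fderiv_right (m := ∞) (by simp)).clm_apply contDiff_const

lemma pds_linComb {φ ψ : Plane → ℝ} (h : ContDiff ℝ ∞ φ) (h' : ContDiff ℝ ∞ ψ) (a b : ℝ)
    (α : List (Fin 2)) : pds α (fun x => a * φ x + b * ψ x)
      = fun x => a * pds α φ x + b * pds α ψ x := by
  induction α with
  | nil => rfl
  | cons i α ih =>
    have hd := fun x => (((pds_smooth h α).differentiable (by simp)) x)
    have hd' := fun x => (((pds_smooth h' α).differentiable (by simp)) x)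
    change pd i (pds α _) = fun x => a * pd i (pds α φ) x + b * pd i (pds α ψ) x
    rw [ih]
    ext x
    simp only [pd]
    rw [fderiv_fun_add ((hd x).const_mul a) ((hd' x).const_mul b), fderiv_const_mul (hd x),
      fderiv_const_mul (hd' x)]
    simp

lemma MemH0.linComb {Ω : Set Plane} {m : ℕ} {v w : Plane → ℝ} (a b : ℝ)
    (hv : MemH0 Ω m v) (hw : MemH0 Ω m w) : MemH0 Ω m (fun x => a * v x + b * w x) := by
  obtain ⟨hv1, φ, G, hφ, hG, hl⟩ := hv
  obtain ⟨hw1, ψ, F, hψ, hF, hl'⟩ := hw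
  refine ⟨hv1.linComb a b hw1, fun n x => a * φ n x + b * ψ n x,
    fun α x => a * G α x + b * F α x, fun n => ⟨?_, ?_, ?_⟩, by simp only [hG, hF], fun α hα => ?_⟩
  · exact (contDiff_const.mul (hφ n).smooth).add (contDiff_const.mul (hψ n).smooth)
  · exact ((hφ n).compact.mul_left (f := fun _ => a)).add
      ((hψ n).compact.mul_left (f := fun _ => b))
  · refine (tsupport_add (fun x => a * φ n x) (fun x => b * ψ n x)).trans (union_subset ?_ ?_)
    · exact (tsupport_mul_subset_right (f := fun _ => a)).trans (hφ n).support
    · exact (tsupport_mul_subset_right (f := fun _ => b)).trans (hψ n).support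
  · obtain ⟨h1, h2⟩ := hl α hα
    obtain ⟨h1', h2'⟩ := hl' α hα
    refine ⟨(MemLp.const_mul h1 a).add (MemLp.const_mul h1' b), ?_⟩
    have key : Tendsto (fun n => ‖a‖ₑ * normL2 Ω (fun x => pds α (φ n) x - G α x)
        + ‖b‖ₑ * normL2 Ω (fun x => pds α (ψ n) x - F α x)) atTop (𝓝 0) := by
      have := (ENNReal.Tendsto.const_mul (a := ‖a‖ₑ) h2 (Or.inr (by simp))).add
        (ENNReal.Tendsto.const_mul (a := ‖b‖ₑ) h2' (Or.inr (by simp)))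
      simpa using this
    refine tendsto_of_tendsto_of_tendsto_of_le_of_le tendsto_const_nhds key
      (fun _ => zero_le) (fun n => ?_)
    rw [show (fun x => pds α (fun x => a * φ n x + b * ψ n x) x - (a * G α x + b * F α x))
      = (a • fun x => pds α (φ n) x - G α x) + (b • fun x => pds α (ψ n) x - F α x) by
        rw [pds_linComb (hφ n).smooth (hψ n).smooth]; ext x; simp; ring]
    have m1 : AEStronglyMeasurable (fun x => pds α (φ n) x - G α x) (volume.restrict Ω) :=
      (pds_smooth (hφ n).smooth α).continuous.aestronglyMeasurable.sub h1.1
    have m2 : AEStronglyMeasurable (fun x => pds α (ψ n) x - F α x) (volume.restrict Ω) :=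
      (pds_smooth (hψ n).smooth α).continuous.aestronglyMeasurable.sub h1'.1
    refine (eLpNorm_add_le (m1.const_smul a) (m2.const_smul b) (by norm_num)).trans ?_
    rw [eLpNorm_const_smul, eLpNorm_const_smul]
    rfl

lemma MemH.zero (Ω : Set Plane) (m : ℕ) : MemH Ω m (fun _ => 0) := by
  induction m with
  | zero => exact MemLp.zero
  | succ m ih => exact ⟨MemLp.zero, fun i => ⟨fun _ => 0, fun φ _ => by simp, ih⟩⟩

lemma pds_zero (α : List (Fin 2)) : pds α (fun _ => 0) = fun _ => 0 := by
  induction α with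
  | nil => rfl
  | cons i α ih =>
    change pd i (pds α _) = _
    rw [ih]; ext x; simp [pd]

lemma MemH0.zero (Ω : Set Plane) (m : ℕ) : MemH0 Ω m (fun _ => 0) := by
  refine ⟨MemH.zero Ω m, fun _ _ => 0, fun _ _ => 0, fun _ => ⟨contDiff_const, ?_, ?_⟩, rfl,
    fun α _ => ⟨MemLp.zero, ?_⟩⟩
  · exact HasCompactSupport.zero
  · rw [show (fun _ : Plane => (0 : ℝ)) = 0 from rfl, tsupport_zero]; exact empty_subset _
  · simp [pds_zero, normL2]

/-! ### Polygonal domains and triangulations -/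

/-- A bounded polygonal domain: bounded, open, connected, bounded by finitely many segments, and
without slits (it is the interior of its closure). -/
structure IsPolygonalDomain (Ω : Set Plane) : Prop where
  isOpen : IsOpen Ω
  isConnected : IsConnected Ω
  isBounded : Bornology.IsBounded Ω
  frontier_subset : ∃ S : Finset (Plane × Plane), frontier Ω ⊆ ⋃ s ∈ S, segment ℝ s.1 s.2
  interior_closure : interior (closure Ω) = Ω

/-- A (conforming) triangulation of `Ω`: a finite simplicial complex in the plane, purely of
dimension two, whose triangles cover exactly the closure of `Ω`. -/
structure Triangulation (Ω : Set Plane) extends Geometry.SimplicialComplex ℝ Plane where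
  finite_faces : faces.Finite
  pure_two : ∀ s ∈ faces, ∃ t ∈ faces, s ⊆ t ∧ t.card = 3
  space_eq : toSimplicialComplex.space = closure Ω

variable {Ω : Set Plane}

/-- The elements `K ∈ 𝒯_h`, given by their three vertices. -/
def Triangulation.Elem (T : Triangulation Ω) : Type :=
  {s : Finset Plane // s ∈ T.faces ∧ s.card = 3}

/-- The edges `e ∈ ℰ_h`, given by their two endpoints. -/
def Triangulation.Edge (T : Triangulation Ω) : Type :=
  {s : Finset Plane // s ∈ T.faces ∧ s.card = 2}

instance (T : Triangulation Ω) : Fintype T.Elem :=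
  (T.finite_faces.subset fun _ h => h.1 :
    {s : Finset Plane | s ∈ T.faces ∧ s.card = 3}.Finite).fintype

instance (T : Triangulation Ω) : Fintype T.Edge :=
  (T.finite_faces.subset fun _ h => h.1 :
    {s : Finset Plane | s ∈ T.faces ∧ s.card = 2}.Finite).fintype

/-- The closed triangle `K`. -/
def Triangulation.Elem.cell {T : Triangulation Ω} (K : T.Elem) : Set Plane :=
  convexHull ℝ (K.1 : Set Plane)

/-- The closed segment `e`. -/
def Triangulation.Edge.cell {T : Triangulation Ω} (e : T.Edge) : Set Plane :=
  convexHull ℝ (e.1 : Set Plane)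

open Classical in
/-- The three edges of `K`, whose union is `∂K`. -/
def Triangulation.Elem.edges {T : Triangulation Ω} (K : T.Elem) : Finset T.Edge :=
  Finset.univ.filter fun e => e.1 ⊆ K.1

/-- Lebesgue measure on the element `K`. -/
def Triangulation.Elem.area {T : Triangulation Ω} (K : T.Elem) : Measure Plane :=
  volume.restrict K.cell

/-- Arc length `ds` on the edge `e`. -/
def Triangulation.Edge.length {T : Triangulation Ω} (e : T.Edge) : Measure Plane :=
  (Measure.hausdorffMeasure 1).restrict e.cell

/-- The barycentre of a finite set of points. -/
def barycentre (s : Finset Plane) : Plane := (s.card : ℝ)⁻¹ • ∑ x ∈ s, x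

/-- The unit normal of `e ⊆ ∂K` that points out of `K`: the normalized component, orthogonal to
`e`, of the vector from the barycentre of `K` to the midpoint of `e`. -/
def Triangulation.Elem.outward {T : Triangulation Ω} (K : T.Elem) (e : T.Edge) : Plane :=
  let w : Plane := (vectorSpan ℝ (e.1 : Set Plane))ᗮ.starProjection
    (barycentre e.1 - barycentre K.1)
  ‖w‖⁻¹ • w

/-- The family `nE` consists of one unit normal `n_e` for each edge `e`. -/
def IsNormalField (T : Triangulation Ω) (nE : T.Edge → Plane) : Prop :=
  ∀ e : T.Edge, ‖nE e‖ = 1 ∧ ∀ x ∈ e.cell, ∀ y ∈ e.cell, ⟪nE e, x - y⟫ = 0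

/-! ### Polynomials and L² representation -/

/-- `ℙ_m` as polynomial functions of total degree at most `m` on the plane. As a triangle has
interior points, this is also `ℙ_m(K)` for an element `K`. -/
def Poly (m : ℕ) : Submodule ℝ (Plane → ℝ) :=
  (MvPolynomial.restrictTotalDegree (Fin 2) ℝ m).map
    (LinearMap.pi fun x : Plane =>
      (MvPolynomial.aeval (R := ℝ) (fun i : Fin 2 => x i)).toLinearMap)

/-- `ℙ_m(e)`: restrictions to `e` of polynomials of degree at most `m`, extended by zero. -/
def Triangulation.Edge.poly {T : Triangulation Ω} (e : T.Edge) (m : ℕ) :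
    Submodule ℝ (Plane → ℝ) :=
  (Poly m).map (LinearMap.pi fun x : Plane =>
    (e.cell.indicator (fun _ => (1 : ℝ)) x) • LinearMap.proj x)

/-- The element `p` of the function space `P` with `∫ p q dμ = ℓ(q)` for all `q ∈ P`. -/
def l2Rep (μ : Measure Plane) (P : Submodule ℝ (Plane → ℝ)) (ℓ : (Plane → ℝ) → ℝ) : P :=
  Classical.epsilon fun p : P => ∀ q ∈ P, ∫ x, (p : Plane → ℝ) x * q x ∂μ = ℓ q

/-- The `L²(μ)` orthogonal projection of `w` onto `P`. -/
def l2Proj (μ : Measure Plane) (P : Submodule ℝ (Plane → ℝ)) (w : Plane → ℝ) : P :=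
  l2Rep μ P fun q => ∫ x, w x * q x ∂μ

/-! ### The weak Galerkin spaces -/

/-- The broken polynomial space `ℙ_m(𝒯_h)`. -/
abbrev BrokenPoly (T : Triangulation Ω) (m : ℕ) : Type := T.Elem → Poly m

/-- The function on the plane that equals `p_K` in the interior of each element `K`. -/
def glue {T : Triangulation Ω} {m : ℕ} (p : BrokenPoly T m) : Plane → ℝ :=
  fun x => ∑ K : T.Elem, (interior K.cell).indicator (p K : Plane → ℝ) x

lemma glue_linComb {T : Triangulation Ω} {m : ℕ} (a b : ℝ) (p q : BrokenPoly T m) :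
    glue (a • p + b • q) = fun x => a * glue p x + b * glue q x := by
  ext x
  simp only [glue, Finset.mul_sum, ← Finset.sum_add_distrib]
  refine Finset.sum_congr rfl fun K _ => ?_
  by_cases h : x ∈ interior K.cell <;> simp [h]

/-- `S_h = {w ∈ H₀¹(Ω) : w|_K ∈ ℙ_{k+2}(K) for all K ∈ 𝒯_h}`. -/
def Sh (T : Triangulation Ω) (k : ℕ) : Submodule ℝ (BrokenPoly T (k + 2)) where
  carrier := {p | MemH0 Ω 1 (glue p)}
  add_mem' {p q} hp hq := by
    have h := hp.linComb 1 1 hq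
    rw [← glue_linComb, one_smul, one_smul] at h
    exact h
  zero_mem' := by
    have h := glue_linComb 0 0 (0 : BrokenPoly T (k + 2)) 0
    simp only [smul_zero, add_zero, zero_mul] at h
    change MemH0 Ω 1 (glue 0)
    rw [h]
    exact MemH0.zero Ω 1
  smul_mem' a p hp := by
    have h := hp.linComb a 0 hp
    rw [← glue_linComb, zero_smul, add_zero] at h
    exact h

/-- `V_h = {v = {v₀, v_n n_e} : v₀ ∈ S_h, v_n ∈ ℙ_{k+1}(ℰ_h)}`, an element being recorded as the
pair `(v₀, v_n)`; the directions `n_e` enter through the weak Laplacian. -/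
abbrev Vh (T : Triangulation Ω) (k : ℕ) : Type :=
  Sh T k × ((e : T.Edge) → e.poly (k + 1))

/-- The polynomial `v₀|_K`. -/
def Vh.inner {T : Triangulation Ω} {k : ℕ} (v : Vh T k) (K : T.Elem) : Plane → ℝ :=
  ((v.1 : BrokenPoly T (k + 2)) K : Plane → ℝ)

/-- The polynomial `v_n|_e`. -/
def Vh.normal {T : Triangulation Ω} {k : ℕ} (v : Vh T k) (e : T.Edge) : Plane → ℝ :=
  (v.2 e : Plane → ℝ)

/-- `V_h⁰`: the subspace of `V_h` of all `v` with `v_n = 0` on the edges contained in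
`Γ = ∂Ω`. -/
def Vh0 (T : Triangulation Ω) (k : ℕ) : Submodule ℝ (Vh T k) where
  carrier := {v | ∀ e : T.Edge, e.cell ⊆ frontier Ω → v.2 e = 0}
  add_mem' hv hw e he := by simp [hv e he, hw e he]
  zero_mem' _ _ := rfl
  smul_mem' a v hv e he := by simp [hv e he]

/-! ### The weak Laplacian and the scheme -/

/-- The weak Laplacian `Δ_{w,m} v`: on each `K` the polynomial of `ℙ_m(K)` with
`(Δ_{w,m} v, φ)_K = -(∇v₀, ∇φ)_K + ⟨v_n n_e · n, φ⟩_{∂K}` for all `φ ∈ ℙ_m(K)`. -/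
def weakLap (T : Triangulation Ω) (nE : T.Edge → Plane) {k : ℕ} (m : ℕ) (v : Vh T k) :
    BrokenPoly T m :=
  fun K => l2Rep K.area (Poly m) fun φ =>
    -(∫ x, ⟪gradient (v.inner K) x, gradient φ x⟫ ∂K.area)
      + ∑ e ∈ K.edges, ∫ x, v.normal e x * ⟪nE e, K.outward e⟫ * φ x ∂e.length

/-- `(p, q)_{𝒯_h} = ∑_K ∫_K p q dx` for functions given element by element. -/
def prodT {T : Triangulation Ω} (p q : T.Elem → Plane → ℝ) : ℝ :=
  ∑ K : T.Elem, ∫ x, p K x * q K x ∂K.area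

/-- The values of `Δ_w v = Δ_{w,k+3} v` on the elements. -/
def dw (T : Triangulation Ω) (nE : T.Edge → Plane) {k : ℕ} (v : Vh T k) : T.Elem → Plane → ℝ :=
  fun K => (weakLap T nE (k + 3) v K : Plane → ℝ)

/-- `𝒜_h(v, w) = (Δ_w v, Δ_w w)_{𝒯_h}`. -/
def Ah (T : Triangulation Ω) (nE : T.Edge → Plane) {k : ℕ} (v w : Vh T k) : ℝ :=
  prodT (dw T nE v) (dw T nE w)

/-- `u_h ∈ V_h⁰` solves the stabilizer-free scheme `𝒜_h(u_h, v) = (f, v₀)` for all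
`v ∈ V_h⁰`. -/
def IsSchemeSolution (T : Triangulation Ω) (nE : T.Edge → Plane) {k : ℕ} (f : Plane → ℝ)
    (uh : Vh T k) : Prop :=
  uh ∈ Vh0 T k ∧ ∀ v ∈ Vh0 T k, Ah T nE uh v = ∫ x in Ω, f x * glue (v.1 : BrokenPoly T (k + 2)) x

/-- `u ∈ H₀²(Ω)` solves `Δ²u = f` in `Ω`, `u = ∂u/∂n = 0` on `∂Ω`, in the variational sense:
`(Δu, Δv) = (f, v)` for all `v ∈ H₀²(Ω)`. -/
def IsBiharmonicSolution (Ω : Set Plane) (f u : Plane → ℝ) : Prop :=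
  MemH0 Ω 2 u ∧ ∀ v : Plane → ℝ, MemH0 Ω 2 v →
    ∫ x in Ω, lap Ω u x * lap Ω v x = ∫ x in Ω, f x * v x

/-! ### Traces and the operator `Q_h` -/

/-- `g ∈ L²(e)` is the trace on `e ⊆ ∂K` of the restriction to `K` of `w ∈ H¹(Ω)`: there are
functions smooth up to the boundary that converge to `w` in `H¹(K)` and to `g` in `L²(e)`. -/
def IsTraceFrom {T : Triangulation Ω} (K : T.Elem) (e : T.Edge) (w g : Plane → ℝ) : Prop :=
  MemLp g 2 e.length ∧
    ∃ ψ : ℕ → Plane → ℝ, (∀ n, ContDiff ℝ ∞ (ψ n)) ∧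
      Tendsto (fun n => eLpNorm (fun x => ψ n x - w x) 2 K.area) atTop (𝓝 0) ∧
      (∀ i, Tendsto (fun n => eLpNorm (fun x => pd i (ψ n) x - weakPd Ω i w x) 2 K.area)
        atTop (𝓝 0)) ∧
      Tendsto (fun n => eLpNorm (fun x => ψ n x - g x) 2 e.length) atTop (𝓝 0)

/-- The trace on the edge `e` of `w ∈ H¹(Ω)`, the same from all elements that contain `e`
(unique almost everywhere on `e`). -/
def trace {T : Triangulation Ω} (e : T.Edge) (w : Plane → ℝ) : Plane → ℝ :=
  Classical.epsilon fun g : Plane → ℝ => ∀ K : T.Elem, e ∈ K.edges → IsTraceFrom K e w g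

/-- The trace on `e` of the normal derivative `∂w/∂n_e = ∇w · n_e` of `w ∈ H²(Ω)`. -/
def normalDeriv {T : Triangulation Ω} (nE : T.Edge → Plane) (e : T.Edge) (w : Plane → ℝ) :
    Plane → ℝ :=
  fun x => ∑ i : Fin 2, trace e (weakPd Ω i w) x * nE e i

/-- `Q_h w = {Q₀ w, Q_n(∂w/∂n_e) n_e}` for `w ∈ H²(Ω)`, where `Q_n` is the `L²(e)` projection
onto `ℙ_{k+1}(e)` on each edge. -/
def Qh (T : Triangulation Ω) (nE : T.Edge → Plane) {k : ℕ}
    (Q0 : {w : Plane → ℝ // MemH Ω 2 w} → Sh T k) (w : {w : Plane → ℝ // MemH Ω 2 w}) : Vh T k :=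
  (Q0 w, fun e => l2Proj e.length (e.poly (k + 1)) (normalDeriv nE e w))

/-- `π_h w`: the `L²(K)` projection of `w` onto `ℙ_{k+3}(K)` on each element `K`. -/
def piH (T : Triangulation Ω) (k : ℕ) (w : Plane → ℝ) : T.Elem → Plane → ℝ :=
  fun K => (l2Proj K.area (Poly (k + 3)) w : Plane → ℝ)

/-- `ℓ₁(u, v) = (Δ_w(Q_h u) - π_h Δu, Δ_w v)_{𝒯_h}`. -/
def ell1 (T : Triangulation Ω) (nE : T.Edge → Plane) {k : ℕ}
    (Q0 : {w : Plane → ℝ // MemH Ω 2 w} → Sh T k) (u : {w : Plane → ℝ // MemH Ω 2 w})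
    (v : Vh T k) : ℝ :=
  prodT (fun K x => dw T nE (Qh T nE Q0 u) K x - piH T k (lap Ω u) K x) (dw T nE v)

/-- `ℓ₂(u, v) = ⟨Δu - π_h Δu, (∇v₀ - v_n n_e) · n⟩_{∂𝒯_h}`. -/
def ell2 (T : Triangulation Ω) (nE : T.Edge → Plane) {k : ℕ}
    (u : {w : Plane → ℝ // MemH Ω 2 w}) (v : Vh T k) : ℝ :=
  ∑ K : T.Elem, ∑ e ∈ K.edges,
    ∫ x, (trace e (lap Ω u) x - piH T k (lap Ω u) K x)
      * ⟪gradient (v.inner K) x - v.normal e x • nE e, K.outward e⟫ ∂e.length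

end C0WG

end

open C0WG

noncomputable section

namespace C0WG

variable {Ω : Set Plane}


/-! Write `π = π_h Δu`. Testing the definition of `Δ_w v` on an element `K` with `π` gives `(π, Δ_w
v)_K = -(∇v₀, ∇π)_K + ⟨v_n n_e·n, π⟩_{∂K}`. Green's formula turns the first term into `(Δv₀, π)_K -
⟨∇v₀·n, π⟩_{∂K}`. Since `Δv₀` is a polynomial of admissible degree on `K`, `π` may be replaced by
`Δu` in `(Δv₀, π)_K`, and Green's formula is applied backwards, now to `Δu ∈ H¹`. The outcome,
`error_identity`, is `(π, Δ_w v)_K = -(∇Δu, ∇v₀)_K + ⟨Δu, v_n n_e·n⟩_{∂K}` plus the contribution of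
`K` to `ℓ₂`.

After summation over `K` the term `⟨Δu, v_n n_e·n⟩` disappears (`sum_trace_mul_normal`): `Δu` and
`v_n` are single-valued on an edge, the outward normals on an interior edge add up to zero, and `v_n
= 0` on boundary edges. The term `-(∇Δu, ∇v₀)` equals `(f, v₀)`: this holds for test functions by
the biharmonic equation and passes to `v₀ ∈ H₀¹` by density (`IsBiharmonicSolution.test_glue`).
Hence `(π, Δ_w v) = (f, v₀) + ℓ₂`, and subtracting the scheme gives the error equation, because `ℓ₁
= 𝒜_h(Q_h u, v) - (π, Δ_w v)`.

Most of the work justifies these manipulations, since weak derivatives, traces, projections and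
`Δ_w` are all specified by `Classical.epsilon` and their existence has to be shown. For `Δ_w` and
`π_h` it is the nondegeneracy of the `L²` form on polynomials (`integral_l2Rep`). For traces, smooth
functions are dense in `H¹` of a convex set (`exists_smooth_approx`), a trace inequality
(`exists_trace_bound`) carries limits to the edges, and the two one-sided traces are compared by
testing the weak derivative across the edge (`ae_eq_of_isTraceFrom`). Green's formula rests on the
divergence theorem for a triangle (`Elem.integral_fderiv`), obtained from an explicit affine
parametrization. -/

/-- The signed double area of the triangle `abc`. -/
def cross (a b c : Plane) : ℝ :=
  (b 0 - a 0) * (c 1 - a 1) - (b 1 - a 1) * (c 0 - a 0)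

/-! ### Integration over triangles and segments by affine parametrization. -/

lemma mem_convexHull_triple {a b c x : Plane} :
    x ∈ convexHull ℝ {a, b, c} ↔
      ∃ t s : ℝ, 0 ≤ t ∧ 0 ≤ s ∧ s ≤ 1 - t ∧ x = a + s • (b - a) + t • (c - a) := by
  constructor
  · intro hx
    have hsub : ({a, b, c} : Set Plane) ⊆ {x | ∃ t s : ℝ, 0 ≤ t ∧ 0 ≤ s ∧ s ≤ 1 - t ∧
        x = a + s • (b - a) + t • (c - a)} := by
      rintro y (rfl | rfl | rfl)
      · exact ⟨0, 0, le_rfl, le_rfl, by simp, by simp⟩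
      · exact ⟨0, 1, le_rfl, by simp, by simp, by simp⟩
      · exact ⟨1, 0, by simp, le_rfl, by simp, by simp⟩
    refine convexHull_min hsub ?_ hx
    rintro x ⟨t, s, ht, hs, hst, rfl⟩ y ⟨t', s', ht', hs', hst', rfl⟩ p q hp hq hpq
    refine ⟨p * t + q * t', p * s + q * s', by positivity, by positivity, ?_, ?_⟩
    · nlinarith
    · obtain rfl : q = 1 - p := by linarith
      module
  · rintro ⟨t, s, ht, hs, hst, rfl⟩
    have hc := convex_convexHull ℝ ({a, b, c} : Set Plane)
    have ha : a ∈ convexHull ℝ ({a, b, c} : Set Plane) := subset_convexHull ℝ _ (by simp)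
    have hb : b ∈ convexHull ℝ ({a, b, c} : Set Plane) := subset_convexHull ℝ _ (by simp)
    have hcc : c ∈ convexHull ℝ ({a, b, c} : Set Plane) := subset_convexHull ℝ _ (by simp)
    have := hc.sum_mem (t := Finset.univ) (w := ![1 - s - t, s, t]) (z := ![a, b, c])
      (by intro i _; fin_cases i <;> simp <;> linarith)
      (by simp [Fin.sum_univ_three]; ring) (by intro i _; fin_cases i <;> simpa)
    convert this using 1
    simp [Fin.sum_univ_three]
    module

/-- The linear part of the parametrization of a triangle. -/
def triLin (u v : Plane) : Plane →L[ℝ] Plane :=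
  (EuclideanSpace.proj (1 : Fin 2)).smulRight u + (EuclideanSpace.proj (0 : Fin 2)).smulRight v

lemma triLin_apply (u v z : Plane) : triLin u v z = z 1 • u + z 0 • v := rfl

/-- The sign is negative because coordinate `0` multiplies the second vector `v`; only the absolute
value is used. -/
lemma det_triLin (u v : Plane) : (triLin u v).det = -(u 0 * v 1 - u 1 * v 0) := by
  rw [ContinuousLinearMap.det,
    ← LinearMap.det_toMatrix (EuclideanSpace.basisFun (Fin 2) ℝ).toBasis, Matrix.det_fin_two]
  simp [LinearMap.toMatrix_apply, triLin]
  ring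

/-- The reference triangle in coordinates. -/
def refTri : Set (ℝ × ℝ) := {p | 0 ≤ p.1 ∧ 0 ≤ p.2 ∧ p.2 ≤ 1 - p.1}

lemma isClosed_refTri : IsClosed refTri :=
  (isClosed_le continuous_const continuous_fst).inter
    ((isClosed_le continuous_const continuous_snd).inter
      (isClosed_le continuous_snd (continuous_const.sub continuous_fst)))

lemma isCompact_refTri : IsCompact refTri :=
  (isCompact_Icc (a := (0 : ℝ × ℝ)) (b := 1)).of_isClosed_subset isClosed_refTri fun p hp => by
    obtain ⟨h1, h2, h3⟩ := hp
    exact ⟨⟨h1, h2⟩, ⟨by simp; linarith, by simp; linarith⟩⟩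

/-- Fubini for the indicator of `refTri`: the slice over `t` is `[0, 1 - t]`, and it is empty unless
`0 ≤ t ≤ 1`. -/
lemma setIntegral_refTri {H : ℝ × ℝ → ℝ} (hH : Continuous H) :
    ∫ p in refTri, H p = ∫ t in (0 : ℝ)..1, ∫ s in (0 : ℝ)..(1 - t), H (t, s) := by
  have hi : Integrable (refTri.indicator H) :=
    (hH.continuousOn.integrableOn_compact isCompact_refTri).integrable_indicator
      isClosed_refTri.measurableSet
  rw [← integral_indicator isClosed_refTri.measurableSet, Measure.volume_eq_prod,
    integral_prod _ (by simpa [Measure.volume_eq_prod] using hi),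
    intervalIntegral.integral_of_le zero_le_one, ← integral_Icc_eq_integral_Ioc,
    ← integral_indicator measurableSet_Icc]
  refine integral_congr_ae (Eventually.of_forall fun t => ?_)
  by_cases ht : t ∈ Icc (0 : ℝ) 1
  · simp only [indicator_of_mem ht]
    rw [intervalIntegral.integral_of_le (by linarith [ht.2]), ← integral_Icc_eq_integral_Ioc,
      ← integral_indicator measurableSet_Icc]
    congr 1
    ext s
    have : (t, s) ∈ refTri ↔ s ∈ Icc 0 (1 - t) :=
      ⟨fun h => ⟨h.2.1, h.2.2⟩, fun h => ⟨ht.1, h.1, h.2⟩⟩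
    by_cases hs : s ∈ Icc 0 (1 - t)
    · rw [indicator_of_mem hs, indicator_of_mem (this.2 hs)]
    · rw [indicator_of_notMem hs, indicator_of_notMem (fun h => hs (this.1 h))]
  · simp only [indicator_of_notMem ht]
    have : ∀ s, refTri.indicator H (t, s) = 0 := fun s =>
      indicator_of_notMem (fun h => ht ⟨h.1, by
        have := h.2.1; have := h.2.2; simp only at *; linarith⟩) _
    simp [this]

/-- Coordinates of the plane as a pair. -/
def pairEquiv : Plane ≃ᵐ ℝ × ℝ :=
  (MeasurableEquiv.toLp 2 (Fin 2 → ℝ)).symm.trans MeasurableEquiv.finTwoArrow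

lemma pairEquiv_apply (z : Plane) : pairEquiv z = (z 0, z 1) := rfl

lemma measurePreserving_pairEquiv : MeasurePreserving pairEquiv :=
  (volume_preserving_finTwoArrow ℝ).comp (EuclideanSpace.volume_preserving_symm_measurableEquiv_toLp (Fin 2))

/-- Affine change of variables. The variable `s` along `b - a` is innermost, so that a derivative in
that direction can be integrated by the fundamental theorem of calculus. -/
lemma setIntegral_triangle {a b c : Plane} (h : cross a b c ≠ 0) {G : Plane → ℝ}
    (hG : Continuous G) :
    ∫ x in convexHull ℝ {a, b, c}, G x = |cross a b c| *
      ∫ t in (0 : ℝ)..1, ∫ s in (0 : ℝ)..(1 - t), G (a + s • (b - a) + t • (c - a)) := by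
  set F : Plane → Plane := fun z => a + triLin (b - a) (c - a) z with hF
  have himg : convexHull ℝ {a, b, c} = F '' (pairEquiv ⁻¹' refTri) := by
    ext x
    rw [mem_convexHull_triple]
    constructor
    · rintro ⟨t, s, h1, h2, h3, rfl⟩
      refine ⟨!₂[t, s], ⟨?_, ?_, ?_⟩, ?_⟩ <;> simp [pairEquiv_apply, triLin_apply, *]
      rw [add_assoc]
    · rintro ⟨z, ⟨h1, h2, h3⟩, rfl⟩
      exact ⟨z 0, z 1, h1, h2, h3, by simp [hF, triLin_apply, add_assoc]⟩
  have hdet : |(triLin (b - a) (c - a)).det| = |cross a b c| := by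
    rw [det_triLin, abs_neg]; rfl
  have hdet0 : (triLin (b - a) (c - a)).det ≠ 0 := by
    rw [← abs_ne_zero, hdet]; exact abs_ne_zero.2 h
  have hinj : Function.Injective F := by
    intro x y hxy
    have h2 : triLin (b - a) (c - a) x = triLin (b - a) (c - a) y := by simpa [hF] using hxy
    exact (LinearMap.equivOfDetNeZero (triLin (b - a) (c - a) : Plane →ₗ[ℝ] Plane)
      hdet0).injective h2
  rw [himg, integral_image_eq_integral_abs_det_fderiv_smul volume
    (pairEquiv.measurable isClosed_refTri.measurableSet)
    (fun x _ => ((triLin (b - a) (c - a)).hasFDerivAt.const_add a).hasFDerivWithinAt)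
    hinj.injOn, hdet]
  simp only [smul_eq_mul]
  rw [integral_const_mul]
  congr 1
  have hcont : Continuous fun p : ℝ × ℝ => G (a + p.2 • (b - a) + p.1 • (c - a)) :=
    hG.comp (by fun_prop)
  rw [← setIntegral_refTri hcont, ← measurePreserving_pairEquiv.setIntegral_preimage_emb
    pairEquiv.measurableEmbedding]
  simp [pairEquiv_apply, triLin_apply, add_assoc]

/-- The integral of `ψ` over the segment `pq` in its affine parametrization. -/
def segInt (ψ : Plane → ℝ) (p q : Plane) : ℝ := ∫ t in (0 : ℝ)..1, ψ (p + t • (q - p))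

lemma segInt_comm (ψ : Plane → ℝ) (p q : Plane) : segInt ψ p q = segInt ψ q p := by
  have := intervalIntegral.integral_comp_sub_left (fun t => ψ (q + t • (p - q))) (a := 0) (b := 1) 1
  simp only [sub_self, sub_zero] at this
  rw [segInt, segInt, ← this]
  congr 1; ext t; congr 1
  module

lemma cross_swap (a b c : Plane) : cross a c b = -cross a b c := by simp only [cross]; ring

lemma cross_rotate (a b c : Plane) : cross b c a = cross a b c := by simp only [cross]; ring

/-- For fixed `t` the inner variable runs along a line parallel to `ab`, from the point of `ac` with
parameter `t` to the point of `bc` with the same parameter. The inner integral is the difference of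
the two values of `ψ`. -/
lemma setIntegral_triangle_fderiv_side {a b c : Plane} (h : cross a b c ≠ 0) {ψ : Plane → ℝ}
    (hψ : ContDiff ℝ 1 ψ) :
    ∫ x in convexHull ℝ {a, b, c}, fderiv ℝ ψ x (b - a) =
      |cross a b c| * (segInt ψ b c - segInt ψ a c) := by
  rw [setIntegral_triangle h ((hψ.continuous_fderiv one_ne_zero).clm_apply continuous_const)]
  congr 1
  have key : ∀ t : ℝ, ∫ s in (0 : ℝ)..(1 - t), fderiv ℝ ψ (a + s • (b - a) + t • (c - a)) (b - a)
      = ψ (b + t • (c - b)) - ψ (a + t • (c - a)) := by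
    intro t
    have hd : ∀ s ∈ uIcc 0 (1 - t), HasDerivAt (fun s : ℝ => ψ (a + s • (b - a) + t • (c - a)))
        (fderiv ℝ ψ (a + s • (b - a) + t • (c - a)) (b - a)) s := by
      intro s _
      have h1 : HasDerivAt (fun s : ℝ => a + s • (b - a) + t • (c - a)) (b - a) s := by
        simpa using (((hasDerivAt_id s).smul_const (b - a)).const_add a).add_const (t • (c - a))
      exact ((hψ.differentiable one_ne_zero _).hasFDerivAt).comp_hasDerivAt s h1
    rw [intervalIntegral.integral_eq_sub_of_hasDerivAt hd]
    · congr 2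
      · module
      · module
    · refine Continuous.intervalIntegrable ?_ _ _
      exact ((hψ.continuous_fderiv one_ne_zero).comp (by fun_prop)).clm_apply continuous_const
  simp_rw [key]
  rw [intervalIntegral.integral_sub, segInt, segInt]
  · exact (hψ.continuous.comp (by fun_prop)).intervalIntegrable _ _
  · exact (hψ.continuous.comp (by fun_prop)).intervalIntegrable _ _

/-- The integral of a directional derivative over a triangle. -/
lemma setIntegral_triangle_fderiv {a b c : Plane} (h : cross a b c ≠ 0) {ψ : Plane → ℝ}
    (hψ : ContDiff ℝ 1 ψ) (β γ : ℝ) :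
    ∫ x in convexHull ℝ {a, b, c}, fderiv ℝ ψ x (β • (b - a) + γ • (c - a)) =
      |cross a b c| * ((β + γ) * segInt ψ b c - β * segInt ψ a c - γ * segInt ψ a b) := by
  have hcomp : IsCompact (convexHull ℝ ({a, b, c} : Set Plane)) :=
    (by simp : ({a, b, c} : Set Plane).Finite).isCompact_convexHull (𝕜 := ℝ)
  have hint : ∀ v : Plane, IntegrableOn (fun x => fderiv ℝ ψ x v) (convexHull ℝ {a, b, c}) :=
    fun v => ((hψ.continuous_fderiv one_ne_zero).clm_apply
      continuous_const).continuousOn.integrableOn_compact hcomp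
  have h1 := setIntegral_triangle_fderiv_side h hψ
  -- Exchanging `b` and `c` gives the derivative along `c - a`.
  have h2 := setIntegral_triangle_fderiv_side (a := a) (b := c) (c := b)
    (by rw [cross_swap]; exact neg_ne_zero.2 h) hψ
  rw [cross_swap, abs_neg, segInt_comm ψ c b, show ({a, c, b} : Set Plane) = {a, b, c} by
    rw [Set.pair_comm]] at h2
  simp only [map_add, map_smul, smul_eq_mul]
  rw [integral_add ((hint _).const_mul β) ((hint _).const_mul γ), integral_const_mul,
    integral_const_mul, h1, h2]
  ring

/-- Integration with respect to arc length over a segment. -/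
lemma setIntegral_segment (p q : Plane) (hpq : p ≠ q) (ψ : Plane → ℝ) :
    ∫ x in segment ℝ p q, ψ x ∂(Measure.hausdorffMeasure 1) = dist p q * segInt ψ p q := by
  have hinj : Function.Injective (AffineMap.lineMap p q : ℝ → Plane) :=
    AffineMap.lineMap_injective ℝ hpq
  have hcont : Continuous (AffineMap.lineMap p q : ℝ → Plane) := AffineMap.lineMap_continuous
  have hemb : MeasurableEmbedding (AffineMap.lineMap p q : ℝ → Plane) :=
    hcont.measurableEmbedding hinj
  -- Arc length on the segment is `dist p q` times the image of Lebesgue measure on `[0, 1]`.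
  have hmeas : (Measure.hausdorffMeasure 1 : Measure Plane).restrict (segment ℝ p q) =
      nndist p q • Measure.map (AffineMap.lineMap p q) (volume.restrict (Icc (0 : ℝ) 1)) := by
    ext s hs
    rw [Measure.restrict_apply hs, Measure.smul_apply, Measure.map_apply hcont.measurable hs,
      Measure.restrict_apply (hcont.measurable hs), ← hausdorffMeasure_real,
      ← hausdorffMeasure_lineMap_image, segment_eq_image_lineMap, image_preimage_inter]
  rw [hmeas, integral_smul_nnreal_measure, hemb.integral_map, NNReal.smul_def, coe_nndist,
    smul_eq_mul, segInt, intervalIntegral.integral_of_le zero_le_one, integral_Icc_eq_integral_Ioc]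
  congr 2
  ext t
  rw [AffineMap.lineMap_apply, vsub_eq_sub, vadd_eq_add, add_comm]


/-! ### Geometry of an element -/

lemma inner_plane (x y : Plane) : ⟪x, y⟫ = x 0 * y 0 + x 1 * y 1 := by
  rw [EuclideanSpace.inner_eq_star_dotProduct]
  simp [dotProduct, Fin.sum_univ_two, mul_comm]

lemma plane_ext {x y : Plane} (h0 : x 0 = y 0) (h1 : x 1 = y 1) : x = y := by
  ext i; fin_cases i <;> assumption

lemma norm_sq_plane (x : Plane) : ‖x‖ ^ 2 = x 0 ^ 2 + x 1 ^ 2 := by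
  rw [EuclideanSpace.real_norm_sq_eq, Fin.sum_univ_two]

/-- By contraposition: if `cross` vanishes, all three points lie on a line through `a` with
direction `b - a`, or `c - a` when `b = a`. The cases depend on which coordinate of `b - a` can be
divided by. -/
lemma cross_ne_zero {a b c : Plane} (h : AffineIndependent ℝ ![a, b, c]) : cross a b c ≠ 0 := by
  intro h0
  simp only [cross] at h0
  rw [affineIndependent_iff_not_collinear_set] at h
  apply h
  rw [collinear_iff_of_mem (p₀ := a) (by simp)]
  by_cases hb0 : b 0 - a 0 = 0
  · by_cases hb1 : b 1 - a 1 = 0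
    · refine ⟨c - a, ?_⟩
      rintro p (rfl | rfl | rfl)
      · exact ⟨0, by simp⟩
      · exact ⟨0, plane_ext (by simp; linarith) (by simp; linarith)⟩
      · exact ⟨1, by simp⟩
    · refine ⟨b - a, ?_⟩
      rintro p (rfl | rfl | rfl)
      · exact ⟨0, by simp⟩
      · exact ⟨1, by simp⟩
      · refine ⟨(p 1 - a 1) / (b 1 - a 1), plane_ext ?_ ?_⟩
        · have : p 0 - a 0 = 0 := by
            rw [hb0] at h0
            have h0' : (b 1 - a 1) * (p 0 - a 0) = 0 := by linarith
            exact (mul_eq_zero.1 h0').resolve_left hb1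
          simp [hb0]; linarith
        · simp; field_simp; ring
  · refine ⟨b - a, ?_⟩
    rintro p (rfl | rfl | rfl)
    · exact ⟨0, by simp⟩
    · exact ⟨1, by simp⟩
    · refine ⟨(p 0 - a 0) / (b 0 - a 0), plane_ext ?_ ?_⟩
      · simp; field_simp; ring
      · simp; field_simp; linarith

/-- The coefficients are those of Cramer's rule. -/
lemma eq_smul_of_cross_ne_zero {a b c : Plane} (h : cross a b c ≠ 0) (v : Plane) :
    ∃ β γ : ℝ, v = β • (b - a) + γ • (c - a) := by
  refine ⟨(v 0 * (c 1 - a 1) - v 1 * (c 0 - a 0)) / cross a b c,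
    ((b 0 - a 0) * v 1 - (b 1 - a 1) * v 0) / cross a b c, plane_ext ?_ ?_⟩ <;>
  · simp
    field_simp
    simp only [cross]
    ring

/-- `N` is the unit normal of the edge `bc` of the triangle `abc` that points away from `a`. -/
structure IsOuterNormal (N a b c : Plane) : Prop where
  norm_eq : ‖N‖ = 1
  inner_edge : ⟪N, c - b⟫ = 0
  inner_pos : 0 < ⟪N, b - a⟫

/-- Both sides are twice the area: `⟪N, b - a⟫` is the height over the base `bc`. -/
lemma IsOuterNormal.inner_mul_dist {N a b c : Plane} (h : IsOuterNormal N a b c) :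
    ⟪N, b - a⟫ * dist b c = |cross a b c| := by
  have h1 := h.inner_edge
  have h2 : N 0 ^ 2 + N 1 ^ 2 = 1 := by rw [← norm_sq_plane, h.norm_eq]; norm_num
  have h3 : dist b c ^ 2 = (c 0 - b 0) ^ 2 + (c 1 - b 1) ^ 2 := by
    rw [dist_comm, dist_eq_norm, norm_sq_plane]; simp
  rw [inner_plane] at h1
  have h4 : 0 ≤ ⟪N, b - a⟫ * dist b c := mul_nonneg h.inner_pos.le dist_nonneg
  rw [← abs_of_nonneg h4, ← sq_eq_sq_iff_abs_eq_abs, mul_pow, h3, inner_plane]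
  simp only [PiLp.sub_apply] at *
  -- `σ` is the signed length of `bc` measured along `N` rotated by a right angle.
  set σ := (c 1 - b 1) * N 0 - (c 0 - b 0) * N 1 with hσ
  have e0 : c 0 - b 0 = -σ * N 1 := by rw [hσ]; linear_combination (-(c 0 - b 0)) * h2 + N 0 * h1
  have e1 : c 1 - b 1 = σ * N 0 := by rw [hσ]; linear_combination (-(c 1 - b 1)) * h2 + N 1 * h1
  have e2 : cross a b c = (b 0 - a 0) * (c 1 - b 1) - (b 1 - a 1) * (c 0 - b 0) := by
    simp only [cross]; ring
  rw [e2, e0, e1]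
  linear_combination (N 0 * (b 0 - a 0) + N 1 * (b 1 - a 1)) ^ 2 * σ ^ 2 * h2

/-- The flux of a constant vector field through `bc`, in the coordinates used for the integral over
the triangle. -/
lemma IsOuterNormal.inner_smul_add {N a b c : Plane} (h : IsOuterNormal N a b c) (β γ : ℝ) :
    ⟪N, β • (b - a) + γ • (c - a)⟫ * dist b c = (β + γ) * |cross a b c| := by
  have : c - a = (c - b) + (b - a) := by abel
  rw [← h.inner_mul_dist, this, inner_add_right, inner_smul_right, inner_smul_right,
    inner_add_right, h.inner_edge]
  ring

/-- The vector `y` from barycentre to midpoint is `(b - a)/3` plus a multiple of the edge vector.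
Its component `w` orthogonal to the edge therefore satisfies `⟪w, b - a⟫ = 3⟪w, y⟫ = 3‖w‖²`, which
gives the outward direction once `w ≠ 0`. -/
lemma Triangulation.Elem.isOuterNormal {T : Triangulation Ω} {K : T.Elem} {e : T.Edge}
    {a b c : Plane} (hK : K.1 = {a, b, c}) (he : e.1 = {b, c}) (h : cross a b c ≠ 0) :
    IsOuterNormal (K.outward e) a b c := by
  have hbc : b ≠ c := by rintro rfl; exact h (by simp only [cross]; ring)
  have hab : a ≠ b := by rintro rfl; exact h (by simp only [cross]; ring)
  have hac : a ≠ c := by rintro rfl; exact h (by simp only [cross]; ring)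
  set y := barycentre e.1 - barycentre K.1 with hy
  set W := (vectorSpan ℝ (e.1 : Set Plane))ᗮ with hW
  set w := W.starProjection y with hw
  have hout : K.outward e = ‖w‖⁻¹ • w := rfl
  have hmem : c - b ∈ vectorSpan ℝ (e.1 : Set Plane) :=
    vsub_mem_vectorSpan ℝ (by simp [he]) (by simp [he])
  have hyv : y = (1 / 3 : ℝ) • (b - a) + (1 / 6 : ℝ) • (c - b) := by
    rw [hy, barycentre, barycentre, he, hK]
    rw [Finset.card_pair hbc, Finset.card_eq_three.2 ⟨a, b, c, hab, hac, hbc, rfl⟩,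
      Finset.sum_pair hbc, Finset.sum_insert (by simp [hab, hac]), Finset.sum_pair hbc]
    push_cast
    module
  have hwW : w ∈ W := Submodule.starProjection_apply_mem _ _
  have h1 : ⟪w, c - b⟫ = 0 := by
    rw [real_inner_comm]; exact (Submodule.mem_orthogonal _ _).1 hwW _ hmem
  have hyw : ⟪w, y⟫ = ‖w‖ ^ 2 := by
    have : y - w ∈ Wᗮ := Submodule.sub_starProjection_mem_orthogonal _
    have h3 := (Submodule.mem_orthogonal _ _).1 this _ hwW
    rw [inner_sub_right, real_inner_self_eq_norm_sq] at h3
    linarith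
  have h2 : ⟪w, b - a⟫ = 3 * ‖w‖ ^ 2 := by
    rw [← hyw, hyv, inner_add_right, inner_smul_right, inner_smul_right, h1]; ring
  -- If `w` vanished, `y` and hence `b - a` would be parallel to the edge, and the triangle would be
  -- degenerate.
  have hw0 : w ≠ 0 := by
    intro hw0
    have : y ∈ Wᗮ := by
      have : y - w ∈ Wᗮ := Submodule.sub_starProjection_mem_orthogonal _
      rwa [hw0, sub_zero] at this
    rw [hW, Submodule.orthogonal_orthogonal, he, Finset.coe_pair, vectorSpan_pair_rev,
      Submodule.mem_span_singleton] at this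
    obtain ⟨r, hr⟩ := this
    rw [hyv, vsub_eq_sub] at hr
    have hba : b - a = (3 * r - 1 / 2) • (c - b) := by
      have : b - a = (3 : ℝ) • (r • (c - b)) - (1 / 2 : ℝ) • (c - b) := by rw [hr]; module
      rw [this]; module
    apply h
    have e0 := congrArg (fun z : Plane => z 0) hba
    have e1 := congrArg (fun z : Plane => z 1) hba
    simp at e0 e1
    have e2 : cross a b c = (b 0 - a 0) * (c 1 - b 1) - (b 1 - a 1) * (c 0 - b 0) := by
      simp only [cross]; ring
    rw [e2, e0, e1]; ring
  have hpos : 0 < ‖w‖ := norm_pos_iff.2 hw0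
  refine ⟨?_, ?_, ?_⟩
  · rw [hout, norm_smul, norm_inv, norm_norm, inv_mul_cancel₀ hpos.ne']
  · rw [hout, inner_smul_left, h1, mul_zero]
  · rw [hout, inner_smul_left, h2]
    simp only [conj_trivial]
    positivity

lemma Triangulation.Elem.cross_ne_zero {T : Triangulation Ω} {K : T.Elem} {a b c : Plane}
    (hK : K.1 = {a, b, c}) : cross a b c ≠ 0 := by
  have hcard := K.2.2
  have hab : a ≠ b := by
    rintro rfl; rw [hK] at hcard; simp at hcard
    have := Finset.card_le_two (a := a) (b := c); omega
  have hac : a ≠ c := by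
    rintro rfl; rw [hK] at hcard; simp at hcard
    have := Finset.card_le_two (a := b) (b := a); omega
  have hbc : b ≠ c := by
    rintro rfl; rw [hK] at hcard; simp at hcard
    have := Finset.card_le_two (a := a) (b := b); omega
  apply C0WG.cross_ne_zero
  have hi := T.indep K.2.1
  let f : Fin 3 ↪ K.1 := ⟨![⟨a, by simp [hK]⟩, ⟨b, by simp [hK]⟩, ⟨c, by simp [hK]⟩], by
    intro i j hij
    fin_cases i <;> fin_cases j <;> simp_all⟩
  have hf : ![a, b, c] = ((↑) : K.1 → Plane) ∘ f := by
    ext i : 1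
    fin_cases i <;> rfl
  rw [hf]
  exact hi.comp_embedding f

open Classical in
/-- The vertices of an element, the last two of which are the endpoints of a given edge. -/
lemma Triangulation.Elem.exists_vertices {T : Triangulation Ω} {K : T.Elem} {e : T.Edge}
    (he : e ∈ K.edges) : ∃ a b c : Plane, K.1 = {a, b, c} ∧ e.1 = {b, c} := by
  have hsub : e.1 ⊆ K.1 := (Finset.mem_filter.1 he).2
  obtain ⟨b, c, hbc, hbc'⟩ := Finset.card_eq_two.1 e.2.2
  have hc : (K.1 \ e.1).card = 1 := by
    rw [Finset.card_sdiff_of_subset hsub, K.2.2, e.2.2]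
  obtain ⟨a, ha⟩ := Finset.card_eq_one.1 hc
  refine ⟨a, b, c, ?_, hbc'⟩
  rw [← hbc', ← Finset.sdiff_union_of_subset hsub, ha, Finset.singleton_union]

lemma Triangulation.Elem.mem_edges {T : Triangulation Ω} {K : T.Elem} {e : T.Edge} :
    e ∈ K.edges ↔ e.1 ⊆ K.1 := by
  classical
  simp [Triangulation.Elem.edges]

-- The summand `g` is arbitrary, so that every sum over `∂K` can be split into three terms. The
-- edges belong to the complex because its faces are closed under passing to nonempty subsets.
open Classical in
lemma Triangulation.Elem.exists_edges {T : Triangulation Ω} {K : T.Elem} {a b c : Plane}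
    (hK : K.1 = {a, b, c}) : ∃ ea eb ec : T.Edge, ea.1 = {b, c} ∧ eb.1 = {a, c} ∧ ec.1 = {a, b} ∧
      ∀ g : T.Edge → ℝ, ∑ e ∈ K.edges, g e = g ea + g eb + g ec := by
  have h := Elem.cross_ne_zero hK
  have hbc : b ≠ c := by rintro rfl; exact h (by simp only [cross]; ring)
  have hab : a ≠ b := by rintro rfl; exact h (by simp only [cross]; ring)
  have hac : a ≠ c := by rintro rfl; exact h (by simp only [cross]; ring)
  have hface : ∀ p q : Plane, ({p, q} : Finset Plane) ⊆ K.1 → ({p, q} : Finset Plane) ∈ T.faces :=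
    fun p q hpq => T.down_closed K.2.1 hpq (by simp)
  let ea : T.Edge := ⟨{b, c}, hface b c (by rw [hK]; simp), Finset.card_pair hbc⟩
  let eb : T.Edge := ⟨{a, c}, hface a c (by rw [hK]; intro x; simp; tauto), Finset.card_pair hac⟩
  let ec : T.Edge := ⟨{a, b}, hface a b (by rw [hK]; intro x; simp; tauto), Finset.card_pair hab⟩
  have hne1 : ea ≠ eb := by
    intro h; have := congrArg (fun e : T.Edge => b ∈ e.1) h
    simp [ea, eb, hab.symm, hbc] at this
  have hne2 : ea ≠ ec := by
    intro h; have := congrArg (fun e : T.Edge => c ∈ e.1) h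
    simp [ea, ec, hac.symm, hbc.symm] at this
  have hne3 : eb ≠ ec := by
    intro h; have := congrArg (fun e : T.Edge => c ∈ e.1) h
    simp [eb, ec, hac.symm, hbc.symm] at this
  refine ⟨ea, eb, ec, rfl, rfl, rfl, fun g => ?_⟩
  have : K.edges = {ea, eb, ec} := by
    ext e
    rw [Elem.mem_edges, hK]
    constructor
    · intro he
      obtain ⟨p, q, hpq, hpq'⟩ := Finset.card_eq_two.1 e.2.2
      have hp : p ∈ ({a, b, c} : Finset Plane) := he (by simp [hpq'])
      have hq : q ∈ ({a, b, c} : Finset Plane) := he (by simp [hpq'])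
      simp only [Finset.mem_insert, Finset.mem_singleton] at hp hq ⊢
      rcases hp with rfl | rfl | rfl <;> rcases hq with rfl | rfl | rfl <;>
        first
        | exact absurd rfl hpq
        | exact Or.inl (Subtype.ext hpq')
        | exact Or.inl (Subtype.ext (hpq'.trans (Finset.pair_comm _ _)))
        | exact Or.inr (Or.inl (Subtype.ext hpq'))
        | exact Or.inr (Or.inl (Subtype.ext (hpq'.trans (Finset.pair_comm _ _))))
        | exact Or.inr (Or.inr (Subtype.ext hpq'))
        | exact Or.inr (Or.inr (Subtype.ext (hpq'.trans (Finset.pair_comm _ _))))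
    · intro he
      simp only [Finset.mem_insert, Finset.mem_singleton] at he
      rcases he with rfl | rfl | rfl <;> intro x <;> simp [ea, eb, ec] <;> tauto
  rw [this, Finset.sum_insert (by simp [hne1, hne2]), Finset.sum_pair hne3, add_assoc]

lemma Triangulation.Elem.exists_triple {T : Triangulation Ω} (K : T.Elem) :
    ∃ a b c : Plane, K.1 = {a, b, c} := by
  classical
  obtain ⟨a, b, c, -, -, -, h⟩ := Finset.card_eq_three.1 K.2.2
  exact ⟨a, b, c, h⟩

/-! ### Measures on elements and edges, the divergence theorem and a trace inequality. -/

lemma Triangulation.Elem.cell_eq {T : Triangulation Ω} {K : T.Elem} {a b c : Plane}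
    (hK : K.1 = {a, b, c}) : K.cell = convexHull ℝ {a, b, c} := by
  simp [Elem.cell, hK]

lemma Triangulation.Edge.cell_eq {T : Triangulation Ω} {e : T.Edge} {b c : Plane}
    (he : e.1 = {b, c}) : e.cell = segment ℝ b c := by
  simp [Edge.cell, he, convexHull_pair]

lemma Triangulation.Elem.isCompact_cell {T : Triangulation Ω} (K : T.Elem) : IsCompact K.cell :=
  (Finset.finite_toSet _).isCompact_convexHull (𝕜 := ℝ)

lemma Triangulation.Edge.isCompact_cell {T : Triangulation Ω} (e : T.Edge) : IsCompact e.cell :=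
  (Finset.finite_toSet _).isCompact_convexHull (𝕜 := ℝ)

instance {T : Triangulation Ω} (K : T.Elem) : IsFiniteMeasure K.area :=
  ⟨by simpa [Triangulation.Elem.area] using K.isCompact_cell.measure_lt_top⟩

instance {T : Triangulation Ω} (e : T.Edge) : IsFiniteMeasure e.length := by
  classical
  obtain ⟨b, c, -, he⟩ := Finset.card_eq_two.1 e.2.2
  refine ⟨?_⟩
  rw [Triangulation.Edge.length, Measure.restrict_apply_univ, Triangulation.Edge.cell_eq he,
    hausdorffMeasure_segment]
  exact edist_lt_top b c

lemma memLp_of_continuous_of_isCompact {μ : Measure Plane} [IsFiniteMeasure μ] {C : Set Plane}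
    (hC : IsCompact C) (hμ : ∀ᵐ x ∂μ, x ∈ C) {g : Plane → ℝ} (hg : Continuous g) (p : ℝ≥0∞) :
    MemLp g p μ := by
  obtain ⟨M, hM⟩ := hC.exists_bound_of_continuousOn hg.continuousOn
  exact MemLp.of_bound hg.aestronglyMeasurable M (hμ.mono fun x hx => hM x hx)

lemma Triangulation.Elem.ae_mem {T : Triangulation Ω} (K : T.Elem) :
    ∀ᵐ x ∂K.area, x ∈ K.cell := ae_restrict_mem K.isCompact_cell.measurableSet

lemma Triangulation.Edge.ae_mem {T : Triangulation Ω} (e : T.Edge) :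
    ∀ᵐ x ∂e.length, x ∈ e.cell := ae_restrict_mem e.isCompact_cell.measurableSet

lemma Triangulation.Elem.memLp {T : Triangulation Ω} (K : T.Elem) {g : Plane → ℝ}
    (hg : Continuous g) (p : ℝ≥0∞) : MemLp g p K.area :=
  memLp_of_continuous_of_isCompact K.isCompact_cell K.ae_mem hg p

lemma Triangulation.Edge.memLp {T : Triangulation Ω} (e : T.Edge) {g : Plane → ℝ}
    (hg : Continuous g) (p : ℝ≥0∞) : MemLp g p e.length :=
  memLp_of_continuous_of_isCompact e.isCompact_cell e.ae_mem hg p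

lemma Triangulation.Elem.integrable {T : Triangulation Ω} (K : T.Elem) {g : Plane → ℝ}
    (hg : Continuous g) : Integrable g K.area :=
  memLp_one_iff_integrable.1 (K.memLp hg 1)

lemma Triangulation.Edge.integrable {T : Triangulation Ω} (e : T.Edge) {g : Plane → ℝ}
    (hg : Continuous g) : Integrable g e.length :=
  memLp_one_iff_integrable.1 (e.memLp hg 1)

lemma Triangulation.Edge.integral_length {T : Triangulation Ω} {e : T.Edge} {b c : Plane}
    (he : e.1 = {b, c}) (hbc : b ≠ c) (ψ : Plane → ℝ) :
    ∫ x, ψ x ∂e.length = dist b c * segInt ψ b c := by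
  rw [Edge.length, Edge.cell_eq he, setIntegral_segment b c hbc]

/-- The divergence theorem on an element. -/
lemma Triangulation.Elem.integral_fderiv {T : Triangulation Ω} (K : T.Elem) {ψ : Plane → ℝ}
    (hψ : ContDiff ℝ 1 ψ) (v : Plane) :
    ∫ x, fderiv ℝ ψ x v ∂K.area = ∑ e ∈ K.edges, ⟪K.outward e, v⟫ * ∫ x, ψ x ∂e.length := by
  obtain ⟨a, b, c, hK⟩ := K.exists_triple
  obtain ⟨ea, eb, ec, ha, hb, hc, hsum⟩ := Elem.exists_edges hK
  have h := Elem.cross_ne_zero hK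
  have hbc : b ≠ c := by rintro rfl; exact h (by simp only [cross]; ring)
  have hab : a ≠ b := by rintro rfl; exact h (by simp only [cross]; ring)
  have hac : a ≠ c := by rintro rfl; exact h (by simp only [cross]; ring)
  have x1 : |cross b a c| = |cross a b c| := by
    rw [← cross_rotate, cross_swap, abs_neg]
  have x2 : |cross c a b| = |cross a b c| := by rw [← cross_rotate]
  have n1 := Elem.isOuterNormal hK ha h
  -- For the other two edges the vertices are permuted so that the vertex opposite to the edge comes
  -- first.
  have n2 := Elem.isOuterNormal (K := K) (e := eb) (a := b) (b := a) (c := c)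
    (by rw [hK, Finset.insert_comm]) hb (by rw [← abs_ne_zero, x1]; exact abs_ne_zero.2 h)
  have n3 := Elem.isOuterNormal (K := K) (e := ec) (a := c) (b := a) (c := b)
    (by rw [hK]; ext; simp; tauto) hc (by rw [← abs_ne_zero, x2]; exact abs_ne_zero.2 h)
  obtain ⟨β, γ, rfl⟩ := eq_smul_of_cross_ne_zero h v
  rw [hsum, Edge.integral_length ha hbc, Edge.integral_length hb hac, Edge.integral_length hc hab,
    Elem.area, Elem.cell_eq hK, setIntegral_triangle_fderiv h hψ]
  have y1 := n1.inner_smul_add β γ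
  -- The same vector `v` is expanded from the vertices `b` and `c`; the coefficient sums `-β` and
  -- `-γ` are its fluxes through `ac` and `ab`, up to the factor `|cross a b c|`.
  have y2 := n2.inner_smul_add (-β - γ) γ
  have y3 := n3.inner_smul_add (-β - γ) β
  rw [show (-β - γ) • (a - b) + γ • (c - b) = β • (b - a) + γ • (c - a) by module, x1] at y2
  rw [show (-β - γ) • (a - c) + β • (b - c) = β • (b - a) + γ • (c - a) by module, x2] at y3
  linear_combination (-segInt ψ b c) * y1 - segInt ψ a c * y2 - segInt ψ a b * y3

lemma continuous_pd {ψ : Plane → ℝ} (hψ : ContDiff ℝ 1 ψ) (i : Fin 2) : Continuous (pd i ψ) :=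
  (hψ.continuous_fderiv one_ne_zero).clm_apply continuous_const

/-- A trace inequality for functions that are smooth up to the boundary. -/
lemma Triangulation.Elem.exists_trace_bound {T : Triangulation Ω} {K : T.Elem} {e : T.Edge}
    (he : e ∈ K.edges) : ∃ C : ℝ, 0 ≤ C ∧ ∀ ψ : Plane → ℝ, ContDiff ℝ 1 ψ →
      ∫ x, ψ x ^ 2 ∂e.length ≤ C * ((∫ x, ψ x ^ 2 ∂K.area) + ∑ i, ∫ x, pd i ψ x ^ 2 ∂K.area) := by
  obtain ⟨a, b, c, hK, hbc'⟩ := Elem.exists_vertices he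
  obtain ⟨ea, eb, ec, ha, hb, hc, hsum⟩ := Elem.exists_edges hK
  obtain rfl : e = ea := Subtype.ext (hbc'.trans ha.symm)
  have h := Elem.cross_ne_zero hK
  have x1 : |cross b a c| = |cross a b c| := by
    rw [← cross_rotate, cross_swap, abs_neg]
  have x2 : |cross c a b| = |cross a b c| := by rw [← cross_rotate]
  have n1 := Elem.isOuterNormal hK ha h
  have n2 := Elem.isOuterNormal (K := K) (e := eb) (a := b) (b := a) (c := c)
    (by rw [hK, Finset.insert_comm]) hb (by rw [← abs_ne_zero, x1]; exact abs_ne_zero.2 h)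
  have n3 := Elem.isOuterNormal (K := K) (e := ec) (a := c) (b := a) (c := b)
    (by rw [hK]; ext; simp; tauto) hc (by rw [← abs_ne_zero, x2]; exact abs_ne_zero.2 h)
  -- The height of the triangle over `e`, equal to `⟪n, x - a⟫` for every `x ∈ e`.
  set H := ⟪K.outward e, b - a⟫ with hH
  have hHpos : 0 < H := n1.inner_pos
  obtain ⟨R, hR⟩ := K.isCompact_cell.isBounded.exists_norm_le
  have hRpos : 0 ≤ R := (norm_nonneg _).trans (hR a (subset_convexHull ℝ _ (by simp [hK])))
  set M := R + ‖a‖ with hM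
  have hM0 : 0 ≤ M := by positivity
  refine ⟨(2 + 2 * M ^ 2) / H, by positivity, fun ψ hψ => ?_⟩
  -- The divergence theorem is applied to the field `(x - a) ψ²`. Its normal component is `H ψ²` on
  -- `e` and zero on the other two edges, which pass through `a`.
  let F : Fin 2 → Plane → ℝ := fun i x => (x i - a i) * ψ x ^ 2
  have hcoord : ∀ i : Fin 2, ContDiff ℝ 1 (fun x : Plane => x i - a i) := fun i => by fun_prop
  have hF : ∀ i, ContDiff ℝ 1 (F i) := fun i => (hcoord i).mul (hψ.pow 2)
  have hderiv : ∀ i x, fderiv ℝ (F i) x (EuclideanSpace.single i 1) =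
      ψ x ^ 2 + (x i - a i) * (2 * ψ x * pd i ψ x) := by
    intro i x
    have d1 : HasFDerivAt (fun x : Plane => x i - a i)
        (EuclideanSpace.proj i : Plane →L[ℝ] ℝ) x :=
      (EuclideanSpace.proj i : Plane →L[ℝ] ℝ).hasFDerivAt.sub_const (a i)
    have d2 := ((hψ.differentiable one_ne_zero x).hasFDerivAt).pow 2
    have := d1.mul d2
    rw [HasFDerivAt.fderiv (f := F i) this]
    simp [pd]
    ring
  have hdiv : ∑ i, ∫ x, fderiv ℝ (F i) x (EuclideanSpace.single i 1) ∂K.area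
      = H * ∫ x, ψ x ^ 2 ∂e.length := by
    simp_rw [fun i => K.integral_fderiv (hF i) (EuclideanSpace.single i 1)]
    rw [Finset.sum_comm]
    have hinner : ∀ e' : T.Edge, ∑ i, ⟪K.outward e', EuclideanSpace.single i (1 : ℝ)⟫ *
        ∫ x, F i x ∂e'.length = ∫ x, ⟪K.outward e', x - a⟫ * ψ x ^ 2 ∂e'.length := by
      intro e'
      simp_rw [← integral_const_mul]
      rw [← integral_finsetSum _ fun i _ => e'.integrable (by
        exact continuous_const.mul (hF i).continuous)]
      refine integral_congr_ae (Eventually.of_forall fun x => ?_)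
      simp [inner_plane, Fin.sum_univ_two, F]
      ring
    simp_rw [hinner]
    rw [hsum]
    have z1 : ∫ x, ⟪K.outward e, x - a⟫ * ψ x ^ 2 ∂e.length = H * ∫ x, ψ x ^ 2 ∂e.length := by
      rw [← integral_const_mul]
      refine integral_congr_ae (e.ae_mem.mono fun x hx => ?_)
      rw [Edge.cell_eq ha, segment_eq_image'] at hx
      obtain ⟨t, -, rfl⟩ := hx
      simp only
      rw [show b + t • (c - b) - a = (b - a) + t • (c - b) by abel, inner_add_right,
        inner_smul_right, n1.inner_edge]
      simp [hH]
    have z2 : ∫ x, ⟪K.outward eb, x - a⟫ * ψ x ^ 2 ∂eb.length = 0 := by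
      rw [← integral_zero Plane ℝ (μ := eb.length)]
      refine integral_congr_ae (eb.ae_mem.mono fun x hx => ?_)
      rw [Edge.cell_eq hb, segment_eq_image'] at hx
      obtain ⟨t, -, rfl⟩ := hx
      simp only
      rw [add_sub_cancel_left, inner_smul_right, n2.inner_edge]
      simp
    have z3 : ∫ x, ⟪K.outward ec, x - a⟫ * ψ x ^ 2 ∂ec.length = 0 := by
      rw [← integral_zero Plane ℝ (μ := ec.length)]
      refine integral_congr_ae (ec.ae_mem.mono fun x hx => ?_)
      rw [Edge.cell_eq hc, segment_eq_image'] at hx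
      obtain ⟨t, -, rfl⟩ := hx
      simp only
      rw [add_sub_cancel_left, inner_smul_right, n3.inner_edge]
      simp
    rw [z1, z2, z3, add_zero, add_zero]
  have i1 : Integrable (fun x => ψ x ^ 2) K.area := K.integrable (hψ.continuous.pow 2)
  have i2 : ∀ i, Integrable (fun x => pd i ψ x ^ 2) K.area := fun i =>
    K.integrable ((continuous_pd hψ i).pow 2)
  have hle : ∀ i, ∫ x, fderiv ℝ (F i) x (EuclideanSpace.single i 1) ∂K.area ≤
      (1 + M ^ 2) * (∫ x, ψ x ^ 2 ∂K.area) + ∫ x, pd i ψ x ^ 2 ∂K.area := by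
    intro i
    rw [← integral_const_mul, ← integral_add (i1.const_mul _) (i2 i)]
    refine integral_mono_ae (K.integrable (((hF i).continuous_fderiv one_ne_zero).clm_apply
      continuous_const)) ((i1.const_mul _).add (i2 i)) (K.ae_mem.mono fun x hx => ?_)
    simp only [hderiv]
    have hx1 : |x i - a i| ≤ M := by
      have : ‖(x - a) i‖ ≤ ‖x - a‖ := PiLp.norm_apply_le (x - a) i
      rw [Real.norm_eq_abs] at this
      exact this.trans ((norm_sub_le x a).trans (by rw [hM]; gcongr; exact hR x hx))
    have hx2 : (x i - a i) ^ 2 ≤ M ^ 2 := by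
      rw [← sq_abs]; gcongr
    -- Young's inequality `2 (xᵢ - aᵢ) ψ ∂ᵢψ ≤ M² ψ² + (∂ᵢψ)²`.
    nlinarith [sq_nonneg ((x i - a i) * ψ x - pd i ψ x),
      mul_le_mul_of_nonneg_right hx2 (sq_nonneg (ψ x))]
  have h0 : 0 ≤ ∫ x, ψ x ^ 2 ∂K.area := integral_nonneg fun x => sq_nonneg _
  have h0' : ∀ i, 0 ≤ ∫ x, pd i ψ x ^ 2 ∂K.area := fun i => integral_nonneg fun x => sq_nonneg _
  have hfin : H * ∫ x, ψ x ^ 2 ∂e.length ≤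
      (2 + 2 * M ^ 2) * ((∫ x, ψ x ^ 2 ∂K.area) + ∑ i, ∫ x, pd i ψ x ^ 2 ∂K.area) := by
    rw [← hdiv]
    refine (Finset.sum_le_sum fun i _ => hle i).trans ?_
    rw [Fin.sum_univ_two, Fin.sum_univ_two]
    have := h0' 0; have := h0' 1
    nlinarith [mul_nonneg (sq_nonneg M) (h0' 0), mul_nonneg (sq_nonneg M) (h0' 1)]
  rw [div_mul_eq_mul_div, le_div_iff₀ hHpos]
  linarith


/-! ### Density of smooth functions in `H¹` of a convex open set -/

lemma eLpNorm_two_sq {α : Type*} [MeasurableSpace α] (μ : Measure α) (h : α → ℝ) :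
    eLpNorm h 2 μ ^ 2 = ∫⁻ x, ‖h x‖ₑ ^ 2 ∂μ := by
  have := eLpNorm_nnreal_pow_eq_lintegral (f := h) (μ := μ) (p := 2) (by norm_num)
  simpa using this

lemma le_of_sq_le_sq {a b : ℝ≥0∞} (h : a ^ 2 ≤ b ^ 2) : a ≤ b :=
  (ENNReal.pow_le_pow_left_iff two_ne_zero).1 h

/-- In the plane the change of variables multiplies the squared norm by `l⁻² ≤ 4`. -/
lemma eLpNorm_comp_affine_le {W : Plane → ℝ} (hW : AEStronglyMeasurable W volume) {l : ℝ}
    (hl : 1 / 2 ≤ l) (z : Plane) :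
    eLpNorm (fun x => W (l • x + z)) 2 volume ≤ 2 * eLpNorm W 2 volume := by
  have hl0 : l ≠ 0 := by linarith
  have hmap : Measure.map (fun x : Plane => l • x + z) volume
      = ENNReal.ofReal |(l ^ 2)⁻¹| • volume := by
    have h1 : (fun x : Plane => l • x + z) = (fun x => x + z) ∘ (fun x => l • x) := rfl
    rw [h1, ← Measure.map_map (by fun_prop) (by fun_prop), Measure.map_addHaar_smul _ hl0]
    rw [Measure.map_smul, map_add_right_eq_self]
    simp
  have hae : AEStronglyMeasurable W (Measure.map (fun x : Plane => l • x + z) volume) := by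
    rw [hmap]; exact hW.smul_measure _
  have hm : AEMeasurable (fun x : Plane => l • x + z) volume := by fun_prop
  refine (eLpNorm_map_measure (p := 2) hae hm).symm.trans_le ?_
  rw [hmap]
  have h4 : ENNReal.ofReal |(l ^ 2)⁻¹| ≤ 4 := by
    rw [show (4 : ℝ≥0∞) = ENNReal.ofReal 4 by simp]
    apply ENNReal.ofReal_le_ofReal
    rw [abs_of_nonneg (by positivity), inv_le_comm₀ (by positivity) (by norm_num)]
    nlinarith
  refine le_of_sq_le_sq ?_
  rw [mul_pow, eLpNorm_two_sq, eLpNorm_two_sq, lintegral_smul_measure, smul_eq_mul]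
  gcongr
  exact h4.trans (by norm_num)

/-- Continuity in `L²` of dilations and translations. -/
lemma exists_eLpNorm_comp_affine_sub_le {W : Plane → ℝ} (hW : MemLp W 2 volume) {ε : ℝ≥0∞}
    (hε : ε ≠ 0) : ∃ δ : ℝ, 0 < δ ∧ ∀ (l : ℝ) (z : Plane), |l - 1| < δ → ‖z‖ < δ →
      eLpNorm (fun x => W (l • x + z) - W x) 2 volume ≤ ε := by
  -- The budget: `W - g` contributes `ε/4`, its affine transform at most `2 · ε/4`, and the
  -- continuous function `g` another `ε/4`.
  obtain ⟨g, hgc, hgW, hg, hgL⟩ := hW.exists_hasCompactSupport_eLpNorm_sub_le (by simp)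
    (ε := ε / 4) (by simp [hε])
  obtain ⟨R, hR⟩ := hgc.isCompact.isBounded.exists_norm_le
  have hR' : ∀ x, g x ≠ 0 → ‖x‖ ≤ |R| := fun x hx =>
    (hR x (subset_tsupport _ hx)).trans (le_abs_self R)
  -- Outside `B` both `g x` and `g (l • x + z)` vanish: `‖l • x + z‖ ≤ |R|` with `l ≥ 1/2` and `‖z‖
  -- < 1/2` forces `‖x‖ ≤ 2|R| + 1`.
  set B := Metric.closedBall (0 : Plane) (2 * |R| + 1) with hB
  have hvol : volume B ≠ ⊤ := (isCompact_closedBall _ _).measure_lt_top.ne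
  obtain ⟨η, hη, hηB⟩ : ∃ η : ℝ, 0 < η ∧ volume B ^ (1 / 2 : ℝ) * ENNReal.ofReal η ≤ ε / 4 := by
    have ht : Tendsto (fun η : ℝ => volume B ^ (1 / 2 : ℝ) * ENNReal.ofReal η) (𝓝[>] 0) (𝓝 0) := by
      have h1 : Tendsto (fun η : ℝ => ENNReal.ofReal η) (𝓝[>] 0) (𝓝 0) := by
        have := (ENNReal.continuous_ofReal.tendsto 0).mono_left
          (nhdsWithin_le_nhds (s := Ioi (0 : ℝ)))
        simpa using this
      have := ENNReal.Tendsto.const_mul (a := volume B ^ (1 / 2 : ℝ)) h1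
        (Or.inr (ENNReal.rpow_ne_top_of_nonneg (by norm_num) hvol))
      simpa using this
    have hev := (ht.eventually (Iio_mem_nhds
      (show (0 : ℝ≥0∞) < ε / 4 from ENNReal.div_pos hε (by simp)))).and self_mem_nhdsWithin
    obtain ⟨η, h1, h2⟩ := hev.exists
    exact ⟨η, h2, h1.le⟩
  have huc := hgc.uniformContinuous_of_continuous hg
  obtain ⟨δ', hδ', hδ⟩ := Metric.uniformContinuous_iff.1 huc η hη
  -- On `B` the displacement is at most `|l - 1| (2|R| + 1) + ‖z‖`, which this choice keeps below
  -- `δ'`.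
  refine ⟨min (1 / 2) (δ' / (2 * |R| + 2)), by positivity, fun l z hl hz => ?_⟩
  have hl1 : |l - 1| < 1 / 2 := hl.trans_le (min_le_left _ _)
  have hz1 : ‖z‖ < 1 / 2 := hz.trans_le (min_le_left _ _)
  have hl2 := hl.trans_le (min_le_right _ _)
  have hz2 := hz.trans_le (min_le_right _ _)
  have hl12 : 1 / 2 ≤ l := by have := (abs_lt.1 hl1).1; linarith
  have hWm := hW.1
  have hgm := hg.aestronglyMeasurable (μ := (volume : Measure Plane))
  have hgl : Continuous fun x : Plane => g (l • x + z) - g x := by fun_prop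
  have hbound : ∀ x, ‖g (l • x + z) - g x‖ ≤ B.indicator (fun _ => η) x := by
    intro x
    by_cases hx : x ∈ B
    · rw [indicator_of_mem hx]
      rw [← dist_eq_norm]
      refine (hδ ?_).le
      rw [dist_eq_norm, show l • x + z - x = (l - 1) • x + z by module]
      refine (norm_add_le _ _).trans_lt ?_
      rw [norm_smul, Real.norm_eq_abs]
      have hxB : ‖x‖ ≤ 2 * |R| + 1 := by simpa [hB] using hx
      have hpos : 0 < 2 * |R| + 2 := by positivity
      calc |l - 1| * ‖x‖ + ‖z‖ ≤ |l - 1| * (2 * |R| + 1) + ‖z‖ := by gcongr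
        _ < δ' / (2 * |R| + 2) * (2 * |R| + 1) + δ' / (2 * |R| + 2) := by
            have : 0 < 2 * |R| + 1 := by positivity
            gcongr
        _ = δ' := by field_simp; ring
    · rw [indicator_of_notMem hx]
      have hxB : 2 * |R| + 1 < ‖x‖ := by simpa [hB] using hx
      have g1 : g x = 0 := by
        by_contra h0
        have := hR' x h0
        have := abs_nonneg R
        linarith
      have g2 : g (l • x + z) = 0 := by
        by_contra h0
        have h1 := hR' _ h0
        have h2 : ‖l • x‖ ≤ |R| + 1 / 2 := by
          calc ‖l • x‖ = ‖(l • x + z) - z‖ := by simp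
            _ ≤ _ := (norm_sub_le _ _).trans (by linarith)
        rw [norm_smul, Real.norm_eq_abs, abs_of_pos (by linarith)] at h2
        nlinarith [norm_nonneg x]
      simp [g1, g2]
  have hgb : eLpNorm (fun x => g (l • x + z) - g x) 2 volume ≤ ε / 4 := by
    refine (eLpNorm_mono (g := B.indicator fun _ => η) fun x => ?_).trans ?_
    · refine (hbound x).trans (le_abs_self _)
    · rw [eLpNorm_indicator_const (by exact Metric.isClosed_closedBall.measurableSet) (by simp)
        (by simp), mul_comm]
      refine le_trans (le_of_eq ?_) hηB
      rw [Real.enorm_eq_ofReal hη.le]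
      norm_num
  have hdecomp : (fun x => W (l • x + z) - W x) = ((fun x => (W - g) (l • x + z)) +
      (fun x => g (l • x + z) - g x)) - (W - g) := by
    ext x; simp
  have hcomp : AEStronglyMeasurable (fun x => (W - g) (l • x + z)) volume := by
    have hl0 : l ≠ 0 := by linarith
    refine (hWm.sub hgm).comp_quasiMeasurePreserving ?_
    have h1 : Measure.QuasiMeasurePreserving (fun x : Plane => l • x) volume volume :=
      ⟨by fun_prop, by
        rw [Measure.map_addHaar_smul _ hl0]; exact Measure.smul_absolutelyContinuous⟩
    exact (measurePreserving_add_right volume z).quasiMeasurePreserving.comp h1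
  rw [hdecomp]
  refine (eLpNorm_sub_le (hcomp.add hgl.aestronglyMeasurable) (hWm.sub hgm) (by norm_num)).trans ?_
  refine (add_le_add_left (eLpNorm_add_le hcomp hgl.aestronglyMeasurable (by norm_num)) _).trans ?_
  have h1 := (eLpNorm_comp_affine_le (hWm.sub hgm) hl12 z).trans (mul_le_mul_right hgW 2)
  calc _ ≤ 2 * (ε / 4) + ε / 4 + ε / 4 := by gcongr
    _ = 4 * (ε / 4) := by ring
    _ = ε := ENNReal.mul_div_cancel (by simp) (by simp)

/-- An average of affine transforms of `W` is as close to `W` as these transforms are. -/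
lemma eLpNorm_average_sub_le {W ρ : Plane → ℝ} (hWm : Measurable W) (hW : MemLp W 2 volume)
    (hρ : Continuous ρ) (hρc : HasCompactSupport ρ) (hρ0 : ∀ y, 0 ≤ ρ y) (hρ1 : ∫ y, ρ y = 1)
    {η : ℝ≥0∞} (l : ℝ) (z : Plane)
    (h : ∀ y, ρ y ≠ 0 → eLpNorm (fun x => W (l • x + z - y) - W x) 2 volume ≤ η) :
    eLpNorm (fun x => (∫ y, W y * ρ (l • x + z - y)) - W x) 2 volume ≤ η := by
  have hloc : LocallyIntegrable W volume := hW.locallyIntegrable (by norm_num)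
  have hρi : Integrable ρ := hρ.integrable_of_hasCompactSupport hρc
  have hflip : ∀ X : Plane, ∫ y, W y * ρ (X - y) = ∫ y, W (X - y) * ρ y := fun X => by
    rw [← integral_sub_left_eq_self (fun y => W y * ρ (X - y)) volume X]
    simp
  have hint : ∀ X : Plane, Integrable fun y => W (X - y) * ρ y := by
    intro X
    have h1 : Integrable fun y => W y * ρ (X - y) := by
      have hs : HasCompactSupport fun y => ρ (X - y) :=
        hρc.comp_homeomorph (Homeomorph.subLeft X)
      have := hloc.integrable_smul_right_of_hasCompactSupport
        (g := fun y => ρ (X - y)) (by fun_prop) hs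
      simpa using this
    simpa using h1.comp_sub_left X
  have hdiff : ∀ x, (∫ y, W y * ρ (l • x + z - y)) - W x
      = ∫ y, ρ y * (W (l • x + z - y) - W x) := by
    intro x
    rw [hflip]
    have : ∀ y, ρ y * (W (l • x + z - y) - W x) = W (l • x + z - y) * ρ y - W x * ρ y :=
      fun y => by ring
    simp_rw [this]
    rw [integral_sub (hint _) (hρi.const_mul _), integral_const_mul, hρ1, mul_one]
  -- With `ρ` as a probability density, the average is controlled pointwise by the `L¹(ν)` norm,
  -- hence by the `L²(ν)` norm; Tonelli then exchanges the integrals in `x` and `y`.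
  let ν : Measure Plane := volume.withDensity fun y => ‖ρ y‖ₑ
  have hρm : Measurable fun y => ‖ρ y‖ₑ := hρ.measurable.enorm
  have hν : IsProbabilityMeasure ν := ⟨by
    rw [withDensity_apply _ MeasurableSet.univ, Measure.restrict_univ]
    have : ∀ y, ‖ρ y‖ₑ = ENNReal.ofReal (ρ y) := fun y => Real.enorm_eq_ofReal (hρ0 y)
    simp_rw [this]
    rw [← ofReal_integral_eq_lintegral_ofReal hρi (Eventually.of_forall hρ0), hρ1,
      ENNReal.ofReal_one]⟩
  have hjm : Measurable fun p : Plane × Plane => ‖W (l • p.1 + z - p.2) - W p.1‖ₑ :=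
    ((hWm.comp (by fun_prop)).sub (hWm.comp measurable_fst)).enorm
  have hpt : ∀ x, ‖(∫ y, W y * ρ (l • x + z - y)) - W x‖ₑ ^ 2 ≤
      ∫⁻ y, ‖W (l • x + z - y) - W x‖ₑ ^ 2 ∂ν := by
    intro x
    have hm : Measurable fun y => W (l • x + z - y) - W x :=
      (hWm.comp (by fun_prop)).sub_const _
    have h1 : ‖(∫ y, W y * ρ (l • x + z - y)) - W x‖ₑ ≤
        eLpNorm (fun y => W (l • x + z - y) - W x) 1 ν := by
      rw [hdiff, eLpNorm_one_eq_lintegral_enorm,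
        lintegral_withDensity_eq_lintegral_mul _ hρm hm.enorm]
      refine (enorm_integral_le_lintegral_enorm _).trans (le_of_eq ?_)
      simp [enorm_mul]
    have h2 := h1.trans (eLpNorm_le_eLpNorm_of_exponent_le (p := 1) (q := 2) (by norm_num)
      hm.aestronglyMeasurable)
    rw [← eLpNorm_two_sq]
    gcongr
  have hsq : eLpNorm (fun x => (∫ y, W y * ρ (l • x + z - y)) - W x) 2 volume ^ 2 ≤ η ^ 2 := by
    rw [eLpNorm_two_sq]
    refine (lintegral_mono hpt).trans ?_
    rw [lintegral_lintegral_swap (hjm.pow_const 2).aemeasurable]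
    have hbd : ∀ᵐ y ∂ν, ∫⁻ x, ‖W (l • x + z - y) - W x‖ₑ ^ 2 ≤ η ^ 2 := by
      rw [ae_withDensity_iff hρm]
      refine Eventually.of_forall fun y hy => ?_
      rw [← eLpNorm_two_sq]
      have := h y (by simpa using hy)
      gcongr
    refine (lintegral_mono_ae hbd).trans ?_
    simp
  exact le_of_sq_le_sq hsq


/-- The mollification `W * ρ`. -/
def mollify (W ρ : Plane → ℝ) (X : Plane) : ℝ := ∫ y, W y * ρ (X - y)

lemma mollify_eq_convolution (W ρ : Plane → ℝ) :
    mollify W ρ = convolution W ρ (ContinuousLinearMap.mul ℝ ℝ) volume := rfl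

lemma contDiff_mollify {W ρ : Plane → ℝ} (hW : LocallyIntegrable W volume)
    (hρ : ContDiff ℝ ∞ ρ) (hρc : HasCompactSupport ρ) : ContDiff ℝ ∞ (mollify W ρ) := by
  rw [mollify_eq_convolution]
  exact hρc.contDiff_convolution_right _ hW hρ

lemma pd_mollify {W ρ : Plane → ℝ} (hW : LocallyIntegrable W volume)
    (hρ : ContDiff ℝ ∞ ρ) (hρc : HasCompactSupport ρ) (i : Fin 2) :
    pd i (mollify W ρ) = mollify W (pd i ρ) := by
  ext X
  rw [pd, mollify_eq_convolution,
    (hρc.hasFDerivAt_convolution_right (ContinuousLinearMap.mul ℝ ℝ) hW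
      (hρ.of_le (by simp)) X).fderiv,
    convolution_precompR_apply _ hW (hρc.fderiv ℝ) (hρ.continuous_fderiv (by simp))]
  rfl

lemma pd_comp_sub_left {ρ : Plane → ℝ} (hρ : ContDiff ℝ ∞ ρ) (X : Plane) (i : Fin 2) :
    pd i (fun y => ρ (X - y)) = fun y => -pd i ρ (X - y) := by
  ext y
  have h1 : HasFDerivAt (fun y : Plane => X - y) (-ContinuousLinearMap.id ℝ Plane) y :=
    (hasFDerivAt_id y).const_sub X
  have := ((hρ.differentiable (by simp) (X - y)).hasFDerivAt).comp y h1
  rw [pd, HasFDerivAt.fderiv (f := fun y => ρ (X - y)) this]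
  simp [pd]

/-- When the support of `y ↦ ρ (X - y)` lies in `U`, this function is admissible in the definition
of the weak derivative, and the derivative moves from the kernel to `w`. `W` and `G` represent the
extensions of `w` and `g` by zero. -/
lemma pd_mollify_of_hasWeakPd {U : Set Plane} {w g W G ρ : Plane → ℝ} {i : Fin 2}
    (hg : HasWeakPd U i w g) (hW : W =ᵐ[volume] U.indicator w) (hG : G =ᵐ[volume] U.indicator g)
    (hU : IsOpen U) (hWl : LocallyIntegrable W volume)
    (hρ : ContDiff ℝ ∞ ρ) (hρc : HasCompactSupport ρ) {X : Plane}
    (hX : tsupport (fun y => ρ (X - y)) ⊆ U) :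
    pd i (mollify W ρ) X = mollify G ρ X := by
  have htest : IsTestFun U (fun y => ρ (X - y)) :=
    ⟨hρ.comp (contDiff_const.sub contDiff_id), hρc.comp_homeomorph (Homeomorph.subLeft X), hX⟩
  have hind : ∀ (F f h : Plane → ℝ), F =ᵐ[volume] U.indicator f →
      ∫ y, F y * h y = ∫ y in U, f y * h y := by
    intro F f h hF
    rw [← integral_indicator hU.measurableSet]
    refine integral_congr_ae (hF.mono fun y hy => ?_)
    simp only
    rw [hy]
    by_cases hyU : y ∈ U <;> simp [hyU]
  have h1 := hg _ htest
  rw [pd_comp_sub_left hρ] at h1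
  rw [pd_mollify hWl hρ hρc, mollify, mollify, hind W w _ hW, hind G g _ hG]
  simp only [mul_neg, integral_neg] at h1
  linarith

lemma eLpNorm_restrict_sub_le {U : Set Plane} (hU : IsOpen U) {f F h : Plane → ℝ}
    (hF : F =ᵐ[volume] U.indicator f) :
    eLpNorm (fun x => h x - f x) 2 (volume.restrict U) ≤ eLpNorm (fun x => h x - F x) 2 volume := by
  refine le_trans (le_of_eq (eLpNorm_congr_ae ?_)) (eLpNorm_restrict_le _ 2 volume U)
  filter_upwards [ae_restrict_of_ae hF, ae_restrict_mem hU.measurableSet] with x hx hxU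
  rw [hx, indicator_of_mem hxU]

/-- Functions that are smooth up to the boundary are dense in `H¹` of a convex open set. -/
theorem exists_smooth_approx {U : Set Plane} (hU : IsOpen U) (hc : Convex ℝ U) (hne : U.Nonempty)
    {w : Plane → ℝ} (hw : MemL2 U w) {g : Fin 2 → Plane → ℝ} (hg : ∀ i, MemL2 U (g i))
    (hwg : ∀ i, HasWeakPd U i w (g i)) :
    ∃ ψ : ℕ → Plane → ℝ, (∀ n, ContDiff ℝ ∞ (ψ n)) ∧
      Tendsto (fun n => eLpNorm (fun x => ψ n x - w x) 2 (volume.restrict U)) atTop (𝓝 0) ∧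
      ∀ i, Tendsto (fun n => eLpNorm (fun x => pd i (ψ n) x - g i x) 2 (volume.restrict U))
        atTop (𝓝 0) := by
  obtain ⟨x₀, hx₀⟩ := hne
  obtain ⟨r, hr, hball⟩ := Metric.nhds_basis_closedBall.mem_iff.1 (hU.mem_nhds hx₀)
  have hrep : ∀ f : Plane → ℝ, MemL2 U f → ∃ F : Plane → ℝ, Measurable F ∧ MemLp F 2 volume ∧
      F =ᵐ[volume] U.indicator f := by
    intro f hf
    have h1 : MemLp (U.indicator f) 2 volume := (memLp_indicator_iff_restrict hU.measurableSet).2 hf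
    exact ⟨h1.1.mk _, h1.1.stronglyMeasurable_mk.measurable, h1.ae_eq h1.1.ae_eq_mk,
      h1.1.ae_eq_mk.symm⟩
  obtain ⟨W, hWm, hW2, hWw⟩ := hrep w hw
  choose G hGm hG2 hGg using fun i => hrep (g i) (hg i)
  have hloc : LocallyIntegrable W volume := hW2.locallyIntegrable (by norm_num)
  -- The shift by `2` keeps `t n` strictly between `0` and `1`.
  let t : ℕ → ℝ := fun n => 1 / ((n : ℝ) + 2)
  have ht0 : ∀ n, 0 < t n := fun n => by positivity
  have ht1 : ∀ n, t n < 1 := fun n => by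
    simp only [t]; rw [div_lt_one (by positivity)]; have : (0:ℝ) ≤ n := by positivity
    linarith
  have htl : Tendsto t atTop (𝓝 0) := by
    have := tendsto_one_div_add_atTop_nhds_zero_nat (𝕜 := ℝ)
    have h2 := (tendsto_add_atTop_iff_nat 1).2 this
    refine h2.congr fun n => ?_
    simp only [t]; push_cast; ring
  -- The kernel has radius `t n * r`: contracting `U` towards `x₀` by the factor `1 - t n` leaves
  -- exactly this margin inside `U`, as `U` is convex and contains the ball of radius `r` about
  -- `x₀`.
  let bump : ∀ n, ContDiffBump (0 : Plane) := fun n =>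
    ⟨t n * r / 2, t n * r, by have := ht0 n; positivity, by
      have := mul_pos (ht0 n) hr; linarith⟩
  let ρ : ℕ → Plane → ℝ := fun n => (bump n).normed volume
  have hρ : ∀ n, ContDiff ℝ ∞ (ρ n) := fun n => (bump n).contDiff_normed
  have hρc : ∀ n, HasCompactSupport (ρ n) := fun n => (bump n).hasCompactSupport_normed
  have hρs : ∀ n, tsupport (ρ n) = Metric.closedBall 0 (t n * r) := fun n =>
    (bump n).tsupport_normed_eq
  let A : ℕ → Plane → Plane := fun n x => (1 - t n) • x + t n • x₀
  have happrox : ∀ F : Plane → ℝ, Measurable F → MemLp F 2 volume →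
      Tendsto (fun n => eLpNorm (fun x => mollify F (ρ n) (A n x) - F x) 2 volume)
        atTop (𝓝 0) := by
    intro F hFm hF2
    rw [ENNReal.tendsto_nhds_zero]
    intro ε hε
    obtain ⟨δ, hδ, hδF⟩ := exists_eLpNorm_comp_affine_sub_le hF2 hε.ne'
    have hev : ∀ᶠ n in atTop, t n * (‖x₀‖ + r + 1) < δ := by
      have := htl.mul_const (‖x₀‖ + r + 1)
      rw [zero_mul] at this
      exact this.eventually (Iio_mem_nhds hδ)
    filter_upwards [hev] with n hn
    have := ht0 n
    refine eLpNorm_average_sub_le hFm hF2 (hρ n).continuous (hρc n) (bump n).nonneg_normed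
      (bump n).integral_normed (1 - t n) (t n • x₀) fun y hy => ?_
    have hyn : ‖y‖ ≤ t n * r := by
      have : y ∈ tsupport (ρ n) := subset_tsupport _ hy
      simpa [hρs] using this
    have := hδF (1 - t n) (t n • x₀ - y) (by
      rw [show 1 - t n - 1 = -t n by ring, abs_neg, abs_of_pos (ht0 n)]
      refine lt_of_le_of_lt ?_ hn
      nlinarith [norm_nonneg x₀]) (by
      refine lt_of_le_of_lt ((norm_sub_le _ _).trans ?_) hn
      rw [norm_smul, Real.norm_eq_abs, abs_of_pos (ht0 n)]
      nlinarith)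
    simpa only [add_sub_assoc] using this
  have hA : ∀ n, ContDiff ℝ ∞ (A n) := fun n => by fun_prop
  refine ⟨fun n x => mollify W (ρ n) (A n x),
    fun n => (contDiff_mollify hloc (hρ n) (hρc n)).comp (hA n), ?_, fun i => ?_⟩
  · exact tendsto_of_tendsto_of_tendsto_of_le_of_le tendsto_const_nhds (happrox W hWm hW2)
      (fun _ => zero_le) fun n => eLpNorm_restrict_sub_le hU hWw
  · have hpd : ∀ n, ∀ x ∈ U, pd i (fun x => mollify W (ρ n) (A n x)) x =
        (1 - t n) * mollify (G i) (ρ n) (A n x) := by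
      intro n x hx
      have hsub : tsupport (fun y => ρ n (A n x - y)) ⊆ U := by
        have h1 : tsupport (fun y => ρ n (A n x - y)) ⊆ Metric.closedBall (A n x) (t n * r) := by
          refine closure_minimal (fun y hy => ?_) Metric.isClosed_closedBall
          have : A n x - y ∈ tsupport (ρ n) := subset_tsupport _ hy
          rw [hρs] at this
          rw [Metric.mem_closedBall, dist_comm, dist_eq_norm]
          simpa using this
        refine h1.trans fun y hy => ?_
        -- A point `y` within `t n * r` of `A n x` is the convex combination of `x` and this point
        -- of the ball about `x₀`, with weights `1 - t n` and `t n`.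
        have hy' : x₀ + (t n)⁻¹ • (y - A n x) ∈ U := by
          apply hball
          rw [Metric.mem_closedBall, dist_eq_norm, add_sub_cancel_left, norm_smul, norm_inv,
            Real.norm_eq_abs, abs_of_pos (ht0 n), inv_mul_le_iff₀ (ht0 n), ← dist_eq_norm]
          exact hy
        have := hc hx hy' (by have := ht1 n; linarith : 0 ≤ 1 - t n) (ht0 n).le (by ring)
        convert this using 1
        rw [smul_add, smul_smul, mul_inv_cancel₀ (ht0 n).ne']
        simp only [A]
        module
      rw [← pd_mollify_of_hasWeakPd (hwg i) hWw (hGg i) hU hloc (hρ n) (hρc n) hsub]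
      have hd := ((contDiff_mollify hloc (hρ n) (hρc n)).differentiable (by simp)
        (A n x)).hasFDerivAt
      have hAd : HasFDerivAt (A n) ((1 - t n) • ContinuousLinearMap.id ℝ Plane) x :=
        ((hasFDerivAt_id x).const_smul (1 - t n)).add_const _
      rw [pd, HasFDerivAt.fderiv (f := fun x => mollify W (ρ n) (A n x)) (hd.comp x hAd)]
      simp [pd]
    have hbd : Tendsto (fun n => eLpNorm (fun x => mollify (G i) (ρ n) (A n x) - G i x) 2 volume
        + ‖t n‖ₑ * eLpNorm (G i) 2 volume) atTop (𝓝 0) := by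
      have h1 : Tendsto (fun n => ‖t n‖ₑ) atTop (𝓝 0) := by
        have := (continuous_enorm.tendsto (0 : ℝ)).comp htl
        simpa [Function.comp_def] using this
      have h2 := ENNReal.Tendsto.mul_const (b := eLpNorm (G i) 2 volume) h1
        (Or.inr (hG2 i).2.ne)
      simpa using (happrox (G i) (hGm i) (hG2 i)).add h2
    refine tendsto_of_tendsto_of_tendsto_of_le_of_le tendsto_const_nhds hbd
      (fun _ => zero_le) fun n => ?_
    have e1 : eLpNorm (fun x => pd i (fun x => mollify W (ρ n) (A n x)) x - g i x) 2
        (volume.restrict U) = eLpNorm (fun x => (1 - t n) * mollify (G i) (ρ n) (A n x) - g i x) 2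
        (volume.restrict U) := by
      refine eLpNorm_congr_ae ?_
      filter_upwards [ae_restrict_mem hU.measurableSet] with x hx
      rw [hpd n x hx]
    simp only at e1 ⊢
    rw [e1]
    refine (eLpNorm_restrict_sub_le hU (hGg i)).trans ?_
    -- The chain rule factor `1 - t n` costs an error `t n • G i`, which tends to zero.
    have e2 : (fun x => (1 - t n) * mollify (G i) (ρ n) (A n x) - G i x) =
        (1 - t n) • (fun x => mollify (G i) (ρ n) (A n x) - G i x) - t n • G i := by
      ext x; simp; ring
    have m1 : AEStronglyMeasurable (fun x => mollify (G i) (ρ n) (A n x) - G i x) volume :=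
      (((contDiff_mollify ((hG2 i).locallyIntegrable (by norm_num)) (hρ n) (hρc n)).comp
        (hA n)).continuous.aestronglyMeasurable).sub (hG2 i).1
    rw [e2]
    refine (eLpNorm_sub_le (m1.const_smul _) ((hG2 i).1.const_smul _) (by norm_num)).trans ?_
    rw [eLpNorm_const_smul, eLpNorm_const_smul]
    gcongr
    refine mul_le_of_le_one_left zero_le ?_
    rw [Real.enorm_eq_ofReal (by have := ht1 n; linarith)]
    exact ENNReal.ofReal_le_one.2 (by have := ht0 n; linarith)


/-! ### Elements as subsets of the domain -/

lemma Triangulation.Elem.convex_cell {T : Triangulation Ω} (K : T.Elem) : Convex ℝ K.cell :=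
  convex_convexHull ℝ _

lemma Triangulation.Elem.cell_subset {T : Triangulation Ω} (K : T.Elem) : K.cell ⊆ closure Ω := by
  rw [← T.space_eq]
  exact T.convexHull_subset_space K.2.1

lemma Triangulation.Elem.interior_subset {T : Triangulation Ω} (hΩ : IsPolygonalDomain Ω)
    (K : T.Elem) : interior K.cell ⊆ Ω :=
  (interior_mono K.cell_subset).trans hΩ.interior_closure.subset

/-- The absence of slits enters here: `K` lies only in the closure of `Ω`, whose interior is `Ω`. -/
lemma Triangulation.Elem.interior_ae_eq {T : Triangulation Ω} (K : T.Elem) :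
    (interior K.cell : Set Plane) =ᵐ[volume] K.cell :=
  interior_ae_eq_of_null_frontier (K.convex_cell.addHaar_frontier volume)

lemma Triangulation.Elem.area_eq {T : Triangulation Ω} (K : T.Elem) :
    K.area = volume.restrict (interior K.cell) :=
  (Measure.restrict_congr_set K.interior_ae_eq).symm

lemma Triangulation.Elem.interior_nonempty {T : Triangulation Ω} (K : T.Elem) :
    (interior K.cell).Nonempty := by
  rw [Elem.cell, interior_convexHull_nonempty_iff_affineSpan_eq_top]
  have hi := T.indep K.2.1
  have h := hi.affineSpan_eq_top_iff_card_eq_finrank_add_one.2 (by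
    simp [K.2.2])
  simpa using h

lemma MemL2.mono {U : Set Plane} {w : Plane → ℝ} (hw : MemL2 Ω w) (hU : U ⊆ Ω) : MemL2 U w :=
  MemLp.mono_measure (Measure.restrict_mono hU le_rfl) hw

lemma MemL2.memLp_area {T : Triangulation Ω} (hΩ : IsPolygonalDomain Ω) {w : Plane → ℝ}
    (hw : MemL2 Ω w) (K : T.Elem) : MemLp w 2 K.area := by
  rw [K.area_eq]
  exact hw.mono (K.interior_subset hΩ)

lemma IsTestFun.mono {U : Set Plane} {φ : Plane → ℝ} (hφ : IsTestFun U φ) (hU : U ⊆ Ω) :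
    IsTestFun Ω φ := ⟨hφ.smooth, hφ.compact, hφ.support.trans hU⟩

lemma IsTestFun.eq_zero {U : Set Plane} {φ : Plane → ℝ} (hφ : IsTestFun U φ) {x : Plane}
    (hx : x ∉ U) : φ x = 0 :=
  image_eq_zero_of_notMem_tsupport fun h => hx (hφ.support h)

lemma IsTestFun.pd {U : Set Plane} {φ : Plane → ℝ} (hφ : IsTestFun U φ) (i : Fin 2) :
    IsTestFun U (pd i φ) := by
  refine ⟨pds_smooth hφ.smooth [i], hφ.compact.fderiv_apply ℝ _, ?_⟩
  exact (tsupport_fderiv_apply_subset ℝ _).trans hφ.support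

lemma HasWeakPd.mono {U : Set Plane} {i : Fin 2} {w g : Plane → ℝ} (hΩ : IsOpen Ω)
    (hw : HasWeakPd Ω i w g) (hU : U ⊆ Ω) : HasWeakPd U i w g := by
  intro φ hφ
  have h := hw φ (hφ.mono hU)
  rwa [setIntegral_eq_of_subset_of_forall_sdiff_eq_zero hΩ.measurableSet hU
      (fun x hx => by rw [(hφ.pd i).eq_zero hx.2, mul_zero]),
    setIntegral_eq_of_subset_of_forall_sdiff_eq_zero hΩ.measurableSet hU
      (fun x hx => by rw [hφ.eq_zero hx.2, mul_zero])] at h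

/-- The choice in `weakPd` is meaningful because membership in `H^{m+1}` provides a candidate. -/
lemma MemH.weakPd_spec {m : ℕ} {w : Plane → ℝ} (hw : MemH Ω (m + 1) w) (i : Fin 2) :
    MemL2 Ω (weakPd Ω i w) ∧ HasWeakPd Ω i w (weakPd Ω i w) := by
  obtain ⟨g, hg, hgm⟩ := hw.2 i
  exact Classical.epsilon_spec (p := fun g : Plane → ℝ => MemL2 Ω g ∧ HasWeakPd Ω i w g)
    ⟨g, hgm.memL2, hg⟩

/-! ### Convergence in `H¹` of an element and traces -/

/-- `ψ → w` in `H¹(K)` along the filter `l`. -/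
structure TendstoH1 {T : Triangulation Ω} (K : T.Elem) {ι : Type*} (l : Filter ι)
    (ψ : ι → Plane → ℝ) (w : Plane → ℝ) : Prop where
  smooth : ∀ n, ContDiff ℝ ∞ (ψ n)
  val : Tendsto (fun n => eLpNorm (fun x => ψ n x - w x) 2 K.area) l (𝓝 0)
  grad : ∀ i, Tendsto (fun n => eLpNorm (fun x => pd i (ψ n) x - weakPd Ω i w x) 2 K.area) l (𝓝 0)

/-- Composition with the two projections of `atTop ×ˢ atTop` turns a convergent sequence into a
Cauchy statement. -/
lemma TendstoH1.comp {T : Triangulation Ω} {K : T.Elem} {ι κ : Type*} {l : Filter ι}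
    {l' : Filter κ} {ψ : ι → Plane → ℝ} {w : Plane → ℝ} (h : TendstoH1 K l ψ w) {j : κ → ι}
    (hj : Tendsto j l' l) : TendstoH1 K l' (fun n => ψ (j n)) w :=
  ⟨fun _ => h.smooth _, h.val.comp hj, fun i => (h.grad i).comp hj⟩

lemma exists_tendstoH1 {T : Triangulation Ω} (hΩ : IsPolygonalDomain Ω) {w : Plane → ℝ}
    (hw : MemH Ω 1 w) (K : T.Elem) : ∃ ψ : ℕ → Plane → ℝ, TendstoH1 K atTop ψ w := by
  have hK := K.interior_subset hΩ
  obtain ⟨ψ, h1, h2, h3⟩ := exists_smooth_approx isOpen_interior K.convex_cell.interior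
    K.interior_nonempty (hw.memL2.mono hK) (fun i => (hw.weakPd_spec i).1.mono hK)
    (fun i => (hw.weakPd_spec i).2.mono hΩ.isOpen hK)
  rw [← K.area_eq] at h2 h3
  exact ⟨ψ, h1, h2, h3⟩

lemma eLpNorm_sq_eq_ofReal {μ : Measure Plane} {g : Plane → ℝ} (hg : MemLp g 2 μ) :
    eLpNorm g 2 μ ^ 2 = ENNReal.ofReal (∫ x, g x ^ 2 ∂μ) := by
  rw [eLpNorm_two_sq, ofReal_integral_eq_lintegral_ofReal hg.integrable_sq
    (Eventually.of_forall fun x => sq_nonneg _)]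
  congr 1
  ext x
  rw [← ofReal_norm, ← ENNReal.ofReal_pow (norm_nonneg _), Real.norm_eq_abs, sq_abs]

lemma Triangulation.Elem.exists_trace_bound_eLpNorm {T : Triangulation Ω} {K : T.Elem}
    {e : T.Edge} (he : e ∈ K.edges) : ∃ C : ℝ≥0∞, C ≠ ⊤ ∧ ∀ ψ : Plane → ℝ, ContDiff ℝ 1 ψ →
      eLpNorm ψ 2 e.length ^ 2 ≤
        C * (eLpNorm ψ 2 K.area ^ 2 + ∑ i, eLpNorm (pd i ψ) 2 K.area ^ 2) := by
  obtain ⟨C, hC, h⟩ := Elem.exists_trace_bound he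
  refine ⟨ENNReal.ofReal C, ENNReal.ofReal_ne_top, fun ψ hψ => ?_⟩
  rw [eLpNorm_sq_eq_ofReal (e.memLp hψ.continuous 2),
    eLpNorm_sq_eq_ofReal (K.memLp hψ.continuous 2)]
  simp_rw [fun i => eLpNorm_sq_eq_ofReal (K.memLp (continuous_pd hψ i) 2)]
  rw [← ENNReal.ofReal_sum_of_nonneg fun i _ => integral_nonneg fun x => sq_nonneg _,
    ← ENNReal.ofReal_add (integral_nonneg fun x => sq_nonneg _)
      (Finset.sum_nonneg fun i _ => integral_nonneg fun x => sq_nonneg _),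
    ← ENNReal.ofReal_mul hC]
  exact ENNReal.ofReal_le_ofReal (h ψ hψ)

lemma tendsto_eLpNorm_sub {μ : Measure Plane} {ι : Type*} {l : Filter ι}
    {F G : ι → Plane → ℝ} {w : Plane → ℝ} (hw : AEStronglyMeasurable w μ)
    (hF : ∀ n, AEStronglyMeasurable (F n) μ) (hG : ∀ n, AEStronglyMeasurable (G n) μ)
    (hFw : Tendsto (fun n => eLpNorm (fun x => F n x - w x) 2 μ) l (𝓝 0))
    (hGw : Tendsto (fun n => eLpNorm (fun x => G n x - w x) 2 μ) l (𝓝 0)) :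
    Tendsto (fun n => eLpNorm (fun x => F n x - G n x) 2 μ) l (𝓝 0) := by
  have := hFw.add hGw
  rw [add_zero] at this
  refine tendsto_of_tendsto_of_tendsto_of_le_of_le tendsto_const_nhds this
    (fun _ => zero_le) fun n => ?_
  have h1 : (fun x => F n x - G n x) = (fun x => F n x - w x) - (fun x => G n x - w x) := by
    ext x; simp
  rw [h1]
  exact eLpNorm_sub_le ((hF n).sub hw) ((hG n).sub hw) (by norm_num)

lemma pd_sub {φ ψ : Plane → ℝ} (h : ContDiff ℝ ∞ φ) (h' : ContDiff ℝ ∞ ψ) (i : Fin 2) :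
    pd i (fun x => φ x - ψ x) = fun x => pd i φ x - pd i ψ x := by
  ext x
  simp only [pd]
  rw [fderiv_fun_sub (h.differentiable (by simp) x) (h'.differentiable (by simp) x)]
  rfl

/-- Sequences with the same limit in `H¹(K)` have the same limit in `L²(e)`. -/
lemma TendstoH1.tendsto_edge_sub {T : Triangulation Ω} (hΩ : IsPolygonalDomain Ω)
    {K : T.Elem} {e : T.Edge} (he : e ∈ K.edges) {ι : Type*} {l : Filter ι}
    {ψ χ : ι → Plane → ℝ} {w : Plane → ℝ} (hw : MemH Ω 1 w)
    (hψ : TendstoH1 K l ψ w) (hχ : TendstoH1 K l χ w) :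
    Tendsto (fun n => eLpNorm (fun x => ψ n x - χ n x) 2 e.length) l (𝓝 0) := by
  obtain ⟨C, hC, h⟩ := Triangulation.Elem.exists_trace_bound_eLpNorm he
  have hwm := (hw.memL2.memLp_area hΩ K).1
  have hv := tendsto_eLpNorm_sub hwm
    (fun n => (hψ.smooth n).continuous.aestronglyMeasurable)
    (fun n => (hχ.smooth n).continuous.aestronglyMeasurable) hψ.val hχ.val
  have hg := fun i => tendsto_eLpNorm_sub (((hw.weakPd_spec i).1.memLp_area hΩ K).1)
    (fun n => (continuous_pd ((hψ.smooth n).of_le (by simp)) i).aestronglyMeasurable)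
    (fun n => (continuous_pd ((hχ.smooth n).of_le (by simp)) i).aestronglyMeasurable)
    (hψ.grad i) (hχ.grad i)
  have hsq : Tendsto (fun n => eLpNorm (fun x => ψ n x - χ n x) 2 e.length ^ 2) l (𝓝 0) := by
    have hlim := ENNReal.Tendsto.const_mul (a := C) ((ENNReal.Tendsto.pow (n := 2) hv).add
      (tendsto_finsetSum Finset.univ fun i _ => ENNReal.Tendsto.pow (n := 2) (hg i))) (Or.inr hC)
    simp only [ne_eq, OfNat.ofNat_ne_zero, not_false_eq_true, zero_pow, Finset.sum_const_zero,
      add_zero, mul_zero] at hlim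
    refine tendsto_of_tendsto_of_tendsto_of_le_of_le tendsto_const_nhds hlim
      (fun _ => zero_le) fun n => ?_
    have := h (fun x => ψ n x - χ n x) (((hψ.smooth n).sub (hχ.smooth n)).of_le (by simp))
    simpa only [pd_sub (hψ.smooth n) (hχ.smooth n)] using this
  have := (ENNReal.continuous_rpow_const (y := 1 / 2)).tendsto 0 |>.comp hsq
  simp only [Function.comp_def] at this
  rw [ENNReal.zero_rpow_of_pos (by norm_num)] at this
  refine this.congr fun n => ?_
  rw [← ENNReal.rpow_natCast, ← ENNReal.rpow_mul]
  norm_num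

lemma isTraceFrom_iff {T : Triangulation Ω} {K : T.Elem} {e : T.Edge} {w g : Plane → ℝ} :
    IsTraceFrom K e w g ↔ MemLp g 2 e.length ∧ ∃ ψ : ℕ → Plane → ℝ, TendstoH1 K atTop ψ w ∧
      Tendsto (fun n => eLpNorm (fun x => ψ n x - g x) 2 e.length) atTop (𝓝 0) :=
  ⟨fun ⟨h, ψ, h1, h2, h3, h4⟩ => ⟨h, ψ, ⟨h1, h2, h3⟩, h4⟩,
    fun ⟨h, ψ, ⟨h1, h2, h3⟩, h4⟩ => ⟨h, ψ, h1, h2, h3, h4⟩⟩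

/-- A trace does not depend on its approximating sequence: the trace inequality applies to the
difference of two such sequences. -/
lemma IsTraceFrom.tendsto_edge {T : Triangulation Ω} (hΩ : IsPolygonalDomain Ω)
    {K : T.Elem} {e : T.Edge} (he : e ∈ K.edges) {ψ : ℕ → Plane → ℝ} {w g : Plane → ℝ}
    (hw : MemH Ω 1 w) (hg : IsTraceFrom K e w g) (hψ : TendstoH1 K atTop ψ w) :
    Tendsto (fun n => eLpNorm (fun x => ψ n x - g x) 2 e.length) atTop (𝓝 0) := by
  obtain ⟨hg2, χ, hχ, hχg⟩ := isTraceFrom_iff.1 hg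
  have := (hψ.tendsto_edge_sub hΩ he hw hχ).add hχg
  rw [add_zero] at this
  refine tendsto_of_tendsto_of_tendsto_of_le_of_le tendsto_const_nhds this
    (fun _ => zero_le) fun n => ?_
  have h1 : (fun x => ψ n x - g x) = (fun x => ψ n x - χ n x) + (fun x => χ n x - g x) := by
    ext x; simp
  rw [h1]
  have m1 := (hψ.smooth n).continuous.aestronglyMeasurable (μ := e.length)
  have m2 := (hχ.smooth n).continuous.aestronglyMeasurable (μ := e.length)
  exact eLpNorm_add_le (m1.sub m2) (m2.sub hg2.1) (by norm_num)

lemma IsTraceFrom.congr {T : Triangulation Ω} {K : T.Elem} {e : T.Edge} {w g g' : Plane → ℝ}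
    (hg : IsTraceFrom K e w g) (h : g =ᵐ[e.length] g') : IsTraceFrom K e w g' := by
  obtain ⟨hg2, χ, hχ, hχg⟩ := isTraceFrom_iff.1 hg
  refine isTraceFrom_iff.2 ⟨(memLp_congr_ae h).1 hg2, χ, hχ, hχg.congr fun n => ?_⟩
  refine eLpNorm_congr_ae (h.mono fun x hx => ?_)
  simp only
  rw [hx]

/-- By the trace inequality a smooth sequence converging in `H¹(K)` is Cauchy in `L²(e)`; the trace
is its limit. -/
lemma exists_isTraceFrom {T : Triangulation Ω} (hΩ : IsPolygonalDomain Ω) {w : Plane → ℝ}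
    (hw : MemH Ω 1 w) {K : T.Elem} {e : T.Edge} (he : e ∈ K.edges) :
    ∃ g, IsTraceFrom K e w g := by
  obtain ⟨ψ, hψ⟩ := exists_tendstoH1 hΩ hw K
  have hm : ∀ n, MemLp (ψ n) 2 e.length := fun n => e.memLp (hψ.smooth n).continuous 2
  have hdouble := (hψ.comp (tendsto_fst (f := atTop) (g := (atTop : Filter ℕ)))).tendsto_edge_sub
    hΩ he hw (hψ.comp (tendsto_snd (f := (atTop : Filter ℕ)) (g := atTop)))
  have hcau : CauchySeq fun n => (hm n).toLp (ψ n) := by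
    rw [Lp.cauchySeq_Lp_iff_cauchySeq_eLpNorm, ← prod_atTop_atTop_eq]
    refine hdouble.congr fun n => eLpNorm_congr_ae ?_
    filter_upwards [(hm n.1).coeFn_toLp, (hm n.2).coeFn_toLp] with x h1 h2
    simp [h1, h2]
  obtain ⟨G, hG⟩ := cauchySeq_tendsto_of_complete hcau
  have hG' := (Lp.tendsto_Lp_iff_tendsto_eLpNorm' _ _).1 hG
  refine ⟨G, isTraceFrom_iff.2 ⟨Lp.memLp G, ψ, hψ, hG'.congr fun n => eLpNorm_congr_ae ?_⟩⟩
  filter_upwards [(hm n).coeFn_toLp] with x h1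
  simp [h1]

/-! ### Green's formula on an element. -/

lemma tendsto_integral_mul {μ : Measure Plane} {ι : Type*} {l : Filter ι}
    {F : ι → Plane → ℝ} {w φ : Plane → ℝ} (hF : ∀ n, MemLp (F n) 2 μ) (hw : MemLp w 2 μ)
    (hφ : MemLp φ 2 μ) (h : Tendsto (fun n => eLpNorm (fun x => F n x - w x) 2 μ) l (𝓝 0)) :
    Tendsto (fun n => ∫ x, F n x * φ x ∂μ) l (𝓝 (∫ x, w x * φ x ∂μ)) := by
  refine tendsto_integral_of_L1' (fun x => w x * φ x) (MemLp.integrable_mul hw hφ).1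
    (Eventually.of_forall fun n => MemLp.integrable_mul (hF n) hφ) ?_
  have hlim := ENNReal.Tendsto.mul_const (b := eLpNorm φ 2 μ) h (Or.inr hφ.2.ne)
  rw [zero_mul] at hlim
  refine tendsto_of_tendsto_of_tendsto_of_le_of_le tendsto_const_nhds hlim
    (fun _ => zero_le) fun n => ?_
  have h1 : (fun x => F n x * φ x) - (fun x => w x * φ x) = (fun x => F n x - w x) • φ := by
    ext x; simp; ring
  rw [h1]
  exact eLpNorm_smul_le_mul_eLpNorm hφ.1 ((hF n).1.sub hw.1)

/-- Green's formula on an element for functions smooth up to the boundary. -/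
lemma Triangulation.Elem.green_smooth {T : Triangulation Ω} (K : T.Elem) {ψ φ : Plane → ℝ}
    (hψ : ContDiff ℝ ∞ ψ) (hφ : ContDiff ℝ ∞ φ) (i : Fin 2) :
    (∫ x, ψ x * pd i φ x ∂K.area) + ∫ x, pd i ψ x * φ x ∂K.area =
      ∑ e ∈ K.edges, K.outward e i * ∫ x, ψ x * φ x ∂e.length := by
  have h1 := K.integral_fderiv (ψ := fun x => ψ x * φ x) ((hψ.mul hφ).of_le (by simp))
    (EuclideanSpace.single i 1)
  have h2 : ∀ e, ⟪K.outward e, EuclideanSpace.single i (1 : ℝ)⟫ = K.outward e i := fun e => by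
    rw [EuclideanSpace.inner_single_right]; simp
  simp_rw [h2] at h1
  have i1 : Integrable (fun x => ψ x * pd i φ x) K.area :=
    K.integrable (hψ.continuous.mul (continuous_pd (hφ.of_le (by simp)) i))
  have i2 : Integrable (fun x => pd i ψ x * φ x) K.area :=
    K.integrable ((continuous_pd (hψ.of_le (by simp)) i).mul hφ.continuous)
  rw [← h1, ← integral_add i1 i2]
  congr 1
  ext x
  rw [fderiv_fun_mul (hψ.differentiable (by simp) x) (hφ.differentiable (by simp) x)]
  simp [pd]
  ring

/-- Green's formula on an element for functions of `H¹`. -/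
lemma Triangulation.Elem.green_trace {T : Triangulation Ω} (hΩ : IsPolygonalDomain Ω)
    {w : Plane → ℝ} (hw : MemH Ω 1 w) (K : T.Elem) {g : T.Edge → Plane → ℝ}
    (hg : ∀ e ∈ K.edges, IsTraceFrom K e w (g e)) {φ : Plane → ℝ} (hφ : ContDiff ℝ ∞ φ)
    (i : Fin 2) :
    (∫ x, w x * pd i φ x ∂K.area) + ∫ x, weakPd Ω i w x * φ x ∂K.area =
      ∑ e ∈ K.edges, K.outward e i * ∫ x, g e x * φ x ∂e.length := by
  obtain ⟨ψ, hψ⟩ := exists_tendstoH1 hΩ hw K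
  have hφc := hφ.continuous
  have l1 := tendsto_integral_mul (fun n => K.memLp (hψ.smooth n).continuous 2)
    (hw.memL2.memLp_area hΩ K) (K.memLp (continuous_pd (hφ.of_le (by simp)) i) 2) hψ.val
  have l2 := tendsto_integral_mul
    (fun n => K.memLp (continuous_pd ((hψ.smooth n).of_le (by simp)) i) 2)
    ((hw.weakPd_spec i).1.memLp_area hΩ K) (K.memLp hφc 2) (hψ.grad i)
  have l3 : Tendsto (fun n => ∑ e ∈ K.edges, K.outward e i * ∫ x, ψ n x * φ x ∂e.length) atTop
      (𝓝 (∑ e ∈ K.edges, K.outward e i * ∫ x, g e x * φ x ∂e.length)) :=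
    tendsto_finsetSum _ fun e he => Tendsto.const_mul _ <|
      tendsto_integral_mul (fun n => e.memLp (hψ.smooth n).continuous 2) (hg e he).1
        (e.memLp hφc 2) ((hg e he).tendsto_edge hΩ he hw hψ)
  refine tendsto_nhds_unique ((l1.add l2).congr fun n => ?_) l3
  exact K.green_smooth (hψ.smooth n) hφ i


/-! ### Geometry of the mesh -/

/-- Interior points would make the affine span the whole plane, whereas two points span at most a
line. -/
lemma interior_segment_eq_empty (b c : Plane) : interior (convexHull ℝ ({b, c} : Set Plane)) = ∅ := by
  by_contra h
  have h1 := interior_convexHull_nonempty_iff_affineSpan_eq_top.1 (nonempty_iff_ne_empty.2 h)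
  have h2 := (collinear_iff_finrank_le_one (k := ℝ)).1 (collinear_pair ℝ b c)
  rw [← direction_affineSpan, h1, AffineSubspace.direction_top, finrank_top] at h2
  simp at h2

/-- Some vertex of `K` is not a vertex of `K'`, so the common vertices are among the remaining two,
and the intersection of two cells lies in the hull of their common vertices. -/
lemma Triangulation.Elem.inter_subset_pair {T : Triangulation Ω} {K K' : T.Elem} (h : K ≠ K') :
    ∃ b c : Plane, K.cell ∩ K'.cell ⊆ convexHull ℝ {b, c} := by
  classical
  have hne : ¬ K.1 ⊆ K'.1 := fun hs => h (Subtype.ext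
    (Finset.eq_of_subset_of_card_le hs (by rw [K.2.2, K'.2.2])))
  obtain ⟨a, ha, ha'⟩ := Finset.not_subset.1 hne
  have hcard : (K.1.erase a).card = 2 := by rw [Finset.card_erase_of_mem ha, K.2.2]
  obtain ⟨b, c, -, hbc⟩ := Finset.card_eq_two.1 hcard
  refine ⟨b, c, (T.inter_subset_convexHull K.2.1 K'.2.1).trans (convexHull_mono ?_)⟩
  rintro x ⟨hx, hx'⟩
  have : x ∈ K.1.erase a := Finset.mem_erase.2 ⟨by rintro rfl; exact ha' hx', hx⟩
  simpa [hbc] using this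

lemma Triangulation.Elem.disjoint_interior {T : Triangulation Ω} {K K' : T.Elem} (h : K ≠ K') :
    Disjoint (interior K.cell) (interior K'.cell) := by
  obtain ⟨b, c, hbc⟩ := Elem.inter_subset_pair h
  rw [Set.disjoint_iff_inter_eq_empty, ← interior_inter, ← subset_empty_iff,
    ← interior_segment_eq_empty b c]
  exact interior_mono hbc

lemma Triangulation.closure_eq_iUnion (T : Triangulation Ω) : closure Ω = ⋃ K : T.Elem, K.cell := by
  refine Subset.antisymm ?_ (iUnion_subset fun K => K.cell_subset)
  intro x hx
  rw [← T.space_eq, Geometry.SimplicialComplex.mem_space_iff] at hx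
  obtain ⟨s, hs, hxs⟩ := hx
  obtain ⟨t, ht, hst, ht3⟩ := T.pure_two s hs
  exact mem_iUnion.2 ⟨⟨t, ht, ht3⟩, convexHull_mono (by exact_mod_cast hst) hxs⟩

lemma Triangulation.ae_eq_iUnion_interior (T : Triangulation Ω) (hΩ : IsPolygonalDomain Ω) :
    (⋃ K : T.Elem, interior K.cell : Set Plane) =ᵐ[volume] Ω := by
  refine ae_eq_set.2 ⟨?_, ?_⟩
  · rw [sdiff_eq_empty.2 (iUnion_subset fun K => K.interior_subset hΩ), measure_empty]
  · have hsub : Ω \ ⋃ K : T.Elem, interior K.cell ⊆ ⋃ K : T.Elem, frontier K.cell := by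
      rintro x ⟨hx, hx'⟩
      have := subset_closure hx
      rw [T.closure_eq_iUnion] at this
      obtain ⟨K, hK⟩ := mem_iUnion.1 this
      exact mem_iUnion.2 ⟨K, subset_closure hK, fun h => hx' (mem_iUnion.2 ⟨K, h⟩)⟩
    exact measure_mono_null hsub (measure_iUnion_null fun K => K.convex_cell.addHaar_frontier volume)

lemma Triangulation.setIntegral_eq_sum (T : Triangulation Ω) (hΩ : IsPolygonalDomain Ω)
    {g : Plane → ℝ} (hg : IntegrableOn g Ω) :
    ∫ x in Ω, g x = ∑ K : T.Elem, ∫ x, g x ∂K.area := by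
  rw [← setIntegral_congr_set (T.ae_eq_iUnion_interior hΩ),
    integral_iUnion_fintype (fun K => isOpen_interior.measurableSet)
      (fun K K' h => Elem.disjoint_interior h) fun K => hg.mono_set (K.interior_subset hΩ)]
  simp_rw [Elem.area_eq]

lemma Triangulation.Edge.exists_endpoints {T : Triangulation Ω} (e : T.Edge) :
    ∃ b c : Plane, b ≠ c ∧ e.1 = {b, c} := by
  classical
  obtain ⟨b, c, h, h'⟩ := Finset.card_eq_two.1 e.2.2
  exact ⟨b, c, h, h'⟩

lemma Triangulation.Elem.exists_isOuterNormal {T : Triangulation Ω} {K : T.Elem} {e : T.Edge}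
    (he : e ∈ K.edges) {b c : Plane} (hbc : e.1 = {b, c}) :
    ∃ a, K.1 = {a, b, c} ∧ IsOuterNormal (K.outward e) a b c := by
  obtain ⟨a, b', c', hK, he'⟩ := Elem.exists_vertices he
  have hK' : K.1 = {a, b, c} := by
    rw [hK, ← he', hbc]
  exact ⟨a, hK', Elem.isOuterNormal hK' hbc (Elem.cross_ne_zero hK')⟩

lemma Triangulation.Elem.norm_outward {T : Triangulation Ω} {K : T.Elem} {e : T.Edge}
    (he : e ∈ K.edges) : ‖K.outward e‖ = 1 := by
  obtain ⟨b, c, -, hbc⟩ := e.exists_endpoints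
  obtain ⟨a, -, h⟩ := Elem.exists_isOuterNormal he hbc
  exact h.norm_eq

/-- Near an interior point of an edge, an element contains the inner side of the edge. -/
lemma Triangulation.Elem.eventually_mem_cell {T : Triangulation Ω} {K : T.Elem} {e : T.Edge}
    (he : e ∈ K.edges) {b c x : Plane} (hbc : e.1 = {b, c}) (hx : x ∈ openSegment ℝ b c) :
    ∀ᶠ y in 𝓝 x, ⟪K.outward e, y - x⟫ ≤ 0 → y ∈ K.cell := by
  obtain ⟨a, hK, hN⟩ := Elem.exists_isOuterNormal he hbc
  have hD : cross b c a ≠ 0 := by rw [cross_rotate]; exact Elem.cross_ne_zero hK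
  -- Affine coordinates based at `b`, with `s` along the edge and `t` towards the opposite vertex.
  -- At `x` one has `t = 0` and `0 < s < 1`; the conditions `0 < s` and `s + t < 1` persist nearby,
  -- and `0 ≤ t` is the half-plane condition.
  let s : Plane → ℝ := fun y => ((y 0 - b 0) * (a 1 - b 1) - (y 1 - b 1) * (a 0 - b 0)) / cross b c a
  let t : Plane → ℝ := fun y => ((c 0 - b 0) * (y 1 - b 1) - (c 1 - b 1) * (y 0 - b 0)) / cross b c a
  have hy : ∀ y, y = b + s y • (c - b) + t y • (a - b) := by
    intro y
    refine plane_ext ?_ ?_ <;>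
    · simp [s, t]
      field_simp
      simp only [cross]
      ring
  have hs : Continuous s := by fun_prop
  have ht : Continuous t := by fun_prop
  rw [openSegment_eq_image'] at hx
  obtain ⟨θ, ⟨hθ0, hθ1⟩, rfl⟩ := hx
  have hsx : s (b + θ • (c - b)) = θ := by
    simp [s, cross] at hD ⊢; field_simp
  have htx : t (b + θ • (c - b)) = 0 := by
    simp [t]; left; ring
  have h1 : ∀ᶠ y in 𝓝 (b + θ • (c - b)), 0 < s y :=
    hs.continuousAt.eventually (lt_mem_nhds (by rw [hsx]; exact hθ0))
  have h2 : ∀ᶠ y in 𝓝 (b + θ • (c - b)), s y + t y < 1 :=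
    (hs.add ht).continuousAt.eventually (gt_mem_nhds (by
      rw [Pi.add_apply, hsx, htx]; linarith))
  filter_upwards [h1, h2] with y h1 h2 hle
  have hNa : ⟪K.outward e, a - b⟫ < 0 := by
    rw [← neg_sub, inner_neg_right]; have := hN.inner_pos; linarith
  have hty : 0 ≤ t y := by
    have e1 : y - (b + θ • (c - b)) = (s y - θ) • (c - b) + t y • (a - b) := by
      nth_rewrite 1 [hy y]; module
    rw [e1, inner_add_right, inner_smul_right, inner_smul_right, hN.inner_edge, mul_zero,
      zero_add] at hle
    by_contra hneg
    push Not at hneg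
    exact absurd (mul_pos_of_neg_of_neg hneg hNa) (not_lt.2 hle)
  rw [Elem.cell_eq (a := b) (b := c) (c := a) (by rw [hK]; ext; simp; tauto),
    mem_convexHull_triple]
  exact ⟨t y, s y, hty, h1.le, by linarith, hy y⟩

lemma exists_mem_openSegment (b c : Plane) : ∃ x, x ∈ openSegment ℝ b c :=
  ⟨(1 / 2 : ℝ) • b + (1 / 2 : ℝ) • c, 1 / 2, 1 / 2, by norm_num, by norm_num, by norm_num, rfl⟩

lemma inner_sub_eq_zero_of_mem_segment {N b c x y : Plane} (h : ⟪N, c - b⟫ = 0)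
    (hx : x ∈ segment ℝ b c) (hy : y ∈ segment ℝ b c) : ⟪N, y - x⟫ = 0 := by
  rw [segment_eq_image'] at hx hy
  obtain ⟨s, -, rfl⟩ := hx
  obtain ⟨t, -, rfl⟩ := hy
  simp only
  rw [show b + t • (c - b) - (b + s • (c - b)) = (t - s) • (c - b) by module, inner_smul_right, h,
    mul_zero]

/-- An edge has at most one element on each of its sides. -/
lemma Triangulation.Elem.eq_of_outward_eq {T : Triangulation Ω} {K K' : T.Elem} {e : T.Edge}
    (he : e ∈ K.edges) (he' : e ∈ K'.edges) (h : K.outward e = K'.outward e) : K = K' := by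
  classical
  by_contra hne
  obtain ⟨b, c, hbc, hbc'⟩ := e.exists_endpoints
  obtain ⟨a, hK, hN⟩ := Elem.exists_isOuterNormal he hbc'
  obtain ⟨x, hx⟩ := exists_mem_openSegment b c
  have h1 := Elem.eventually_mem_cell he hbc' hx
  have h2 := Elem.eventually_mem_cell he' hbc' hx
  have hlim : Tendsto (fun τ : ℝ => x - τ • K.outward e) (𝓝[>] 0) (𝓝 x) := by
    have : ContinuousAt (fun τ : ℝ => x - τ • K.outward e) 0 := by fun_prop
    have h3 := this.tendsto
    simp only [zero_smul, sub_zero] at h3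
    exact h3.mono_left nhdsWithin_le_nhds
  -- With equal outward normals, a short step inwards from the edge lands in both cells. If the
  -- elements differed, that point would lie in the hull of the common vertices, which is `e`,
  -- although it is off the line of `e`.
  obtain ⟨τ, ⟨h3, h4⟩, hτ⟩ := (((hlim.eventually h1).and (hlim.eventually h2)).and
    self_mem_nhdsWithin).exists
  have hτ0 : (0 : ℝ) < τ := hτ
  have hin : ⟪K.outward e, x - τ • K.outward e - x⟫ = -τ := by
    rw [show x - τ • K.outward e - x = (-τ) • K.outward e by module, inner_smul_right,
      real_inner_self_eq_norm_sq, hN.norm_eq]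
    ring
  have hm := T.inter_subset_convexHull K.2.1 K'.2.1
    ⟨h3 (by rw [hin]; linarith), h4 (by rw [← h, hin]; linarith)⟩
  have hsub : K.1 ∩ K'.1 = e.1 := by
    have hsub1 : e.1 ⊆ K.1 ∩ K'.1 :=
      Finset.subset_inter (Elem.mem_edges.1 he) (Elem.mem_edges.1 he')
    refine (Finset.eq_of_subset_of_card_le hsub1 ?_).symm
    rw [e.2.2]
    by_contra hlt
    push Not at hlt
    have e1 : K.1 ∩ K'.1 = K.1 := Finset.eq_of_subset_of_card_le Finset.inter_subset_left
      (by rw [K.2.2]; omega)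
    have e2 : K.1 ∩ K'.1 = K'.1 := Finset.eq_of_subset_of_card_le Finset.inter_subset_right
      (by rw [K'.2.2]; omega)
    exact hne (Subtype.ext (e1.symm.trans e2))
  rw [← Finset.coe_inter, hsub, hbc', Finset.coe_pair, convexHull_pair] at hm
  have := inner_sub_eq_zero_of_mem_segment hN.inner_edge (openSegment_subset_segment ℝ b c hx) hm
  rw [hin] at this
  linarith

/-- In the plane, two vectors orthogonal to the same nonzero vector are parallel; `σ` is the factor
between them. -/
lemma eq_or_eq_neg_of_inner_eq_zero {N N' w : Plane} (hw : w ≠ 0) (hN : ‖N‖ = 1) (hN' : ‖N'‖ = 1)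
    (h : ⟪N, w⟫ = 0) (h' : ⟪N', w⟫ = 0) : N' = N ∨ N' = -N := by
  have n1 : N 0 ^ 2 + N 1 ^ 2 = 1 := by rw [← norm_sq_plane, hN]; norm_num
  have n2 : N' 0 ^ 2 + N' 1 ^ 2 = 1 := by rw [← norm_sq_plane, hN']; norm_num
  rw [inner_plane] at h h'
  have hdet : N 0 * N' 1 - N 1 * N' 0 = 0 := by
    by_contra hd
    apply hw
    refine plane_ext ?_ ?_
    · refine (mul_eq_zero.1 (?_ : (N 0 * N' 1 - N 1 * N' 0) * w 0 = 0)).resolve_left hd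
      linear_combination N' 1 * h - N 1 * h'
    · refine (mul_eq_zero.1 (?_ : (N 0 * N' 1 - N 1 * N' 0) * w 1 = 0)).resolve_left hd
      linear_combination N 0 * h' - N' 0 * h
  set σ := N 0 * N' 0 + N 1 * N' 1 with hσ
  have e0 : N' 0 = σ * N 0 := by rw [hσ]; linear_combination (-N' 0) * n1 - N 1 * hdet
  have e1 : N' 1 = σ * N 1 := by rw [hσ]; linear_combination (-N' 1) * n1 + N 0 * hdet
  have hσ2 : σ ^ 2 = 1 := by
    rw [e0, e1] at n2
    linear_combination n2 - σ ^ 2 * n1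
  rcases (show σ = 1 ∨ σ = -1 by simpa using hσ2) with h1 | h1
  · exact Or.inl (plane_ext (by rw [e0, h1, one_mul]) (by rw [e1, h1, one_mul]))
  · exact Or.inr (plane_ext (by rw [e0, h1]; simp) (by rw [e1, h1]; simp))

lemma Triangulation.Elem.outward_eq_or {T : Triangulation Ω} {K K' : T.Elem} {e : T.Edge}
    (he : e ∈ K.edges) (he' : e ∈ K'.edges) : K' = K ∨ K'.outward e = -K.outward e := by
  obtain ⟨b, c, hbc, hbc'⟩ := e.exists_endpoints
  obtain ⟨a, -, hN⟩ := Elem.exists_isOuterNormal he hbc'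
  obtain ⟨a', -, hN'⟩ := Elem.exists_isOuterNormal he' hbc'
  rcases eq_or_eq_neg_of_inner_eq_zero (sub_ne_zero.2 hbc.symm) hN.norm_eq hN'.norm_eq
    hN.inner_edge hN'.inner_edge with h | h
  · exact Or.inl (Elem.eq_of_outward_eq he' he h)
  · exact Or.inr h

/-- The interior of an edge shared by two elements lies in the domain. -/
lemma Triangulation.Edge.openSegment_subset {T : Triangulation Ω} (hΩ : IsPolygonalDomain Ω)
    {K K' : T.Elem} {e : T.Edge} (he : e ∈ K.edges) (he' : e ∈ K'.edges) (hne : K' ≠ K)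
    {b c : Plane} (hbc : e.1 = {b, c}) : openSegment ℝ b c ⊆ Ω := by
  intro x hx
  have hopp := (Elem.outward_eq_or he he').resolve_left hne
  -- The two cells cover both sides of the edge near `x`, so `x` is interior to the closure of `Ω`.
  have hmem : ∀ᶠ y in 𝓝 x, y ∈ closure Ω := by
    filter_upwards [Elem.eventually_mem_cell he hbc hx, Elem.eventually_mem_cell he' hbc hx]
      with y h1 h2
    rcases le_total ⟪K.outward e, y - x⟫ 0 with h | h
    · exact K.cell_subset (h1 h)
    · exact K'.cell_subset (h2 (by rw [hopp, inner_neg_left]; linarith))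
  exact hΩ.interior_closure.subset (mem_interior_iff_mem_nhds.2 hmem)

/-! ### Localization at a single edge and matching of one-sided traces. -/

/-- The part of the domain that meets no edge but possibly `e`. -/
def Triangulation.Edge.patch {T : Triangulation Ω} (e : T.Edge) : Set Plane :=
  Ω \ ⋃ e' : {e' : T.Edge // e' ≠ e}, e'.1.cell

lemma Triangulation.Edge.isOpen_patch {T : Triangulation Ω} (hΩ : IsOpen Ω) (e : T.Edge) :
    IsOpen e.patch := by
  classical
  exact hΩ.sdiff (isClosed_iUnion_of_finite fun e' => e'.1.isCompact_cell.isClosed)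

lemma Triangulation.Edge.patch_subset {T : Triangulation Ω} (e : T.Edge) : e.patch ⊆ Ω :=
  sdiff_subset

/-- A different edge can meet `e` only in a common vertex, and `x` is not an endpoint. -/
lemma Triangulation.Edge.mem_patch {T : Triangulation Ω} {e : T.Edge} {b c x : Plane}
    (hbc : b ≠ c) (he : e.1 = {b, c}) (hx : x ∈ openSegment ℝ b c) (hxΩ : x ∈ Ω) :
    x ∈ e.patch := by
  classical
  refine ⟨hxΩ, fun hmem => ?_⟩
  obtain ⟨⟨e', hne⟩, hxe'⟩ := mem_iUnion.1 hmem
  have hxe : x ∈ e.cell := by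
    rw [Edge.cell_eq he]; exact openSegment_subset_segment ℝ b c hx
  have hm := T.inter_subset_convexHull e.2.1 e'.2.1 ⟨hxe, hxe'⟩
  rw [← Finset.coe_inter] at hm
  have hxb : x ≠ b := by rintro rfl; exact hbc (left_mem_openSegment_iff.1 hx)
  have hxc : x ≠ c := by rintro rfl; exact hbc (right_mem_openSegment_iff.1 hx)
  have hlt : (e.1 ∩ e'.1).card ≤ 1 := by
    by_contra hlt
    push Not at hlt
    have e1 : e.1 ∩ e'.1 = e.1 := Finset.eq_of_subset_of_card_le Finset.inter_subset_left
      (by rw [e.2.2]; omega)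
    have e2 : e.1 ∩ e'.1 = e'.1 := Finset.eq_of_subset_of_card_le Finset.inter_subset_right
      (by rw [e'.2.2]; omega)
    exact hne (Subtype.ext (e2.symm.trans e1))
  rcases Finset.card_le_one_iff_subset_singleton.1 hlt with ⟨p, hp⟩
  have hxp : x ∈ convexHull ℝ ({p} : Set Plane) := convexHull_mono (by exact_mod_cast hp) hm
  rw [convexHull_singleton, mem_singleton_iff] at hxp
  subst hxp
  have hne' : (e.1 ∩ e'.1).Nonempty := by
    rw [← Finset.coe_nonempty]
    exact (convexHull_nonempty_iff (𝕜 := ℝ)).1 ⟨_, hm⟩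
  obtain ⟨q, hq⟩ := hne'
  have hqx : q = x := by simpa using hp hq
  subst hqx
  have := (Finset.mem_inter.1 hq).1
  rw [he] at this
  simp [hxb, hxc] at this

open Classical in
/-- The elements that contain the edge `e`. -/
def Triangulation.Edge.elems {T : Triangulation Ω} (e : T.Edge) : Finset T.Elem :=
  Finset.univ.filter fun K => e ∈ K.edges

lemma Triangulation.Edge.mem_elems {T : Triangulation Ω} {e : T.Edge} {K : T.Elem} :
    K ∈ e.elems ↔ e ∈ K.edges := by
  simp [Edge.elems]

lemma Triangulation.sum_comm (T : Triangulation Ω) (F : T.Elem → T.Edge → ℝ) :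
    ∑ K : T.Elem, ∑ e ∈ K.edges, F K e = ∑ e : T.Edge, ∑ K ∈ e.elems, F K e := by
  classical
  exact Finset.sum_comm' fun K e => by simp [Edge.mem_elems]

/-- Sums of edge integrals against functions supported in the patch of an edge. -/
lemma Triangulation.Edge.sum_patch {T : Triangulation Ω} {e : T.Edge} {φ : Plane → ℝ}
    (hφ : IsTestFun e.patch φ) (a : T.Elem → T.Edge → ℝ) (G : T.Elem → T.Edge → Plane → ℝ) :
    ∑ K : T.Elem, ∑ e' ∈ K.edges, a K e' * ∫ x, G K e' x * φ x ∂e'.length =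
      ∑ K ∈ e.elems, a K e * ∫ x, G K e x * φ x ∂e.length := by
  rw [T.sum_comm, Fintype.sum_eq_single e]
  intro e' he'
  refine Finset.sum_eq_zero fun K _ => ?_
  have h0 : ∫ x, G K e' x * φ x ∂e'.length = 0 := by
    rw [← integral_zero Plane ℝ (μ := e'.length)]
    refine integral_congr_ae (e'.ae_mem.mono fun x hx => ?_)
    simp only
    rw [hφ.eq_zero fun hx' => hx'.2 (mem_iUnion.2 ⟨⟨e', he'⟩, hx⟩), mul_zero]
  rw [h0, mul_zero]

/-- Integration by parts over the whole plane; the compact support of the test function removes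
boundary terms. -/
lemma hasWeakPd_of_contDiff {ψ : Plane → ℝ} (hψ : ContDiff ℝ ∞ ψ) (i : Fin 2) :
    HasWeakPd Ω i ψ (pd i ψ) := by
  intro φ hφ
  rw [setIntegral_eq_integral_of_forall_compl_eq_zero
      fun x hx => by rw [(hφ.pd i).eq_zero hx, mul_zero],
    setIntegral_eq_integral_of_forall_compl_eq_zero fun x hx => by rw [hφ.eq_zero hx, mul_zero]]
  have hψ' : Continuous (pd i ψ) := continuous_pd (hψ.of_le (by simp)) i
  refine integral_mul_fderiv_eq_neg_fderiv_mul_of_integrable ?_ ?_ ?_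
    (fun x _ => hψ.differentiable (by simp) x) (fun x _ => hφ.smooth.differentiable (by simp) x)
  · exact (hψ'.mul hφ.smooth.continuous).integrable_of_hasCompactSupport hφ.compact.mul_left
  · exact (hψ.continuous.mul (hφ.pd i).smooth.continuous).integrable_of_hasCompactSupport
      (hφ.pd i).compact.mul_left
  · exact (hψ.continuous.mul hφ.smooth.continuous).integrable_of_hasCompactSupport
      hφ.compact.mul_left

lemma IsTestFun.integral_pd {φ : Plane → ℝ} (hφ : IsTestFun Ω φ) (i : Fin 2) :
    ∫ x in Ω, C0WG.pd i φ x = 0 := by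
  have := hasWeakPd_of_contDiff (Ω := Ω) (contDiff_const (c := (1 : ℝ))) i φ hφ
  simpa [C0WG.pd] using this

/-- The outward normals on an interior edge add up to zero. -/
lemma Triangulation.Edge.sum_outward {T : Triangulation Ω} (hΩ : IsPolygonalDomain Ω) {e : T.Edge}
    (he : e.elems.Nonempty) (hfr : ¬ e.cell ⊆ frontier Ω) : ∑ K ∈ e.elems, K.outward e = 0 := by
  obtain ⟨b, c, hbc, hbc'⟩ := e.exists_endpoints
  obtain ⟨K₀, hK₀⟩ := he
  have hsub : e.cell ⊆ closure Ω :=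
    (convexHull_mono (by exact_mod_cast Elem.mem_edges.1 (Edge.mem_elems.1 hK₀))).trans
      K₀.cell_subset
  obtain ⟨y, hy, hy'⟩ := not_subset.1 hfr
  have hyΩ : y ∈ Ω := by
    by_contra h
    exact hy' ⟨hsub hy, by rwa [hΩ.isOpen.interior_eq]⟩
  rw [Edge.cell_eq hbc', ← closure_openSegment] at hy
  obtain ⟨x, hxΩ, hx⟩ := mem_closure_iff.1 hy Ω hΩ.isOpen hyΩ
  have hxp := Edge.mem_patch hbc hbc' hx hxΩ
  -- Take a bump `φ` that meets no edge but `e`. Since `∫_Ω ∂ᵢφ = 0`, the divergence theorem on the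
  -- elements leaves only `(∑ nᵢ) ∫_e φ = 0`, with a positive integral.
  obtain ⟨φ, hφs, hφc, hφd, hφr, hφx⟩ := exists_contDiff_tsupport_subset (n := ⊤)
    ((e.isOpen_patch hΩ.isOpen).mem_nhds hxp)
  have hφ : IsTestFun e.patch φ := ⟨hφd, hφc, hφs⟩
  have hφΩ := hφ.mono e.patch_subset
  have hpos : 0 < ∫ x, φ x ∂e.length := by
    rw [Edge.integral_length hbc' hbc]
    refine mul_pos (dist_pos.2 hbc) ?_
    rw [openSegment_eq_image'] at hx
    obtain ⟨θ, hθ, rfl⟩ := hx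
    refine intervalIntegral.integral_pos zero_lt_one
      (hφd.continuous.comp (by fun_prop)).continuousOn
      (fun t _ => (hφr (mem_range_self _)).1) ⟨θ, Ioo_subset_Icc_self hθ, ?_⟩
    rw [hφx]; exact one_pos
  have hz : ∀ i, (∑ K ∈ e.elems, K.outward e) i = 0 := by
    intro i
    have h1 := hφΩ.integral_pd i
    rw [T.setIntegral_eq_sum hΩ ((hφΩ.pd i).smooth.continuous.integrable_of_hasCompactSupport
      (hφΩ.pd i).compact).integrableOn] at h1
    have h2 := fun K : T.Elem => K.integral_fderiv (hφd.of_le (by simp))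
      (EuclideanSpace.single i 1)
    simp_rw [pd, h2] at h1
    have h3 := Edge.sum_patch hφ (fun K e => ⟪K.outward e, EuclideanSpace.single i (1 : ℝ)⟫)
      (fun _ _ _ => 1)
    simp only [one_mul] at h3
    rw [h3, ← Finset.sum_mul, mul_eq_zero] at h1
    have h4 := h1.resolve_right hpos.ne'
    rw [← sum_inner, EuclideanSpace.inner_single_right] at h4
    simpa using h4
  exact plane_ext (hz 0) (hz 1)

lemma Triangulation.Edge.ae_mem_openSegment {T : Triangulation Ω} {e : T.Edge} {b c : Plane}
    (he : e.1 = {b, c}) : ∀ᵐ x ∂e.length, x ∈ openSegment ℝ b c := by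
  have hna : NullSingletonClass (Measure.hausdorffMeasure 1 : Measure Plane) :=
    Measure.nullSingletonClass_hausdorff _ one_pos
  have h0 : ∀ p : Plane, ∀ᵐ x ∂e.length, x ≠ p := fun p =>
    ae_restrict_of_ae (by simp [ae_iff])
  filter_upwards [e.ae_mem, h0 b, h0 c] with x hx hb hc
  rw [Edge.cell_eq he] at hx
  exact mem_openSegment_of_ne_left_right hb.symm hc.symm hx

/-- The traces of an `H¹` function from the two sides of an edge agree. -/
lemma ae_eq_of_isTraceFrom {T : Triangulation Ω} (hΩ : IsPolygonalDomain Ω) {w : Plane → ℝ}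
    (hw : MemH Ω 1 w) {G : T.Elem → T.Edge → Plane → ℝ}
    (hG : ∀ K, ∀ e ∈ K.edges, IsTraceFrom K e w (G K e)) {K K' : T.Elem} {e : T.Edge}
    (he : e ∈ K.edges) (he' : e ∈ K'.edges) : G K e =ᵐ[e.length] G K' e := by
  classical
  rcases eq_or_ne K' K with rfl | hne
  · rfl
  obtain ⟨b, c, hbc, hbc'⟩ := e.exists_endpoints
  have hopp := (Triangulation.Elem.outward_eq_or he he').resolve_left hne
  have hN1 := Triangulation.Elem.norm_outward he
  have helems : e.elems = {K, K'} := by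
    ext L
    rw [Triangulation.Edge.mem_elems, Finset.mem_insert, Finset.mem_singleton]
    constructor
    · intro hL
      rcases Triangulation.Elem.outward_eq_or he hL with h | h
      · exact Or.inl h
      · exact Or.inr (Triangulation.Elem.eq_of_outward_eq hL he' (h.trans hopp.symm))
    · rintro (rfl | rfl) <;> assumption
  have hGm := (hG K e he).1
  have hGm' := (hG K' e he').1
  -- The weak derivative on `Ω` has no contribution from `e`, while Green's formula on the two sides
  -- produces the jump times the normal; hence the jump is orthogonal to all test functions of the
  -- patch.
  have htest : ∀ φ, IsTestFun e.patch φ → ∫ x, φ x • (G K e x - G K' e x) ∂e.length = 0 := by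
    intro φ hφ
    have hφΩ := hφ.mono e.patch_subset
    have hφe : MemLp φ 2 e.length := e.memLp hφ.smooth.continuous 2
    have hz : ∀ i, K.outward e i * ∫ x, φ x • (G K e x - G K' e x) ∂e.length = 0 := by
      intro i
      have h1 := (hw.weakPd_spec i).2 φ hφΩ
      rw [T.setIntegral_eq_sum hΩ (hφΩ.integrable_mul_pd hw.memL2 i),
        T.setIntegral_eq_sum hΩ (hφΩ.integrable_mul (hw.weakPd_spec i).1), ← sub_eq_zero,
        sub_neg_eq_add, ← Finset.sum_add_distrib] at h1
      simp_rw [fun L => Triangulation.Elem.green_trace hΩ hw L (hG L) hφ.smooth i] at h1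
      rw [Triangulation.Edge.sum_patch hφ (fun L e => L.outward e i) G, helems, Finset.sum_pair hne.symm,
        hopp] at h1
      have i1 : Integrable (fun x => G K e x * φ x) e.length := MemLp.integrable_mul hGm hφe
      have i2 : Integrable (fun x => G K' e x * φ x) e.length := MemLp.integrable_mul hGm' hφe
      have h2 : ∫ x, φ x • (G K e x - G K' e x) ∂e.length =
          (∫ x, G K e x * φ x ∂e.length) - ∫ x, G K' e x * φ x ∂e.length := by
        rw [← integral_sub i1 i2]
        congr 1; ext x; simp; ring
      rw [h2]
      simp only [PiLp.neg_apply] at h1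
      linear_combination h1
    -- A unit normal has a nonzero component, and that one yields the conclusion.
    by_contra hne0
    have h0 := fun i => (mul_eq_zero.1 (hz i)).resolve_right hne0
    rw [plane_ext (y := 0) (h0 0) (h0 1), norm_zero] at hN1
    exact zero_ne_one hN1
  have hae := (e.isOpen_patch hΩ.isOpen).ae_eq_zero_of_integral_contDiff_smul_eq_zero
    (f := fun x => G K e x - G K' e x) (μ := e.length)
    (((hGm.integrable (by norm_num)).sub
      (hGm'.integrable (by norm_num))).locallyIntegrable.locallyIntegrableOn _)
    fun φ h1 h2 h3 => htest φ ⟨h1, h2, h3⟩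
  filter_upwards [hae, Triangulation.Edge.ae_mem_openSegment hbc'] with x hx hxs
  exact sub_eq_zero.1 (hx (Triangulation.Edge.mem_patch hbc hbc' hxs
    (Triangulation.Edge.openSegment_subset hΩ he he' hne hbc' hxs)))

/-- The trace of an `H¹` function exists on all edges. -/
theorem isTraceFrom_trace {T : Triangulation Ω} (hΩ : IsPolygonalDomain Ω) {w : Plane → ℝ}
    (hw : MemH Ω 1 w) {K : T.Elem} {e : T.Edge} (he : e ∈ K.edges) :
    IsTraceFrom K e w (trace e w) := by
  have hex : ∀ (K : T.Elem) (e : T.Edge), ∃ g, e ∈ K.edges → IsTraceFrom K e w g := by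
    intro K e
    by_cases h : e ∈ K.edges
    · obtain ⟨g, hg⟩ := exists_isTraceFrom hΩ hw h
      exact ⟨g, fun _ => hg⟩
    · exact ⟨0, fun h' => absurd h' h⟩
  choose G hG using hex
  -- The trace from one element serves for all elements containing `e`, since the one-sided traces
  -- agree almost everywhere.
  refine Classical.epsilon_spec
    (p := fun g : Plane → ℝ => ∀ K : T.Elem, e ∈ K.edges → IsTraceFrom K e w g)
    ⟨G K e, fun K' he' => ?_⟩ K he
  exact (hG K' e he').congr (ae_eq_of_isTraceFrom hΩ hw hG he' he)


/-! ### Polynomial functions -/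

/-- The function on the plane given by a polynomial in two variables. -/
def polyFun (P : MvPolynomial (Fin 2) ℝ) (x : Plane) : ℝ :=
  MvPolynomial.aeval (fun i : Fin 2 => x i) P

lemma mem_Poly {m : ℕ} {p : Plane → ℝ} :
    p ∈ Poly m ↔ ∃ P : MvPolynomial (Fin 2) ℝ, P.totalDegree ≤ m ∧ polyFun P = p := by
  rw [Poly, Submodule.mem_map]
  refine exists_congr fun P => ?_
  rw [MvPolynomial.mem_restrictTotalDegree]
  rfl

lemma contDiff_polyFun (P : MvPolynomial (Fin 2) ℝ) : ContDiff ℝ ∞ (polyFun P) := by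
  unfold polyFun
  induction P using MvPolynomial.induction_on with
  | C a => simpa using contDiff_const
  | add p q hp hq => simpa using hp.add hq
  | mul_X p i hp =>
    simp only [map_mul, MvPolynomial.aeval_X]
    exact hp.mul (by fun_prop)

lemma analyticOnNhd_polyFun (P : MvPolynomial (Fin 2) ℝ) : AnalyticOnNhd ℝ (polyFun P) univ :=
  AnalyticOnNhd.aeval_mvPolynomial
    (fun i => (EuclideanSpace.proj i : Plane →L[ℝ] ℝ).analyticOnNhd univ) P

lemma pd_polyFun (P : MvPolynomial (Fin 2) ℝ) (i : Fin 2) :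
    pd i (polyFun P) = polyFun (MvPolynomial.pderiv i P) := by
  induction P using MvPolynomial.induction_on with
  | C a =>
    ext x
    have : polyFun (MvPolynomial.C a) = fun _ => a := by ext; simp [polyFun]
    simp [pd, this]
    simp [polyFun]
  | add p q hp hq =>
    ext x
    have h : polyFun (p + q) = fun x => polyFun p x + polyFun q x := by ext; simp [polyFun]
    have h' := congrFun hp x
    have h'' := congrFun hq x
    simp only [pd] at h' h'' ⊢
    rw [h, fderiv_fun_add ((contDiff_polyFun p).differentiable (by simp) x)
      ((contDiff_polyFun q).differentiable (by simp) x), add_apply, h', h'']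
    simp [polyFun]
  | mul_X p j hp =>
    ext x
    have h : polyFun (p * MvPolynomial.X j) = fun x => polyFun p x * x j := by
      ext; simp [polyFun]
    have h' := congrFun hp x
    have hj : HasFDerivAt (fun x : Plane => x j) (EuclideanSpace.proj j : Plane →L[ℝ] ℝ) x :=
      (EuclideanSpace.proj j : Plane →L[ℝ] ℝ).hasFDerivAt
    have := ((contDiff_polyFun p).differentiable (by simp) x).hasFDerivAt.mul hj
    simp only [pd] at h' ⊢
    rw [h, HasFDerivAt.fderiv (f := fun x => polyFun p x * x j) this]
    rcases eq_or_ne j i with rfl | hij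
    · simp [h', polyFun]
    · simp [h', polyFun, MvPolynomial.pderiv_X_of_ne hij, hij]

/-- This bound without loss of a degree suffices: derivatives of `v₀` only need to lie in `ℙ_{k+3}`,
and `v₀` has degree at most `k + 2`. -/
lemma totalDegree_pderiv_le (P : MvPolynomial (Fin 2) ℝ) (i : Fin 2) :
    (MvPolynomial.pderiv i P).totalDegree ≤ P.totalDegree := by
  nth_rewrite 1 [P.as_sum]
  rw [map_sum]
  refine MvPolynomial.totalDegree_finsetSum_le fun s hs => ?_
  rw [MvPolynomial.pderiv_monomial]
  refine (MvPolynomial.totalDegree_monomial_le _ _).trans ?_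
  refine le_trans ?_ (MvPolynomial.le_totalDegree hs)
  exact Finsupp.sum_le_sum_index tsub_le_self (fun _ _ => monotone_id) (fun _ _ => rfl)

lemma contDiff_of_mem_Poly {m : ℕ} {p : Plane → ℝ} (hp : p ∈ Poly m) : ContDiff ℝ ∞ p := by
  obtain ⟨P, -, rfl⟩ := mem_Poly.1 hp
  exact contDiff_polyFun P

lemma pd_mem_Poly {m : ℕ} {p : Plane → ℝ} (hp : p ∈ Poly m) (i : Fin 2) : pd i p ∈ Poly m := by
  obtain ⟨P, hP, rfl⟩ := mem_Poly.1 hp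
  exact mem_Poly.2 ⟨_, (totalDegree_pderiv_le P i).trans hP, (pd_polyFun P i).symm⟩

lemma Poly_mono {m n : ℕ} (h : m ≤ n) : Poly m ≤ Poly n := by
  intro p hp
  obtain ⟨P, hP, rfl⟩ := mem_Poly.1 hp
  exact mem_Poly.2 ⟨P, hP.trans h, rfl⟩

instance (m : ℕ) : FiniteDimensional ℝ (Poly m) := by
  unfold Poly
  infer_instance

/-- By continuity `p` vanishes on the interior of `K`; analyticity extends this to the whole plane,
as needed because `Poly m` consists of functions on the plane. -/
lemma eq_zero_of_integral_sq_eq_zero {T : Triangulation Ω} (K : T.Elem) {m : ℕ} {p : Plane → ℝ}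
    (hp : p ∈ Poly m) (h : ∫ x, p x * p x ∂K.area = 0) : p = 0 := by
  have hc := (contDiff_of_mem_Poly hp).continuous
  have h1 := (integral_eq_zero_iff_of_nonneg (fun x => mul_self_nonneg (p x))
    (K.integrable (hc.mul hc))).1 h
  have h2 : p =ᵐ[volume.restrict (interior K.cell)] 0 := by
    rw [← K.area_eq]
    exact h1.mono fun x hx => mul_self_eq_zero.1 hx
  have h3 := Measure.eqOn_open_of_ae_eq h2 isOpen_interior hc.continuousOn continuousOn_const
  obtain ⟨x, hx⟩ := K.interior_nonempty
  obtain ⟨P, -, rfl⟩ := mem_Poly.1 hp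
  exact (analyticOnNhd_polyFun P).eq_of_eventuallyEq (g := 0) (fun _ _ => analyticAt_const)
    (h3.eventuallyEq_of_mem (isOpen_interior.mem_nhds hx))

/-! ### Existence of the `L²` projection and of the weak Laplacian. -/

/-- The defining property of `l2Rep` on the polynomials over an element. -/
lemma integral_l2Rep {T : Triangulation Ω} (K : T.Elem) (m : ℕ) {ℓ : (Plane → ℝ) → ℝ}
    (hadd : ∀ p ∈ Poly m, ∀ q ∈ Poly m, ℓ (p + q) = ℓ p + ℓ q)
    (hsmul : ∀ (a : ℝ), ∀ p ∈ Poly m, ℓ (a • p) = a * ℓ p) :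
    ∀ q ∈ Poly m, ∫ x, (l2Rep K.area (Poly m) ℓ : Plane → ℝ) x * q x ∂K.area = ℓ q := by
  have hint : ∀ p q : Poly m, Integrable (fun x => (p : Plane → ℝ) x * (q : Plane → ℝ) x) K.area :=
    fun p q => K.integrable
      ((contDiff_of_mem_Poly p.2).continuous.mul (contDiff_of_mem_Poly q.2).continuous)
  let B : Poly m →ₗ[ℝ] Module.Dual ℝ (Poly m) := LinearMap.mk₂ ℝ
    (fun p q => ∫ x, (p : Plane → ℝ) x * (q : Plane → ℝ) x ∂K.area)
    (fun p p' q => by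
      rw [← integral_add (hint p q) (hint p' q)]
      congr 1; ext x; simp [add_mul])
    (fun a p q => by
      rw [smul_eq_mul, ← integral_const_mul]
      congr 1; ext x; simp [mul_assoc])
    (fun p q q' => by
      rw [← integral_add (hint p q) (hint p q')]
      congr 1; ext x; simp [mul_add])
    (fun a p q => by
      rw [smul_eq_mul, ← integral_const_mul]
      congr 1; ext x; simp; ring)
  -- The `L²(K)` form is definite on `Poly m`, so it identifies this finite-dimensional space with
  -- its dual.
  have hinj : Function.Injective B := by
    rw [← LinearMap.ker_eq_bot, LinearMap.ker_eq_bot']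
    intro p hp
    have : B p p = 0 := by rw [hp]; rfl
    exact Subtype.ext (eq_zero_of_integral_sq_eq_zero K p.2 this)
  have hsurj : Function.Surjective B :=
    (LinearMap.injective_iff_surjective_of_finrank_eq_finrank
      (Subspace.dual_finrank_eq (K := ℝ) (V := Poly m)).symm).1 hinj
  let L : Module.Dual ℝ (Poly m) :=
    { toFun := fun q => ℓ q
      map_add' := fun p q => hadd p p.2 q q.2
      map_smul' := fun a p => hsmul a p p.2 }
  obtain ⟨p, hp⟩ := hsurj L
  exact Classical.epsilon_spec
    (p := fun p : Poly m => ∀ q ∈ Poly m, ∫ x, (p : Plane → ℝ) x * q x ∂K.area = ℓ q)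
    ⟨p, fun q hq => LinearMap.congr_fun hp ⟨q, hq⟩⟩

lemma integral_piH {T : Triangulation Ω} {w : Plane → ℝ} (K : T.Elem) (hw : MemLp w 2 K.area)
    (k : ℕ) {q : Plane → ℝ} (hq : q ∈ Poly (k + 3)) :
    ∫ x, piH T k w K x * q x ∂K.area = ∫ x, w x * q x ∂K.area := by
  have hint : ∀ p ∈ Poly (k + 3), Integrable (fun x => w x * p x) K.area := fun p hp =>
    MemLp.integrable_mul hw (K.memLp (contDiff_of_mem_Poly hp).continuous 2)
  refine integral_l2Rep K (k + 3) (fun p hp q hq => ?_) (fun a p hp => ?_) q hq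
  · rw [← integral_add (hint p hp) (hint q hq)]
    congr 1; ext x; simp [mul_add]
  · rw [← integral_const_mul]
    congr 1; ext x; simp; ring

lemma piH_mem_Poly {T : Triangulation Ω} (w : Plane → ℝ) (K : T.Elem) (k : ℕ) :
    piH T k w K ∈ Poly (k + 3) := Subtype.property _

lemma dw_mem_Poly {T : Triangulation Ω} (nE : T.Edge → Plane) {k : ℕ} (v : Vh T k) (K : T.Elem) :
    dw T nE v K ∈ Poly (k + 3) := Subtype.property _

lemma Vh.inner_mem_Poly {T : Triangulation Ω} {k : ℕ} (v : Vh T k) (K : T.Elem) :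
    v.inner K ∈ Poly (k + 2) := Subtype.property _

lemma inner_gradient_left (φ : Plane → ℝ) (x y : Plane) : ⟪gradient φ x, y⟫ = fderiv ℝ φ x y := by
  rw [gradient, InnerProductSpace.toDual_symm_apply]

lemma gradient_apply (φ : Plane → ℝ) (x : Plane) (i : Fin 2) : gradient φ x i = pd i φ x := by
  have := inner_gradient_left φ x (EuclideanSpace.single i 1)
  rw [EuclideanSpace.inner_single_right] at this
  simpa [pd] using this

lemma inner_eq_sum (x y : Plane) : ⟪x, y⟫ = ∑ i, x i * y i := by
  rw [inner_plane, Fin.sum_univ_two]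

/-- The normal component on an edge agrees with a polynomial. -/
lemma Vh.exists_normal_eq {T : Triangulation Ω} {k : ℕ} (v : Vh T k) (e : T.Edge) :
    ∃ r : Plane → ℝ, Continuous r ∧ v.normal e =ᵐ[e.length] r := by
  obtain ⟨r, hr, hre⟩ := Submodule.mem_map.1 (v.2 e).2
  refine ⟨r, (contDiff_of_mem_Poly hr).continuous, e.ae_mem.mono fun x hx => ?_⟩
  have := congrFun hre x
  rw [Vh.normal, ← this]
  simp [hx]

lemma Vh.memLp_normal {T : Triangulation Ω} {k : ℕ} (v : Vh T k) (e : T.Edge) :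
    MemLp (v.normal e) 2 e.length := by
  obtain ⟨r, hr, hre⟩ := v.exists_normal_eq e
  exact (memLp_congr_ae hre).2 (e.memLp hr 2)

/-- The functional that defines the weak Laplacian, in coordinates. -/
def lapFunctional {T : Triangulation Ω} (nE : T.Edge → Plane) {k : ℕ} (v : Vh T k) (K : T.Elem)
    (q : Plane → ℝ) : ℝ :=
  -(∑ i, ∫ x, pd i (v.inner K) x * pd i q x ∂K.area)
    + ∑ e ∈ K.edges, ⟪nE e, K.outward e⟫ * ∫ x, v.normal e x * q x ∂e.length

lemma pd_add {φ ψ : Plane → ℝ} (h : ContDiff ℝ ∞ φ) (h' : ContDiff ℝ ∞ ψ) (i : Fin 2) :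
    pd i (φ + ψ) = pd i φ + pd i ψ := by
  ext x
  simp only [pd, Pi.add_apply]
  rw [fderiv_add (h.differentiable (by simp) x) (h'.differentiable (by simp) x)]
  rfl

lemma pd_smul {φ : Plane → ℝ} (h : ContDiff ℝ ∞ φ) (a : ℝ) (i : Fin 2) :
    pd i (a • φ) = a • pd i φ := by
  ext x
  simp only [pd, Pi.smul_apply]
  rw [fderiv_const_smul (h.differentiable (by simp) x)]
  rfl

lemma continuous_pd_of_mem_Poly {m : ℕ} {p : Plane → ℝ} (hp : p ∈ Poly m) (i : Fin 2) :
    Continuous (pd i p) := (contDiff_of_mem_Poly (pd_mem_Poly hp i)).continuous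

/-- The defining property of the weak Laplacian. -/
lemma integral_dw {T : Triangulation Ω} (nE : T.Edge → Plane) {k : ℕ} (v : Vh T k) (K : T.Elem)
    {q : Plane → ℝ} (hq : q ∈ Poly (k + 3)) :
    ∫ x, dw T nE v K x * q x ∂K.area = lapFunctional nE v K q := by
  have hvp := fun i => continuous_pd_of_mem_Poly (v.inner_mem_Poly K) i
  have hif : ∀ i, ∀ q ∈ Poly (k + 3), Integrable (fun x => pd i (v.inner K) x * pd i q x) K.area :=
    fun i q hq => K.integrable ((hvp i).mul (continuous_pd_of_mem_Poly hq i))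
  have hie : ∀ e : T.Edge, ∀ q ∈ Poly (k + 3), Integrable (fun x => v.normal e x * q x) e.length :=
    fun e q hq => MemLp.integrable_mul (v.memLp_normal e)
      (e.memLp (contDiff_of_mem_Poly hq).continuous 2)
  have hfun : ∀ q ∈ Poly (k + 3),
      -(∫ x, ⟪gradient (v.inner K) x, gradient q x⟫ ∂K.area)
        + ∑ e ∈ K.edges, ∫ x, v.normal e x * ⟪nE e, K.outward e⟫ * q x ∂e.length
      = lapFunctional nE v K q := by
    intro q hq
    rw [lapFunctional, ← integral_finsetSum _ fun i _ => hif i q hq]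
    congr 1
    · congr 2
      ext x
      simp_rw [inner_eq_sum, gradient_apply]
    · refine Finset.sum_congr rfl fun e _ => ?_
      rw [← integral_const_mul]
      congr 1; ext x; ring
  rw [← hfun q hq]
  refine integral_l2Rep K (k + 3) (fun p hp q hq => ?_) (fun a p hp => ?_) q hq
  · rw [hfun _ ((Poly (k + 3)).add_mem hp hq), hfun _ hp, hfun _ hq]
    simp only [lapFunctional]
    have h1 : ∀ i, ∫ x, pd i (v.inner K) x * pd i (p + q) x ∂K.area =
        (∫ x, pd i (v.inner K) x * pd i p x ∂K.area) +
          ∫ x, pd i (v.inner K) x * pd i q x ∂K.area := fun i => by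
      rw [← integral_add (hif i p hp) (hif i q hq),
        pd_add (contDiff_of_mem_Poly hp) (contDiff_of_mem_Poly hq)]
      congr 1; ext x; simp [mul_add]
    have h2 : ∀ e : T.Edge, ∫ x, v.normal e x * (p + q) x ∂e.length =
        (∫ x, v.normal e x * p x ∂e.length) + ∫ x, v.normal e x * q x ∂e.length := fun e => by
      rw [← integral_add (hie e p hp) (hie e q hq)]
      congr 1; ext x; simp [mul_add]
    simp_rw [h1, h2, mul_add, Finset.sum_add_distrib]
    ring
  · rw [hfun _ ((Poly (k + 3)).smul_mem a hp), hfun _ hp]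
    simp only [lapFunctional]
    have h1 : ∀ i, ∫ x, pd i (v.inner K) x * pd i (a • p) x ∂K.area =
        a * ∫ x, pd i (v.inner K) x * pd i p x ∂K.area := fun i => by
      rw [← integral_const_mul, pd_smul (contDiff_of_mem_Poly hp)]
      congr 1; ext x; simp; ring
    have h2 : ∀ e : T.Edge, ∫ x, v.normal e x * (a • p) x ∂e.length =
        a * ∫ x, v.normal e x * p x ∂e.length := fun e => by
      rw [← integral_const_mul]
      congr 1; ext x; simp; ring
    simp_rw [h1, h2, mul_left_comm _ a, ← Finset.mul_sum]
    ring

lemma lapFunctional_sub {T : Triangulation Ω} (nE : T.Edge → Plane) {k : ℕ} (v v' : Vh T k)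
    (K : T.Elem) {m : ℕ} {q : Plane → ℝ} (hq : q ∈ Poly m) :
    lapFunctional nE (v - v') K q = lapFunctional nE v K q - lapFunctional nE v' K q := by
  have hqe : ∀ e : T.Edge, MemLp q 2 e.length := fun e =>
    e.memLp (contDiff_of_mem_Poly hq).continuous 2
  have hie : ∀ (v : Vh T k) (e : T.Edge), Integrable (fun x => v.normal e x * q x) e.length :=
    fun v e => MemLp.integrable_mul (v.memLp_normal e) (hqe e)
  have hif : ∀ (v : Vh T k) i, Integrable (fun x => pd i (v.inner K) x * pd i q x) K.area :=
    fun v i => K.integrable ((continuous_pd_of_mem_Poly (v.inner_mem_Poly K) i).mul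
      (continuous_pd_of_mem_Poly hq i))
  have h1 : ∀ i, ∫ x, pd i ((v - v').inner K) x * pd i q x ∂K.area =
      (∫ x, pd i (v.inner K) x * pd i q x ∂K.area) -
        ∫ x, pd i (v'.inner K) x * pd i q x ∂K.area := fun i => by
    rw [← integral_sub (hif v i) (hif v' i)]
    have : (v - v').inner K = fun x => v.inner K x - v'.inner K x := rfl
    rw [this, pd_sub (contDiff_of_mem_Poly (v.inner_mem_Poly K))
      (contDiff_of_mem_Poly (v'.inner_mem_Poly K))]
    congr 1; ext x; ring
  have h2 : ∀ e : T.Edge, ∫ x, (v - v').normal e x * q x ∂e.length =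
      (∫ x, v.normal e x * q x ∂e.length) - ∫ x, v'.normal e x * q x ∂e.length := fun e => by
    rw [← integral_sub (hie v e) (hie v' e)]
    have : (v - v').normal e = fun x => v.normal e x - v'.normal e x := rfl
    rw [this]
    congr 1; ext x; ring
  simp only [lapFunctional, h1, h2, mul_sub, Finset.sum_sub_distrib]
  ring

/-- Linearity of `Δ_w` itself is not needed: its values are only paired with the polynomial `Δ_w v`,
and the functional defining it is linear in its argument. -/
lemma Ah_sub {T : Triangulation Ω} (nE : T.Edge → Plane) {k : ℕ} (a b v : Vh T k) :
    Ah T nE (a - b) v = Ah T nE a v - Ah T nE b v := by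
  simp only [Ah, prodT]
  rw [← Finset.sum_sub_distrib]
  refine Finset.sum_congr rfl fun K _ => ?_
  have hq := dw_mem_Poly nE v K
  rw [integral_dw nE _ K hq, integral_dw nE _ K hq, integral_dw nE _ K hq,
    lapFunctional_sub nE a b K hq]


/-! ### Weak derivatives and the continuous problem -/

/-- The fundamental lemma of the calculus of variations, applied to the difference. -/
lemma HasWeakPd.ae_eq (hΩ : IsOpen Ω) {i : Fin 2} {w g g' : Plane → ℝ} (hg : MemL2 Ω g)
    (hg' : MemL2 Ω g') (h : HasWeakPd Ω i w g) (h' : HasWeakPd Ω i w g') :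
    g =ᵐ[volume.restrict Ω] g' := by
  have hloc : LocallyIntegrableOn (fun x => g x - g' x) Ω :=
    locallyIntegrableOn_of_locallyIntegrable_restrict
      ((MemLp.sub hg hg').locallyIntegrable (by norm_num))
  have hae := hΩ.ae_eq_zero_of_integral_contDiff_smul_eq_zero hloc fun φ h1 h2 h3 => by
    have hφ : IsTestFun Ω φ := ⟨h1, h2, h3⟩
    have h4 := (h φ hφ).symm.trans (h' φ hφ)
    rw [← setIntegral_eq_integral_of_forall_compl_eq_zero (s := Ω)
      fun x hx => by rw [hφ.eq_zero hx, zero_smul]]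
    have h5 : ∫ x in Ω, φ x • (g x - g' x) = (∫ x in Ω, g x * φ x) - ∫ x in Ω, g' x * φ x := by
      rw [← integral_sub (hφ.integrable_mul hg) (hφ.integrable_mul hg')]
      congr 1; ext x; simp; ring
    rw [h5]; linarith
  filter_upwards [ae_restrict_of_ae hae, ae_restrict_mem hΩ.measurableSet] with x hx hxΩ
  exact sub_eq_zero.1 (hx hxΩ)

lemma HasWeakPd.congr {i : Fin 2} {w w' g : Plane → ℝ} (h : HasWeakPd Ω i w g)
    (hw : w =ᵐ[volume.restrict Ω] w') : HasWeakPd Ω i w' g := by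
  intro φ hφ
  rw [← h φ hφ]
  exact integral_congr_ae (hw.mono fun x hx => by simp only [hx])

lemma IsTestFun.memL2 {φ : Plane → ℝ} (hφ : IsTestFun Ω φ) : MemL2 Ω φ :=
  (hφ.smooth.continuous.memLp_of_hasCompactSupport hφ.compact).restrict Ω

lemma IsTestFun.pds {φ : Plane → ℝ} (hφ : IsTestFun Ω φ) (α : List (Fin 2)) :
    IsTestFun Ω (pds α φ) := by
  induction α with
  | nil => exact hφ
  | cons i α ih => exact ih.pd i

lemma IsTestFun.memH {φ : Plane → ℝ} (hφ : IsTestFun Ω φ) (m : ℕ) : MemH Ω m φ := by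
  induction m generalizing φ with
  | zero => exact hφ.memL2
  | succ m ih =>
    exact ⟨hφ.memL2, fun i => ⟨C0WG.pd i φ, hasWeakPd_of_contDiff hφ.smooth i, ih (hφ.pd i)⟩⟩

lemma IsTestFun.memH0 {φ : Plane → ℝ} (hφ : IsTestFun Ω φ) (m : ℕ) : MemH0 Ω m φ :=
  ⟨hφ.memH m, fun _ => φ, fun α => C0WG.pds α φ, fun _ => hφ, rfl, fun α _ =>
    ⟨(hφ.pds α).memL2, by simp [normL2]⟩⟩

/-- Allowing `w` to differ from `φ` on a null set makes the lemma iterable: `weakPd` of a test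
function is known only almost everywhere. -/
lemma IsTestFun.weakPd_ae_eq (hΩ : IsOpen Ω) {φ w : Plane → ℝ} (hφ : IsTestFun Ω φ)
    (hw : φ =ᵐ[volume.restrict Ω] w) (i : Fin 2) :
    C0WG.pd i φ =ᵐ[volume.restrict Ω] weakPd Ω i w := by
  have h1 : HasWeakPd Ω i w (C0WG.pd i φ) := (hasWeakPd_of_contDiff hφ.smooth i).congr hw
  have h2 := Classical.epsilon_spec (p := fun g : Plane → ℝ => MemL2 Ω g ∧ HasWeakPd Ω i w g)
    ⟨_, (hφ.pd i).memL2, h1⟩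
  exact HasWeakPd.ae_eq hΩ (hφ.pd i).memL2 h2.1 h1 h2.2

lemma IsTestFun.lap_ae_eq (hΩ : IsOpen Ω) {φ : Plane → ℝ} (hφ : IsTestFun Ω φ) :
    lap Ω φ =ᵐ[volume.restrict Ω] fun x => ∑ i, C0WG.pd i (C0WG.pd i φ) x := by
  have h : ∀ i, C0WG.pd i (C0WG.pd i φ) =ᵐ[volume.restrict Ω] weakPd Ω i (weakPd Ω i φ) := fun i =>
    (hφ.pd i).weakPd_ae_eq hΩ (hφ.weakPd_ae_eq hΩ EventuallyEq.rfl i) i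
  filter_upwards [h 0, h 1] with x h0 h1
  simp [lap, Fin.sum_univ_two, h0, h1]

/-- The biharmonic equation tested with `C_c^∞(Ω)`, integrated by parts once. -/
lemma IsBiharmonicSolution.test (hΩ : IsOpen Ω) {f u : Plane → ℝ}
    (hu : IsBiharmonicSolution Ω f u) (hreg : MemH Ω 1 (lap Ω u)) {φ : Plane → ℝ}
    (hφ : IsTestFun Ω φ) :
    ∑ i, ∫ x in Ω, weakPd Ω i (lap Ω u) x * pd i φ x = -∫ x in Ω, f x * φ x := by
  rw [← hu.2 φ (hφ.memH0 2)]
  have h1 : ∫ x in Ω, lap Ω u x * lap Ω φ x = ∑ i, ∫ x in Ω, lap Ω u x * pd i (pd i φ) x := by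
    rw [← integral_finsetSum _ fun i _ => (hφ.pd i).integrable_mul_pd hreg.memL2 i]
    refine integral_congr_ae ((hφ.lap_ae_eq hΩ).mono fun x hx => ?_)
    simp only [hx, Finset.mul_sum]
  rw [h1, ← Finset.sum_neg_distrib]
  refine Finset.sum_congr rfl fun i _ => ?_
  rw [(hreg.weakPd_spec i).2 _ (hφ.pd i), neg_neg]

lemma glue_eq_of_mem_interior {T : Triangulation Ω} {m : ℕ} (p : BrokenPoly T m) {K : T.Elem}
    {x : Plane} (hx : x ∈ interior K.cell) : glue p x = (p K : Plane → ℝ) x := by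
  classical
  rw [glue, Fintype.sum_eq_single K, indicator_of_mem hx]
  intro K' hK'
  exact indicator_of_notMem
    (fun h => Set.disjoint_left.1 (Triangulation.Elem.disjoint_interior hK') h hx) _

/-- The biharmonic equation tested with a broken polynomial in `H₀¹(Ω)`. -/
lemma IsBiharmonicSolution.test_glue {T : Triangulation Ω} (hΩ : IsPolygonalDomain Ω)
    {f u : Plane → ℝ} (hf : MemL2 Ω f) (hu : IsBiharmonicSolution Ω f u)
    (hreg : MemH Ω 1 (lap Ω u)) {m : ℕ} {p : BrokenPoly T m} (hp : MemH0 Ω 1 (glue p)) :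
    ∑ K : T.Elem, ∑ i, ∫ x, weakPd Ω i (lap Ω u) x * pd i (p K : Plane → ℝ) x ∂K.area =
      -∫ x in Ω, f x * glue p x := by
  obtain ⟨-, φ, G, hφ, hG, hlim⟩ := hp
  have hG0 := hlim [] (by simp)
  have hG1 : ∀ i : Fin 2, MemL2 Ω (G [i]) ∧
      Tendsto (fun n => eLpNorm (fun x => pd i (φ n) x - G [i] x) 2 (volume.restrict Ω)) atTop
        (𝓝 0) := fun i => hlim [i] (by simp)
  rw [hG] at hG0
  have hG0' : Tendsto (fun n => eLpNorm (fun x => φ n x - glue p x) 2 (volume.restrict Ω)) atTop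
      (𝓝 0) := hG0.2
  have hL2 : ∀ {χ : Plane → ℝ}, IsTestFun Ω χ → MemLp χ 2 (volume.restrict Ω) := fun h => h.memL2
  -- The `L²` limit of the derivatives is a weak derivative of the limit function.
  have hweak : ∀ i, HasWeakPd Ω i (glue p) (G [i]) := by
    intro i χ hχ
    have l1 := tendsto_integral_mul (fun n => hL2 (hφ n)) hG0.1 (hL2 (hχ.pd i)) hG0'
    have l2 := (tendsto_integral_mul (fun n => hL2 ((hφ n).pd i)) (hG1 i).1 (hL2 hχ) (hG1 i).2).neg
    exact tendsto_nhds_unique (l1.congr fun n => hasWeakPd_of_contDiff (hφ n).smooth i χ hχ) l2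
  -- By uniqueness on the interior of `K`, the global weak derivative is there the classical
  -- derivative of the polynomial.
  have hGK : ∀ (K : T.Elem) i, G [i] =ᵐ[K.area] pd i (p K : Plane → ℝ) := by
    intro K i
    have hKΩ := K.interior_subset hΩ
    rw [K.area_eq]
    have h1 := (hweak i).mono hΩ.isOpen hKΩ
    have h2 : HasWeakPd (interior K.cell) i (glue p) (pd i (p K : Plane → ℝ)) := by
      refine (hasWeakPd_of_contDiff (contDiff_of_mem_Poly (p K).2) i).congr ?_
      filter_upwards [ae_restrict_mem isOpen_interior.measurableSet] with x hx
      rw [glue_eq_of_mem_interior p hx]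
    have h3 : MemL2 (interior K.cell) (pd i (p K : Plane → ℝ)) := by
      rw [MemL2, ← K.area_eq]
      exact K.memLp (continuous_pd_of_mem_Poly (p K).2 i) 2
    exact HasWeakPd.ae_eq isOpen_interior ((hG1 i).1.mono hKΩ) h3 h1 h2
  have hw := fun i => (hreg.weakPd_spec i).1
  -- The equation for test functions passes to the limit, since only first derivatives of `φ n`
  -- occur in it.
  have hsum : ∑ i, ∫ x in Ω, weakPd Ω i (lap Ω u) x * G [i] x = -∫ x in Ω, f x * glue p x := by
    have l1 : Tendsto (fun n => ∑ i, ∫ x in Ω, pd i (φ n) x * weakPd Ω i (lap Ω u) x) atTop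
        (𝓝 (∑ i, ∫ x in Ω, G [i] x * weakPd Ω i (lap Ω u) x)) :=
      tendsto_finsetSum _ fun i _ =>
        tendsto_integral_mul (fun n => hL2 ((hφ n).pd i)) (hG1 i).1 (hw i) (hG1 i).2
    have l2 := (tendsto_integral_mul (fun n => hL2 (hφ n)) hG0.1 hf hG0').neg
    simp only [mul_comm] at l1 l2 ⊢
    refine tendsto_nhds_unique (l1.congr fun n => ?_) l2
    have := hu.test hΩ.isOpen hreg (hφ n)
    simpa only [mul_comm] using this
  rw [← hsum, Finset.sum_comm]
  refine Finset.sum_congr rfl fun i _ => ?_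
  have hi : IntegrableOn (fun x => weakPd Ω i (lap Ω u) x * G [i] x) Ω :=
    MemLp.integrable_mul (hw i) (hG1 i).1
  rw [T.setIntegral_eq_sum hΩ hi]
  refine Finset.sum_congr rfl fun K _ => ?_
  exact integral_congr_ae ((hGK K i).mono fun x hx => by simp only [hx])

/-! ### The error equation -/

/-- The core computation on one element. It trades `(π_h w, Δ_w v)_K` for the gradient term, which
the differential equation handles, and the term in `v_n`, which cancels between elements. -/
lemma Triangulation.Elem.error_identity {T : Triangulation Ω} (hΩ : IsPolygonalDomain Ω)
    (nE : T.Edge → Plane) {k : ℕ} {w : Plane → ℝ} (hw : MemH Ω 1 w) (v : Vh T k) (K : T.Elem) :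
    (∫ x, piH T k w K x * dw T nE v K x ∂K.area) -
      ∑ e ∈ K.edges, ∫ x, (trace e w x - piH T k w K x)
        * ⟪gradient (v.inner K) x - v.normal e x • nE e, K.outward e⟫ ∂e.length =
      -(∑ i, ∫ x, weakPd Ω i w x * pd i (v.inner K) x ∂K.area) +
        ∑ e ∈ K.edges, ⟪nE e, K.outward e⟫ * ∫ x, trace e w x * v.normal e x ∂e.length := by
  set π := piH T k w K with hπdef
  set p := v.inner K with hpdef
  have hπ : π ∈ Poly (k + 3) := piH_mem_Poly w K k
  have hp : p ∈ Poly (k + 2) := v.inner_mem_Poly K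
  have hπs := contDiff_of_mem_Poly hπ
  have hpps : ∀ i, ContDiff ℝ ∞ (pd i p) := fun i => contDiff_of_mem_Poly (pd_mem_Poly hp i)
  have h1 : ∫ x, π x * dw T nE v K x ∂K.area = lapFunctional nE v K π := by
    rw [← integral_dw nE v K hπ]
    simp only [mul_comm]
  have hg : ∀ e ∈ K.edges, MemLp (trace e w) 2 e.length := fun e he =>
    (isTraceFrom_trace hΩ hw he).1
  -- For each `i`, Green's formula makes both sides equal to integrals against `∂ᵢ∂ᵢ v₀`, once of
  -- `π` and once of `w`. These agree by the definition of the projection, as `∂ᵢ∂ᵢ v₀ ∈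
  -- ℙ_{k+3}(K)`.
  have h2 : ∀ i, (∑ e ∈ K.edges, K.outward e i * ∫ x, π x * pd i p x ∂e.length) -
      ∫ x, pd i p x * pd i π x ∂K.area =
      (∑ e ∈ K.edges, K.outward e i * ∫ x, trace e w x * pd i p x ∂e.length) -
        ∫ x, weakPd Ω i w x * pd i p x ∂K.area := by
    intro i
    rw [← K.green_smooth hπs (hpps i) i, ← K.green_trace hΩ hw
      (fun e he => isTraceFrom_trace hΩ hw he) (hpps i) i,
      integral_piH K (hw.memL2.memLp_area hΩ K) k
        (Poly_mono (by omega) (pd_mem_Poly (pd_mem_Poly hp i) i))]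
    simp only [mul_comm (pd i p _)]
    ring
  have h3 : ∀ e ∈ K.edges, ∫ x, (trace e w x - π x)
        * ⟪gradient p x - v.normal e x • nE e, K.outward e⟫ ∂e.length =
      (∑ i, K.outward e i * ∫ x, trace e w x * pd i p x ∂e.length) -
      (∑ i, K.outward e i * ∫ x, π x * pd i p x ∂e.length) -
      ⟪nE e, K.outward e⟫ * (∫ x, trace e w x * v.normal e x ∂e.length) +
      ⟪nE e, K.outward e⟫ * ∫ x, v.normal e x * π x ∂e.length := by
    intro e he
    have hge : MemLp (trace e w) 2 e.length := hg e he
    have hπe : MemLp π 2 e.length := e.memLp hπs.continuous 2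
    have hne := v.memLp_normal e
    have hpe : ∀ i, MemLp (pd i p) 2 e.length := fun i => e.memLp (hpps i).continuous 2
    have i1 : ∀ i, Integrable (fun x => K.outward e i * (trace e w x * pd i p x)) e.length :=
      fun i => (MemLp.integrable_mul hge (hpe i)).const_mul _
    have i2 : ∀ i, Integrable (fun x => K.outward e i * (π x * pd i p x)) e.length :=
      fun i => (MemLp.integrable_mul hπe (hpe i)).const_mul _
    have i3 : Integrable (fun x => ⟪nE e, K.outward e⟫ * (trace e w x * v.normal e x)) e.length :=
      (MemLp.integrable_mul hge hne).const_mul _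
    have i4 : Integrable (fun x => ⟪nE e, K.outward e⟫ * (v.normal e x * π x)) e.length :=
      (MemLp.integrable_mul hne hπe).const_mul _
    simp_rw [← integral_const_mul]
    have i1' : Integrable (fun x => ∑ i, K.outward e i * (trace e w x * pd i p x)) e.length :=
      integrable_finsetSum _ fun i _ => i1 i
    have i2' : Integrable (fun x => ∑ i, K.outward e i * (π x * pd i p x)) e.length :=
      integrable_finsetSum _ fun i _ => i2 i
    rw [← integral_finsetSum _ fun i _ => i1 i, ← integral_finsetSum _ fun i _ => i2 i,
      ← integral_sub i1' i2', ← integral_sub (by exact i1'.sub i2') i3,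
      ← integral_add (by exact (i1'.sub i2').sub i3) i4]
    congr 1
    ext x
    rw [inner_sub_left, inner_smul_left, inner_eq_sum (gradient p x)]
    simp only [gradient_apply, Fin.sum_univ_two, conj_trivial]
    ring
  rw [Finset.sum_congr rfl h3, h1, lapFunctional]
  simp only [Finset.sum_add_distrib, Finset.sum_sub_distrib]
  rw [Finset.sum_comm (s := K.edges), Finset.sum_comm (s := K.edges)]
  simp only [Fin.sum_univ_two]
  linear_combination h2 0 + h2 1

/-- The interelement jumps cancel. -/
lemma sum_trace_mul_normal {T : Triangulation Ω} (hΩ : IsPolygonalDomain Ω)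
    (nE : T.Edge → Plane) {k : ℕ} (w : Plane → ℝ) {v : Vh T k} (hv : v ∈ Vh0 T k) :
    ∑ K : T.Elem, ∑ e ∈ K.edges,
      ⟪nE e, K.outward e⟫ * ∫ x, trace e w x * v.normal e x ∂e.length = 0 := by
  rw [T.sum_comm]
  refine Finset.sum_eq_zero fun e _ => ?_
  -- The edge integral is the same from all elements, so the coefficient of it is `⟪n_e, ∑ n⟫`.
  rw [← Finset.sum_mul, ← inner_sum]
  by_cases hfr : e.cell ⊆ frontier Ω
  · have h0 : v.normal e = 0 := by
      rw [Vh.normal, hv e hfr]; rfl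
    simp [h0]
  · rcases e.elems.eq_empty_or_nonempty with h | h
    · simp [h]
    · rw [Triangulation.Edge.sum_outward hΩ h hfr, inner_zero_right, zero_mul]

theorem error_equation {T : Triangulation Ω} (hΩ : IsPolygonalDomain Ω)
    (nE : T.Edge → Plane) {k : ℕ} (Q0 : {w : Plane → ℝ // MemH Ω 2 w} → Sh T k)
    {f : Plane → ℝ} (hf : MemL2 Ω f) {u : Plane → ℝ} (hu : IsBiharmonicSolution Ω f u)
    (hreg : MemH Ω 1 (lap Ω u)) {uh : Vh T k} (huh : IsSchemeSolution T nE f uh)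
    {v : Vh T k} (hv : v ∈ Vh0 T k) :
    Ah T nE (Qh T nE Q0 ⟨u, hu.1.1⟩ - uh) v
      = ell1 T nE Q0 ⟨u, hu.1.1⟩ v + ell2 T nE ⟨u, hu.1.1⟩ v := by
  have hcont : ∀ K : T.Elem, ∀ q ∈ Poly (k + 3), Continuous q := fun K q hq =>
    (contDiff_of_mem_Poly hq).continuous
  have h1 : ell1 T nE Q0 ⟨u, hu.1.1⟩ v = Ah T nE (Qh T nE Q0 ⟨u, hu.1.1⟩) v -
      ∑ K : T.Elem, ∫ x, piH T k (lap Ω u) K x * dw T nE v K x ∂K.area := by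
    rw [ell1, Ah, prodT, prodT, ← Finset.sum_sub_distrib]
    refine Finset.sum_congr rfl fun K _ => ?_
    have hq := hcont K _ (dw_mem_Poly nE v K)
    have i1 : Integrable (fun x => dw T nE (Qh T nE Q0 ⟨u, hu.1.1⟩) K x * dw T nE v K x) K.area :=
      K.integrable ((hcont K _ (dw_mem_Poly nE _ K)).mul hq)
    have i2 : Integrable (fun x => piH T k (lap Ω u) K x * dw T nE v K x) K.area :=
      K.integrable ((hcont K _ (piH_mem_Poly _ K k)).mul hq)
    rw [← integral_sub i1 i2]
    congr 1; ext x; ring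
  have h2 := Finset.sum_congr (rfl : (Finset.univ : Finset T.Elem) = Finset.univ)
    fun K _ => K.error_identity hΩ nE hreg v
  rw [Finset.sum_sub_distrib, Finset.sum_add_distrib, sum_trace_mul_normal hΩ nE _ hv,
    Finset.sum_neg_distrib, add_zero] at h2
  have h3 := hu.test_glue hΩ hf hreg (p := (v.1 : BrokenPoly T (k + 2))) v.1.2
  have h4 : ell2 T nE ⟨u, hu.1.1⟩ v = ∑ K : T.Elem, ∑ e ∈ K.edges,
      ∫ x, (trace e (lap Ω u) x - piH T k (lap Ω u) K x)
        * ⟪gradient (v.inner K) x - v.normal e x • nE e, K.outward e⟫ ∂e.length := rfl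
  rw [Ah_sub, huh.2 v hv, h1, h4]
  change ∑ K : T.Elem, ∑ i, ∫ x, weakPd Ω i (lap Ω u) x * pd i (v.inner K) x ∂K.area = _ at h3
  -- `h2` expresses `(π_h Δu, Δ_w v) - ℓ₂` by `-(∇Δu, ∇v₀)`, and `h3` identifies the latter with
  -- `(f, v₀)`.
  linear_combination h2 - h3

end C0WG

end

/-- The error equation of the stabilizer-free `C⁰` weak Galerkin method. -/
theorem lemma4p2 (Ω : Set Plane) (hΩ : IsPolygonalDomain Ω) (T : Triangulation Ω)
    (nE : T.Edge → Plane) (hnE : IsNormalField T nE) (k : ℕ)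
    (Q0 : {w : Plane → ℝ // MemH Ω 2 w} → Sh T k)
    (f : Plane → ℝ) (hf : MemL2 Ω f)
    (u : Plane → ℝ) (hu : IsBiharmonicSolution Ω f u) (hreg : MemH Ω 1 (lap Ω u))
    (uh : Vh T k) (huh : IsSchemeSolution T nE f uh) :
    ∀ v ∈ Vh0 T k,
      Ah T nE (Qh T nE Q0 ⟨u, hu.1.1⟩ - uh) v
        = ell1 T nE Q0 ⟨u, hu.1.1⟩ v + ell2 T nE ⟨u, hu.1.1⟩ v := by
  intro v hv
  exact error_equation hΩ nE Q0 hf hu hreg huh hv
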